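/- Let $n\ge 1$, $c\ge 0$, $\rho>0$ be given. Let $K=B_1(0)\times\mathbb R\times\mathbb C^n$, with $B_1(0)\subset\mathbb C^{n-1}$ the open unit ball and coordinates $(X^1,\dots,X^{n-1},\tilde\phi,w^0,\dots,w^{n-1})$, and let $\bar N=(0,\infty)\times K$ carry the one-loop deformed metric of the symmetric space $\mathrm{SU}(n,2)/\mathrm S(\mathrm U(n)\times\mathrm U(2))$, $g^c=\frac{1}{4\rho^2}\frac{\rho+2c}{\rho+c}d\rho^2+g^c_\rho$, where $$\begin{aligned}g_\rho^c={}&\tfrac{\rho+c}{\rho}\tfrac{1}{1-\|X\|^2}\Big(\sum_a|dX^a|^2+\tfrac{1}{1-\|X\|^2}\Big|\sum_a\bar X^adX^a\Big|^2\Big)\\&+\tfrac{1}{4\rho^2}\tfrac{\rho+c}{\rho+2c}\Big(d\tilde\phi-4\,\mathrm{Im}\big(\bar w^0dw^0-\sum_a\bar w^adw^a\big)+\tfrac{2c}{1-\|X\|^2}\mathrm{Im}\sum_a\bar X^adX^a\Big)^2\\&-\tfrac2\rho\Big(|dw^0|^2-\sum_a|dw^a|^2\Big)+\tfrac{\rho+c}{\rho^2}\tfrac{4}{1-\|X\|^2}\Big|dw^0+\sum_aX^adw^a\Big|^2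 .\end{aligned}$$ Let $\bar N_\rho=\{\rho\}\times K$ be the level set of $\rho$ with the induced metric $g_\rho^c$, and $p_\rho=(\rho,0)$. Number the rows and columns of complex $n\times n$ matrices $0,\dots,n-1$, let $U_a$ be the matrix with single entry $1$ at $(0,a)$, let $\sigma(A)=-I\bar A^\top I$ with $I=\mathrm{diag}(-1,1,\dots,1)$, and put $B_a=(1+\delta_{1a})U_a-[U_a,\sigma(U_1)]$, $B_a^R=\frac12(B_a+\sigma(B_a))$, $B_a^I=\frac1{2i}(B_a-\sigma(B_a))$ for $1\le a\le n-1$. Let $\mathfrak b=\mathrm{span}_{\mathbb R}\{B_a^R,B_a^I\}\subset\mathfrak{su}(1,n-1)$ (the solvable Iwasawa subalgebra), let $\mathfrak{heis}_{2n+1}=\mathbb C^n\oplus\mathbb RZ$ with $Z$ central and $[v,u]=\mathrm{Im}(\bar v^0u^0-\sum_a\bar v^au^a)Z$, and let $\mathfrak l=\mathfrak b\ltimes\mathfrak{heis}_{2n+1}$ with $[A,v+sZ]=-A^\top v$. For $x=A+v+sZ\in\mathfrak l$ let $\alpha(x)$ be the vector field on $K$ with components, with $\zeta=(1,X)$, $$\dot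 X^a=(A\zeta)_a-X^a(A\zeta)_0,\qquad \dot{\tilde\phi}=-2c\,\mathrm{Im}(A\zeta)_0+\sqrt2\,\mathrm{Im}\big(\bar v^0w^0-\sum_a\bar v^aw^a\big)+s,\qquad \dot w=-A^\top w+\tfrac{1}{2\sqrt2}v .$$ (0) $\mathfrak l$ is solvable, and $\alpha$ is the infinitesimal version of a simply transitive isometric action on $(\bar N_\rho,g^c_\rho)$ of the simply connected Lie group $L=B\ltimes\mathrm{Heis}_{2n+1}$ with Lie algebra $\mathfrak l$: the fields $\alpha(x)$ are smooth, complete and Killing, $[\alpha(x),\alpha(y)]=-\alpha([x,y])$, and $x\mapsto\alpha(x)|_q$ is a linear isomorphism $\mathfrak l\to T_q\bar N_\rho$ for every $q$. Accordingly regard $g_\rho^c$ as the left-invariant metric on $L$ given by the inner product $\langle x,y\rangle=g^c_\rho(\alpha(x)|_{p_\rho},\alpha(y)|_{p_\rho})$ on $\mathfrak l$. A left-invariant metric on a simply connected solvable (nilpotent) Lie group is called a solvsoliton (nilsoliton) if its Ricci endomorphism on the Lie algebra is $\lambda\,\mathrm{Id}+D$ for some $\lambda\in\mathbb R$ and some derivation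 $D$ of the Lie algebra. Then: 1. If $n=1$, so that $\mathfrak l=\mathfrak{heis}_3$, then $(\bar N_\rho,g^c_\rho)$ is a nilsoliton for all $c\ge0$, $\rho>0$. 2. If $n>1$ and $c=0$, then $(\bar N_\rho,g^0_\rho)$ is a solvsoliton for all $\rho>0$. 3. If $n>1$ and $c>0$, then $(\bar N_\rho,g^c_\rho)$ is not a solvsoliton, for any $\rho>0$; moreover, the operator $\mathrm{ad}(B_1^R)$ on $\mathfrak l$ is not normal with respect to $\langle\cdot,\cdot\rangle$. -/

import Mathlib

noncomputable section

open scoped ContDiff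

namespace OneLoop

/-! ## Algebraic Ricci solitons on Lie groups with a left-invariant metric -/

section LeftInvariant

/-- A left-invariant Riemannian metric on the simply connected Lie group with Lie algebra `𝔤`,
i.e. an inner product on `𝔤`. -/
structure LeftInvariantMetric (𝔤 : Type*) [LieRing 𝔤] [LieAlgebra ℝ 𝔤] where
  form : LinearMap.BilinForm ℝ 𝔤
  symm : ∀ x y, form x y = form y x
  pos : ∀ x, x ≠ 0 → 0 < form x x

variable {𝔤 : Type*} [LieRing 𝔤] [LieAlgebra ℝ 𝔤]

namespace LeftInvariantMetric

theorem nondegenerate (g : LeftInvariantMetric 𝔤) : g.form.Nondegenerate := by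
  refine ⟨fun x hx => ?_, fun x hx => ?_⟩ <;>
  · by_contra h
    exact (g.pos x h).ne' (hx x)

variable [FiniteDimensional ℝ 𝔤]

/-- The linear form `z ↦ ½ (g([x,y],z) - g([y,z],x) + g([z,x],y))` of the Koszul formula. -/
def koszul (g : LeftInvariantMetric 𝔤) (x y : 𝔤) : Module.Dual ℝ 𝔤 where
  toFun z := (1 / 2 : ℝ) * (g.form ⁅x, y⁆ z - g.form ⁅y, z⁆ x + g.form ⁅z, x⁆ y)
  map_add' a b := by simp; ring
  map_smul' r a := by simp; ring

/-- The Levi-Civita connection `∇_x y` of the left-invariant metric, on left-invariant vector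
fields: the unique solution of the Koszul formula `g(∇_x y, z) = koszul x y z`. -/
def nabla (g : LeftInvariantMetric 𝔤) (x y : 𝔤) : 𝔤 :=
  (g.form.toDual g.nondegenerate).symm (g.koszul x y)

theorem form_nabla (g : LeftInvariantMetric 𝔤) (x y z : 𝔤) :
    g.form (g.nabla x y) z
      = (1 / 2 : ℝ) * (g.form ⁅x, y⁆ z - g.form ⁅y, z⁆ x + g.form ⁅z, x⁆ y) :=
  LinearMap.BilinForm.apply_toDual_symm_apply (hB := g.nondegenerate) (g.koszul x y) z

theorem form_ext (g : LeftInvariantMetric 𝔤) {a b : 𝔤}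
    (h : ∀ z, g.form a z = g.form b z) : a = b :=
  (g.form.toDual g.nondegenerate).injective (LinearMap.ext h)

theorem nabla_add_left (g : LeftInvariantMetric 𝔤) (x x' y : 𝔤) :
    g.nabla (x + x') y = g.nabla x y + g.nabla x' y :=
  g.form_ext fun z => by simp [form_nabla]; ring

theorem nabla_smul_left (g : LeftInvariantMetric 𝔤) (r : ℝ) (x y : 𝔤) :
    g.nabla (r • x) y = r • g.nabla x y :=
  g.form_ext fun z => by simp [form_nabla]; ring

theorem nabla_add_right (g : LeftInvariantMetric 𝔤) (x y y' : 𝔤) :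
    g.nabla x (y + y') = g.nabla x y + g.nabla x y' :=
  g.form_ext fun z => by simp [form_nabla]; ring

theorem nabla_smul_right (g : LeftInvariantMetric 𝔤) (r : ℝ) (x y : 𝔤) :
    g.nabla x (r • y) = r • g.nabla x y :=
  g.form_ext fun z => by simp [form_nabla]; ring

/-- The curvature tensor `R(x,y)z = ∇_x ∇_y z - ∇_y ∇_x z - ∇_[x,y] z`, as a linear function
of its first argument `x`. -/
def curvature (g : LeftInvariantMetric 𝔤) (y z : 𝔤) : 𝔤 →ₗ[ℝ] 𝔤 where
  toFun x := g.nabla x (g.nabla y z) - g.nabla y (g.nabla x z) - g.nabla ⁅x, y⁆ z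
  map_add' a b := by
    simp only [nabla_add_left, nabla_add_right, add_lie]; abel
  map_smul' r a := by
    simp only [nabla_smul_left, nabla_smul_right, smul_lie, smul_sub, RingHom.id_apply]

/-- The Ricci tensor `Ric(y,z) = tr (x ↦ R(x,y)z)`, as a linear function of `z`. -/
def ricciTensor (g : LeftInvariantMetric 𝔤) (y : 𝔤) : Module.Dual ℝ 𝔤 where
  toFun z := LinearMap.trace ℝ 𝔤 (g.curvature y z)
  map_add' a b := by
    rw [← map_add]; congr 1; ext x
    simp only [curvature, nabla_add_right, LinearMap.coe_mk, AddHom.coe_mk, LinearMap.add_apply]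
    abel
  map_smul' r a := by
    rw [← map_smul]; congr 1; ext x
    simp only [curvature, nabla_smul_right, LinearMap.coe_mk, AddHom.coe_mk,
      LinearMap.smul_apply, smul_sub, RingHom.id_apply]

/-- The Ricci endomorphism: `g(ric y, z) = Ric(y,z)`. -/
def ricci (g : LeftInvariantMetric 𝔤) (y : 𝔤) : 𝔤 :=
  (g.form.toDual g.nondegenerate).symm (g.ricciTensor y)

/-- `ric = λ Id + D` for some real `λ` and some derivation `D` of the Lie algebra. -/
def IsAlgebraicRicciSoliton (g : LeftInvariantMetric 𝔤) : Prop :=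
  ∃ (l : ℝ) (D : LieDerivation ℝ 𝔤 𝔤), ∀ x, g.ricci x = l • x + D x

/-- An algebraic Ricci soliton on a solvable Lie group. -/
def IsSolvsoliton (g : LeftInvariantMetric 𝔤) : Prop :=
  LieAlgebra.IsSolvable 𝔤 ∧ g.IsAlgebraicRicciSoliton

/-- An algebraic Ricci soliton on a nilpotent Lie group. -/
def IsNilsoliton (g : LeftInvariantMetric 𝔤) : Prop :=
  LieRing.IsNilpotent 𝔤 ∧ g.IsAlgebraicRicciSoliton

/-- The endomorphism `f` commutes with its adjoint with respect to `g`. -/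
def IsNormal (g : LeftInvariantMetric 𝔤) (f : Module.End ℝ 𝔤) : Prop :=
  Commute f (g.form.leftAdjointOfNondegenerate g.nondegenerate f)

end LeftInvariantMetric

end LeftInvariant

/-! ## Infinitesimal simply transitive isometric actions -/

section Action

variable {E : Type*} [NormedAddCommGroup E] [NormedSpace ℝ E]

/-- `V` is a Killing field, on the open set `K`, of the Riemannian metric `g`: at all `p ∈ K`
and for all constant vectors `u, w`,
`V (g(u,w)) + g(DV(u), w) + g(u, DV(w)) = 0`, i.e. the Lie derivative of `g` vanishes. -/
def IsKillingOn (K : Set E) (g : E → E → E → ℝ) (V : E → E) : Prop :=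
  ∀ p ∈ K, ∀ u w : E,
    HasDerivAt (fun t : ℝ => g (p + t • V p) u w)
      (-(g p (fderiv ℝ V p u) w + g p u (fderiv ℝ V p w))) 0

/-- All integral curves of `V` in `K` exist for all times. -/
def IsCompleteOn (K : Set E) (V : E → E) : Prop :=
  ∀ p ∈ K, ∃ γ : ℝ → E, γ 0 = p ∧ ∀ t, γ t ∈ K ∧ HasDerivAt γ (V (γ t)) t

/-- `α` is the infinitesimal action of the Lie algebra `𝔤` on the Riemannian manifold `(K, g)`
(`K` an open set) given by a simply transitive isometric left action, on a simply connected `K`,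
of the simply connected Lie group of `𝔤`: fundamental vector fields are smooth, complete and
Killing, `α` is an anti-homomorphism, and it identifies `𝔤` with each tangent space. -/
structure IsSimplyTransitiveIsometricAction {𝔤 : Type*} [LieRing 𝔤] [LieAlgebra ℝ 𝔤]
    (K : Set E) (g : E → E → E → ℝ) (α : E → 𝔤 →ₗ[ℝ] E) : Prop where
  smooth : ∀ x, ContDiffOn ℝ ∞ (fun q => α q x) K
  anti_hom : ∀ x y, ∀ q ∈ K,
    VectorField.lieBracket ℝ (fun q => α q x) (fun q => α q y) q = -α q ⁅x, y⁆
  killing : ∀ x, IsKillingOn K g (fun q => α q x)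
  complete : ∀ x, IsCompleteOn K (fun q => α q x)
  bijective : ∀ q ∈ K, Function.Bijective (α q)

end Action

/-! ## The one-loop deformed metric

Throughout, `d = n - 1` where `4n` is the real dimension of the quaternionic Kähler manifold. -/

section Metric

open ComplexConjugate

/-- Coordinates `(X, φ, w)` with `X = (X¹, …, X^d) ∈ ℂ^d`, `φ ∈ ℝ` and
`w = (w⁰, …, w^d) ∈ ℂ^{d+1}`. -/
abbrev Coord (d : ℕ) : Type := (Fin d → ℂ) × ℝ × (Fin (d + 1) → ℂ)

/-- `K = B₁(0) × ℝ × ℂ^{d+1}` with `B₁(0) ⊆ ℂ^d` the open Euclidean unit ball. -/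
def levelDomain (d : ℕ) : Set (Coord d) := {q | ∑ a, Complex.normSq (q.1 a) < 1}

/-- The polarization of the real quadratic form `z ↦ |z|²` on `ℂ`. -/
def reInner (z w : ℂ) : ℝ := (conj z * w).re

variable {d : ℕ}

/-- The function `1 - ‖X‖²`. -/
def hFun (q : Coord d) : ℝ := 1 - ∑ a, Complex.normSq (q.1 a)

/-- The one-form `∑ X̄^a dX^a` at `q`. -/
def xForm (q u : Coord d) : ℂ := ∑ a, conj (q.1 a) * u.1 a

/-- The one-form `dφ - 4 Im(w̄⁰ dw⁰ - ∑ w̄^a dw^a) + (2c/(1-‖X‖²)) Im(∑ X̄^a dX^a)` at `q`. -/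
def phiForm (c : ℝ) (q u : Coord d) : ℝ :=
  u.2.1 - 4 * (conj (q.2.2 0) * u.2.2 0 - ∑ a : Fin d, conj (q.2.2 a.succ) * u.2.2 a.succ).im
    + 2 * c / hFun q * (xForm q u).im

/-- The one-form `dw⁰ + ∑ X^a dw^a` at `q`. -/
def wForm (q u : Coord d) : ℂ := u.2.2 0 + ∑ a : Fin d, q.1 a * u.2.2 a.succ

/-- The one-loop deformed metric `g^c` on `N̄ = (0,∞) × K`, at the point `p = (ρ, X, φ, w)`,
evaluated on the tangent vectors `u`, `v` (polarized). -/
def oneLoopMetric (c : ℝ) (p u v : ℝ × Coord d) : ℝ :=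
  1 / (4 * p.1 ^ 2) * ((p.1 + 2 * c) / (p.1 + c)) * (u.1 * v.1)
  + (p.1 + c) / p.1 * (1 / hFun p.2) *
      (∑ a, reInner (u.2.1 a) (v.2.1 a)
        + 1 / hFun p.2 * reInner (xForm p.2 u.2) (xForm p.2 v.2))
  + 1 / (4 * p.1 ^ 2) * ((p.1 + c) / (p.1 + 2 * c)) * (phiForm c p.2 u.2 * phiForm c p.2 v.2)
  - 2 / p.1 * (reInner (u.2.2.2 0) (v.2.2.2 0)
      - ∑ a : Fin d, reInner (u.2.2.2 a.succ) (v.2.2.2 a.succ))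
  + (p.1 + c) / p.1 ^ 2 * (4 / hFun p.2) * reInner (wForm p.2 u.2) (wForm p.2 v.2)

/-- The metric `g_ρ^c` induced by `g^c` on the level set `N̄_ρ = {ρ} × K ≅ K`. -/
def levelMetric (c ρ : ℝ) (q u v : Coord d) : ℝ := oneLoopMetric c (ρ, q) (0, u) (0, v)

end Metric

/-! ## The solvable Lie algebra `𝔩 = 𝔟 ⋉ 𝔥𝔢𝔦𝔰_{2n+1}` -/

section LieAlg

open Matrix ComplexConjugate

variable (d : ℕ)

/-- Complex `n × n` matrices, `n = d + 1`, with rows and columns numbered `0, 1, …, d`. -/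
abbrev Mat : Type := Matrix (Fin (d + 1)) (Fin (d + 1)) ℂ

variable {d}

instance matLieRing : LieRing (Mat d) := LieRing.ofAssociativeRing

/-- `I = diag(-1, 1, …, 1)`. -/
def sgn : Mat d := Matrix.diagonal (Fin.cons (-1) (fun _ => 1))

/-- The anti-linear involution `σ(A) = -I Ā^⊤ I` of `𝔤𝔩(n,ℂ)`. -/
def sigma (A : Mat d) : Mat d := -(sgn * Aᴴ * sgn)

theorem sgn_mul_sgn : (sgn : Mat d) * sgn = 1 := by
  rw [sgn, Matrix.diagonal_mul_diagonal, ← Matrix.diagonal_one]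
  congr 1; ext i; refine Fin.cases ?_ (fun i => ?_) i <;> simp

theorem sgn_conjTranspose : (sgn : Mat d)ᴴ = sgn := by
  rw [sgn, Matrix.diagonal_conjTranspose]
  congr 1; ext i; refine Fin.cases ?_ (fun i => ?_) i <;> simp

theorem sigma_sigma (A : Mat d) : sigma (sigma A) = A := by
  simp only [sigma, Matrix.conjTranspose_neg, Matrix.conjTranspose_mul, sgn_conjTranspose,
    Matrix.conjTranspose_conjTranspose, Matrix.mul_neg, Matrix.neg_mul, neg_neg]
  rw [← Matrix.mul_assoc, ← Matrix.mul_assoc, sgn_mul_sgn, Matrix.one_mul, Matrix.mul_assoc,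
    sgn_mul_sgn, Matrix.mul_one]

theorem sigma_add (A B : Mat d) : sigma (A + B) = sigma A + sigma B := by
  simp [sigma, Matrix.mul_add, Matrix.add_mul, add_comm]

theorem sigma_smul (r : ℂ) (A : Mat d) : sigma (r • A) = conj r • sigma A := by
  simp [sigma]

theorem sigma_mul (A B : Mat d) : sigma (A * B) = -(sigma B * sigma A) := by
  simp only [sigma, Matrix.conjTranspose_mul, Matrix.mul_neg, Matrix.neg_mul, neg_neg]
  congr 1
  rw [Matrix.mul_assoc (sgn * Bᴴ), ← Matrix.mul_assoc sgn (sgn * Aᴴ), ← Matrix.mul_assoc sgn sgn,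
    sgn_mul_sgn, Matrix.one_mul]
  simp only [Matrix.mul_assoc]

/-- The real Lie algebra `𝔲(1,n-1)`, the fixed points of `σ`. -/
def uLie (d : ℕ) : LieSubalgebra ℝ (Mat d) where
  carrier := {A | sigma A = A}
  add_mem' {A B} hA hB := by
    simp only [Set.mem_ofPred_eq] at *; rw [sigma_add, hA, hB]
  zero_mem' := by simp [sigma]
  smul_mem' r A hA := by
    simp only [Set.mem_ofPred_eq] at *
    have h := sigma_smul (r : ℂ) A
    rw [hA, Complex.conj_ofReal] at h
    exact h
  lie_mem' {A B} hA hB := by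
    have hA' : sigma A = A := hA
    have hB' : sigma B = B := hB
    change sigma (A * B - B * A) = A * B - B * A
    have hn : sigma (-(B * A)) = - sigma (B * A) := by
      have := sigma_smul (-1 : ℂ) (B * A)
      simpa using this
    rw [sub_eq_add_neg, sigma_add, hn, sigma_mul, sigma_mul, hA', hB']
    abel

/-- `Re(A) = ½ (A + σ(A))`. -/
def reU (A : Mat d) : uLie d :=
  ⟨(1 / 2 : ℂ) • (A + sigma A), by
    change sigma _ = _
    rw [sigma_smul, sigma_add, sigma_sigma, add_comm (sigma A) A]; congr 1; simp [map_ofNat]⟩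

/-- `Im(A) = (1/2i) (A - σ(A))`. -/
def imU (A : Mat d) : uLie d :=
  ⟨(1 / (2 * Complex.I)) • (A - sigma A), by
    change sigma _ = _
    have h : sigma (A - sigma A) = -(A - sigma A) := by
      have := sigma_smul (-1 : ℂ) (sigma A)
      rw [sub_eq_add_neg, sigma_add]
      simp only [neg_smul, one_smul, map_neg, map_one, sigma_sigma] at this
      rw [this]; abel
    rw [sigma_smul, h, smul_neg, ← neg_smul]
    congr 1
    simp [map_ofNat]⟩

/-- `U_a`, with single entry `1` in position `(0,a)`; `a : Fin d` stands for `a + 1` in the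
numbering `1, …, d`. -/
def uMat (a : Fin d) : Mat d := Matrix.single 0 a.succ 1

/-- The first element of `Fin d`, given any element. -/
def firstIdx (a : Fin d) : Fin d := ⟨0, lt_of_le_of_lt (Nat.zero_le _) a.isLt⟩

/-- `B_a = (1 + δ_{1a}) U_a - [U_a, σ(U_1)]`. -/
def bMat (a : Fin d) : Mat d :=
  (1 + if a = firstIdx a then 1 else 0 : ℂ) • uMat a - ⁅uMat a, sigma (uMat (firstIdx a))⁆

/-- `B_a^R = Re(B_a)`. -/
def bR (a : Fin d) : uLie d := reU (bMat a)

/-- `B_a^I = Im(B_a)`. -/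
def bI (a : Fin d) : uLie d := imU (bMat a)

theorem sigma_uMat (a : Fin d) : sigma (uMat a) = Matrix.single a.succ 0 1 := by
  ext i j
  simp only [sigma, sgn, uMat, Matrix.neg_apply, Matrix.diagonal_mul, Matrix.mul_diagonal,
    Matrix.conjTranspose_apply, Matrix.single_apply]
  refine Fin.cases ?_ (fun i => ?_) i <;> refine Fin.cases ?_ (fun j => ?_) j <;>
    simp [Fin.succ_ne_zero, (Fin.succ_ne_zero _).symm]

theorem sigma_single_zero (a : Fin d) : sigma (Matrix.single a.succ 0 1) = uMat a := by
  rw [← sigma_uMat, sigma_sigma]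

theorem lie_uMat_sigma (a b : Fin d) :
    ⁅uMat a, sigma (uMat b)⁆
      = (if a = b then 1 else 0 : ℂ) • Matrix.single 0 0 1 - Matrix.single b.succ a.succ (1 : ℂ) := by
  rw [LieRing.of_associative_ring_bracket, sigma_uMat, uMat, Matrix.single_mul_single_same]
  by_cases h : a = b
  · subst h; simp
  · simp [h, Matrix.single_mul_single_of_ne]

theorem sigma_lie (A B : Mat d) : sigma ⁅A, B⁆ = ⁅sigma A, sigma B⁆ := by
  simp only [LieRing.of_associative_ring_bracket]
  have h := sigma_smul (-1 : ℂ) (B * A)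
  simp only [neg_smul, one_smul, map_neg, map_one] at h
  rw [sub_eq_add_neg, sigma_add, h, sigma_mul, sigma_mul]
  abel

theorem bMat_eq (a : Fin d) : bMat a
    = (1 + if a = firstIdx a then 1 else 0 : ℂ) • Matrix.single 0 a.succ (1 : ℂ)
      - ((if a = firstIdx a then 1 else 0 : ℂ) • Matrix.single 0 0 1
          - Matrix.single (firstIdx a).succ a.succ (1 : ℂ)) := by
  rw [bMat, lie_uMat_sigma, uMat]

theorem sigma_bMat_eq (a : Fin d) : sigma (bMat a)
    = (1 + if a = firstIdx a then 1 else 0 : ℂ) • Matrix.single a.succ 0 (1 : ℂ)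
      + ((if a = firstIdx a then 1 else 0 : ℂ) • Matrix.single 0 0 1
          - Matrix.single a.succ (firstIdx a).succ (1 : ℂ)) := by
  have h := sigma_smul (-1 : ℂ) ⁅uMat a, sigma (uMat (firstIdx a))⁆
  simp only [neg_smul, one_smul, map_neg, map_one] at h
  rw [bMat, sub_eq_add_neg, sigma_add, h, sigma_lie, sigma_sigma, sigma_smul, ← lie_skew,
    neg_neg, lie_uMat_sigma, sigma_uMat]
  by_cases e : a = firstIdx a
  · simp [← e]
  · simp [e, Ne.symm e]

/-- The null vector `η = e₀ + e₁`. -/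
def etaV (a : Fin d) : Fin (d + 1) → ℂ := Pi.single 0 1 + Pi.single (firstIdx a).succ 1

/-- The null vector `ν = e₀ - e₁`. -/
def nuV (a : Fin d) : Fin (d + 1) → ℂ := Pi.single 0 1 - Pi.single (firstIdx a).succ 1

theorem coe_bR_first (a : Fin d) (h : a = firstIdx a) :
    (bR a : Mat d) = Matrix.single 0 a.succ 1 + Matrix.single a.succ 0 1 := by
  simp only [bR, reU]
  rw [sigma_bMat_eq, bMat_eq, ← h, if_pos rfl]
  module

theorem coe_bI_first (a : Fin d) (h : a = firstIdx a) :
    (bI a : Mat d) = Complex.I • Matrix.vecMulVec (etaV a) (nuV a) := by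
  simp only [bI, imU]
  have e : (1 / (2 * Complex.I)) = -Complex.I / 2 := by
    field_simp; simp
  rw [sigma_bMat_eq, bMat_eq, e, etaV, nuV, ← h, if_pos rfl]
  simp only [Matrix.add_vecMulVec, Matrix.vecMulVec_sub,
    ← Matrix.single_eq_single_vecMulVec_single]
  module

theorem coe_bR_ne (a : Fin d) (h : a ≠ firstIdx a) :
    (bR a : Mat d) = (1 / 2 : ℂ) • (Matrix.vecMulVec (etaV a) (Pi.single a.succ 1)
      + Matrix.vecMulVec (Pi.single a.succ 1) (nuV a)) := by
  simp only [bR, reU]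
  rw [sigma_bMat_eq, bMat_eq, etaV, nuV, if_neg h]
  simp only [Matrix.add_vecMulVec, Matrix.vecMulVec_sub,
    ← Matrix.single_eq_single_vecMulVec_single]
  module

theorem coe_bI_ne (a : Fin d) (h : a ≠ firstIdx a) :
    (bI a : Mat d) = (-Complex.I / 2) • (Matrix.vecMulVec (etaV a) (Pi.single a.succ 1)
      - Matrix.vecMulVec (Pi.single a.succ 1) (nuV a)) := by
  simp only [bI, imU]
  have e : (1 / (2 * Complex.I)) = -Complex.I / 2 := by
    field_simp; simp
  rw [sigma_bMat_eq, bMat_eq, e, etaV, nuV, if_neg h]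
  simp only [Matrix.add_vecMulVec, Matrix.vecMulVec_sub,
    ← Matrix.single_eq_single_vecMulVec_single]
  module

theorem firstIdx_eq (a b : Fin d) : firstIdx a = firstIdx b := rfl

theorem nuV_dot_etaV (a b : Fin d) : nuV a ⬝ᵥ etaV b = 0 := by
  simp [nuV, etaV, firstIdx_eq b a, dotProduct_add]

theorem nuV_dot_single (a b : Fin d) (h : b ≠ firstIdx b) :
    nuV a ⬝ᵥ Pi.single b.succ 1 = 0 := by
  rw [firstIdx_eq b a] at h
  simp [nuV, h, Fin.succ_ne_zero]

theorem single_dot_etaV (a b : Fin d) (h : b ≠ firstIdx b) :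
    Pi.single b.succ (1 : ℂ) ⬝ᵥ etaV a = 0 := by
  rw [firstIdx_eq b a] at h
  simp [etaV, h, Fin.succ_ne_zero]

theorem single_dot_single (a b : Fin d) :
    (Pi.single a.succ (1 : ℂ) : Fin (d + 1) → ℂ) ⬝ᵥ Pi.single b.succ 1
      = if a = b then 1 else 0 := by
  simp [Pi.single_apply, eq_comm]

/-- The bracket of two elements of `𝔤₁ = span {B_a^R, B_a^I | a ≥ 2}`. -/
theorem lie_aux (a b : Fin d) (ha : a ≠ firstIdx a) (hb : b ≠ firstIdx b) (s t s' t' : ℂ) :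
    ⁅s • Matrix.vecMulVec (etaV a) (Pi.single a.succ 1)
        + t • Matrix.vecMulVec (Pi.single a.succ 1) (nuV a),
      s' • Matrix.vecMulVec (etaV b) (Pi.single b.succ 1)
        + t' • Matrix.vecMulVec (Pi.single b.succ 1) (nuV b)⁆
      = (if a = b then s * t' - s' * t else 0) • Matrix.vecMulVec (etaV a) (nuV a) := by
  have e1 : etaV b = etaV a := rfl
  have e2 : nuV b = nuV a := rfl
  rw [e1, e2, LieRing.of_associative_ring_bracket]
  simp only [mul_add, add_mul, smul_mul_smul_comm, Matrix.vecMulVec_mul_vecMulVec,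
    single_dot_etaV a a ha, single_dot_etaV a b hb, nuV_dot_single a a ha,
    nuV_dot_single a b hb, nuV_dot_etaV, single_dot_single, eq_comm (a := b)]
  by_cases h : a = b
  · subst h; simp; module
  · simp [h]

theorem bR_first_mul (a b : Fin d) (h : a = firstIdx a) (v : Fin (d + 1) → ℂ) :
    (bR a : Mat d) * Matrix.vecMulVec (etaV b) v = Matrix.vecMulVec (etaV b) v := by
  have e1 : etaV b = etaV a := rfl
  rw [coe_bR_first a h, e1, etaV, ← h, Matrix.mul_vecMulVec]
  congr 1
  simp only [Matrix.single_eq_single_vecMulVec_single, Matrix.add_mulVec, Matrix.vecMulVec_mulVec]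
  simp [dotProduct_add, Fin.succ_ne_zero, add_comm]

theorem mul_bR_first (a b : Fin d) (h : a = firstIdx a) (v : Fin (d + 1) → ℂ) :
    Matrix.vecMulVec v (nuV b) * (bR a : Mat d) = -Matrix.vecMulVec v (nuV b) := by
  have e1 : nuV b = nuV a := rfl
  rw [coe_bR_first a h, e1, nuV, ← h, Matrix.vecMulVec_mul, ← Matrix.vecMulVec_neg]
  congr 1
  simp only [Matrix.single_eq_single_vecMulVec_single, Matrix.vecMul_add, Matrix.vecMul_vecMulVec]
  simp [Fin.succ_ne_zero, sub_eq_add_neg, add_comm]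

theorem bR_first_mul_single (a b : Fin d) (h : a = firstIdx a) (hb : b ≠ firstIdx b)
    (v : Fin (d + 1) → ℂ) :
    (bR a : Mat d) * Matrix.vecMulVec (Pi.single b.succ 1) v = 0 := by
  rw [firstIdx_eq b a, ← h] at hb
  rw [coe_bR_first a h, Matrix.mul_vecMulVec]
  simp only [Matrix.single_eq_single_vecMulVec_single, Matrix.add_mulVec, Matrix.vecMulVec_mulVec]
  simp [hb, Fin.succ_ne_zero]

theorem single_mul_bR_first (a b : Fin d) (h : a = firstIdx a) (hb : b ≠ firstIdx b)
    (v : Fin (d + 1) → ℂ) :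
    Matrix.vecMulVec v (Pi.single b.succ 1) * (bR a : Mat d) = 0 := by
  rw [firstIdx_eq b a, ← h] at hb
  rw [coe_bR_first a h, Matrix.vecMulVec_mul]
  simp only [Matrix.single_eq_single_vecMulVec_single, Matrix.vecMul_add, Matrix.vecMul_vecMulVec]
  simp [hb, Fin.succ_ne_zero]

theorem lie_bR_bI_first (a : Fin d) (h : a = firstIdx a) : ⁅bR a, bI a⁆ = (2 : ℝ) • bI a := by
  apply Subtype.ext
  change ⁅(bR a : Mat d), (bI a : Mat d)⁆ = (2 : ℝ) • (bI a : Mat d)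
  rw [coe_bI_first a h, LieRing.of_associative_ring_bracket, Matrix.mul_smul, Matrix.smul_mul,
    bR_first_mul a a h, mul_bR_first a a h]
  rw [two_smul]; module

theorem lie_bR_bR_of_first (a b : Fin d) (h : a = firstIdx a) (hb : b ≠ firstIdx b) :
    ⁅bR a, bR b⁆ = bR b := by
  apply Subtype.ext
  change ⁅(bR a : Mat d), (bR b : Mat d)⁆ = (bR b : Mat d)
  rw [coe_bR_ne b hb, LieRing.of_associative_ring_bracket]
  simp only [Matrix.mul_smul, Matrix.smul_mul, Matrix.mul_add, Matrix.add_mul,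
    bR_first_mul a b h, mul_bR_first a b h, bR_first_mul_single a b h hb,
    single_mul_bR_first a b h hb]
  module

theorem lie_bR_bI_of_first (a b : Fin d) (h : a = firstIdx a) (hb : b ≠ firstIdx b) :
    ⁅bR a, bI b⁆ = bI b := by
  apply Subtype.ext
  change ⁅(bR a : Mat d), (bI b : Mat d)⁆ = (bI b : Mat d)
  rw [coe_bI_ne b hb, LieRing.of_associative_ring_bracket]
  simp only [Matrix.mul_smul, Matrix.smul_mul, Matrix.mul_sub, Matrix.sub_mul,
    bR_first_mul a b h, mul_bR_first a b h, bR_first_mul_single a b h hb,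
    single_mul_bR_first a b h hb]
  module

theorem lie_bI_bR_of_first (a b : Fin d) (h : a = firstIdx a) (hb : b ≠ firstIdx b) :
    ⁅bI a, bR b⁆ = 0 := by
  apply Subtype.ext
  change ⁅(bI a : Mat d), (bR b : Mat d)⁆ = 0
  have e1 : etaV b = etaV a := rfl
  have e2 : nuV b = nuV a := rfl
  rw [coe_bI_first a h, coe_bR_ne b hb, LieRing.of_associative_ring_bracket, e1, e2]
  simp [mul_add, add_mul, Matrix.vecMulVec_mul_vecMulVec, nuV_dot_etaV, nuV_dot_single a b hb,
    single_dot_etaV a b hb]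

theorem lie_bI_bI_of_first (a b : Fin d) (h : a = firstIdx a) (hb : b ≠ firstIdx b) :
    ⁅bI a, bI b⁆ = 0 := by
  apply Subtype.ext
  change ⁅(bI a : Mat d), (bI b : Mat d)⁆ = 0
  have e1 : etaV b = etaV a := rfl
  have e2 : nuV b = nuV a := rfl
  rw [coe_bI_first a h, coe_bI_ne b hb, LieRing.of_associative_ring_bracket, e1, e2]
  simp [mul_sub, sub_mul, Matrix.vecMulVec_mul_vecMulVec, nuV_dot_etaV, nuV_dot_single a b hb,
    single_dot_etaV a b hb]

theorem lie_bR_bR_ne (a b : Fin d) (ha : a ≠ firstIdx a) (hb : b ≠ firstIdx b) :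
    ⁅bR a, bR b⁆ = 0 := by
  apply Subtype.ext
  change ⁅(bR a : Mat d), (bR b : Mat d)⁆ = 0
  rw [coe_bR_ne a ha, coe_bR_ne b hb, smul_add, smul_add, lie_aux a b ha hb]
  simp

theorem lie_bI_bI_ne (a b : Fin d) (ha : a ≠ firstIdx a) (hb : b ≠ firstIdx b) :
    ⁅bI a, bI b⁆ = 0 := by
  apply Subtype.ext
  change ⁅(bI a : Mat d), (bI b : Mat d)⁆ = 0
  rw [coe_bI_ne a ha, coe_bI_ne b hb, smul_sub, smul_sub, sub_eq_add_neg, sub_eq_add_neg,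
    ← neg_smul, ← neg_smul, lie_aux a b ha hb]
  split_ifs <;> simp

theorem lie_bR_bI_ne (a b : Fin d) (ha : a ≠ firstIdx a) (hb : b ≠ firstIdx b) :
    ⁅bR a, bI b⁆ = (if a = b then 1 / 2 else 0 : ℝ) • bI (firstIdx a) := by
  apply Subtype.ext
  change ⁅(bR a : Mat d), (bI b : Mat d)⁆ = _ • (bI (firstIdx a) : Mat d)
  rw [coe_bR_ne a ha, coe_bI_ne b hb, smul_sub, smul_add, sub_eq_add_neg,
    ← neg_smul, lie_aux a b ha hb, coe_bI_first _ (firstIdx_eq _ _)]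
  split_ifs
  · rw [show etaV (firstIdx a) = etaV a from rfl, show nuV (firstIdx a) = nuV a from rfl,
      ← smul_assoc]
    congr 1
    rw [Complex.real_smul]; push_cast; ring
  · simp

variable (d) in
/-- The real span of the `B_a^R`, `B_a^I`. -/
def bSpan : Submodule ℝ (uLie d) := Submodule.span ℝ (Set.range bR ∪ Set.range bI)

theorem bR_mem (a : Fin d) : bR a ∈ bSpan d := Submodule.subset_span (Or.inl ⟨a, rfl⟩)

theorem bI_mem (a : Fin d) : bI a ∈ bSpan d := Submodule.subset_span (Or.inr ⟨a, rfl⟩)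

theorem eq_of_first {a b : Fin d} (ha : a = firstIdx a) (hb : b = firstIdx b) : a = b := by
  rw [ha, hb]; rfl

theorem lie_RR_mem (a b : Fin d) : ⁅bR a, bR b⁆ ∈ bSpan d := by
  by_cases ha : a = firstIdx a <;> by_cases hb : b = firstIdx b
  · rw [eq_of_first ha hb, lie_self]; exact zero_mem _
  · rw [lie_bR_bR_of_first a b ha hb]; exact bR_mem b
  · rw [← lie_skew, lie_bR_bR_of_first b a hb ha]; exact neg_mem (bR_mem a)
  · rw [lie_bR_bR_ne a b ha hb]; exact zero_mem _

theorem lie_II_mem (a b : Fin d) : ⁅bI a, bI b⁆ ∈ bSpan d := by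
  by_cases ha : a = firstIdx a <;> by_cases hb : b = firstIdx b
  · rw [eq_of_first ha hb, lie_self]; exact zero_mem _
  · rw [lie_bI_bI_of_first a b ha hb]; exact zero_mem _
  · rw [← lie_skew, lie_bI_bI_of_first b a hb ha, neg_zero]; exact zero_mem _
  · rw [lie_bI_bI_ne a b ha hb]; exact zero_mem _

theorem lie_RI_mem (a b : Fin d) : ⁅bR a, bI b⁆ ∈ bSpan d := by
  by_cases ha : a = firstIdx a <;> by_cases hb : b = firstIdx b
  · rw [eq_of_first hb ha, lie_bR_bI_first a ha]; exact Submodule.smul_mem _ _ (bI_mem a)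
  · rw [lie_bR_bI_of_first a b ha hb]; exact bI_mem b
  · rw [← lie_skew, lie_bI_bR_of_first b a hb ha, neg_zero]; exact zero_mem _
  · rw [lie_bR_bI_ne a b ha hb]; exact Submodule.smul_mem _ _ (bI_mem _)

variable (d) in
/-- The solvable Iwasawa subalgebra `𝔟 = 𝔞 ⊕ 𝔫` of `𝔰𝔲(1,n-1)`: the real span of
the matrices `B_a^R`, `B_a^I`, `a = 1, …, n-1`. -/
def bLie : LieSubalgebra ℝ (uLie d) where
  toSubmodule := bSpan d
  lie_mem' {x y} hx hy := by
    change ⁅x, y⁆ ∈ bSpan d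
    replace hx : x ∈ bSpan d := hx
    replace hy : y ∈ bSpan d := hy
    unfold bSpan at hx hy
    induction hx, hy using Submodule.span_induction₂ with
    | mem_mem x y hx hy =>
      rcases hx with ⟨a, rfl⟩ | ⟨a, rfl⟩ <;> rcases hy with ⟨b, rfl⟩ | ⟨b, rfl⟩
      · exact lie_RR_mem a b
      · exact lie_RI_mem a b
      · rw [← lie_skew]; exact neg_mem (lie_RI_mem b a)
      · exact lie_II_mem a b
    | zero_left y hy => rw [zero_lie]; exact zero_mem _
    | zero_right x hx => rw [lie_zero]; exact zero_mem _
    | add_left x y z _ _ _ h1 h2 => rw [add_lie]; exact add_mem h1 h2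
    | add_right x y z _ _ _ h1 h2 => rw [lie_add]; exact add_mem h1 h2
    | smul_left r x y _ _ h => rw [smul_lie]; exact Submodule.smul_mem _ _ h
    | smul_right r x y _ _ h => rw [lie_smul]; exact Submodule.smul_mem _ _ h

/-- The Heisenberg algebra `𝔥𝔢𝔦𝔰_{2n+1}`, with underlying vector space `ℂ^n ⊕ ℝ Z`.
Its real basis `e_k`, `f_k` (`k = 0, …, d`), `Z` consists of the unit vectors `e_k` of `ℂ^n`,
of `f_k = i e_k`, and of the central element `Z`. -/
def Heis (d : ℕ) : Type := (Fin (d + 1) → ℂ) × ℝ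

instance : AddCommGroup (Heis d) := inferInstanceAs (AddCommGroup ((Fin (d + 1) → ℂ) × ℝ))

instance : Module ℝ (Heis d) := inferInstanceAs (Module ℝ ((Fin (d + 1) → ℂ) × ℝ))

instance : FiniteDimensional ℝ (Heis d) :=
  inferInstanceAs (FiniteDimensional ℝ ((Fin (d + 1) → ℂ) × ℝ))

/-- The symplectic form `Im(v̄⁰ u⁰ - ∑ v̄^a u^a)` on `ℂ^n`. -/
def omega (v u : Fin (d + 1) → ℂ) : ℝ :=
  (conj (v 0) * u 0 - ∑ a : Fin d, conj (v a.succ) * u a.succ).im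

theorem omega_eq (v u : Fin (d + 1) → ℂ) : omega v u = -(star v ⬝ᵥ (sgn *ᵥ u)).im := by
  rw [omega, ← Complex.neg_im]
  congr 1
  simp [dotProduct, sgn, Matrix.mulVec_diagonal, Fin.sum_univ_succ, sub_eq_add_neg, add_comm]

theorem omega_add_left (v v' u : Fin (d + 1) → ℂ) :
    omega (v + v') u = omega v u + omega v' u := by
  simp only [omega_eq, star_add, add_dotProduct, Complex.add_im]; ring

theorem omega_add_right (v u u' : Fin (d + 1) → ℂ) :
    omega v (u + u') = omega v u + omega v u' := by
  simp only [omega_eq, Matrix.mulVec_add, dotProduct_add, Complex.add_im]; ring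

theorem omega_smul_right (r : ℝ) (v u : Fin (d + 1) → ℂ) :
    omega v (r • u) = r * omega v u := by
  simp only [omega_eq, Matrix.mulVec_smul, dotProduct_smul, Complex.smul_im, smul_eq_mul]; ring

theorem omega_swap (v u : Fin (d + 1) → ℂ) : omega u v = -omega v u := by
  have h : ∀ z w : ℂ, (conj z * w).im = -(conj w * z).im := fun z w => by
    simp only [Complex.mul_im, Complex.conj_re, Complex.conj_im]; ring
  simp only [omega, Complex.sub_im, Complex.im_sum]
  rw [h (u 0), Finset.sum_congr rfl fun a _ => h (u (Fin.succ a)) (v a.succ),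
    Finset.sum_neg_distrib]
  ring

/-- `[v + s Z, u + t Z] = Im(v̄⁰ u⁰ - ∑ v̄^a u^a) Z`; in particular `[e_0, f_0] = Z` and
`[e_a, f_a] = -Z` for `a ≥ 1`. -/
instance : Bracket (Heis d) (Heis d) where
  bracket x y := ((0 : Fin (d + 1) → ℂ), omega x.1 y.1)

theorem heis_lie_def (x y : Heis d) :
    ⁅x, y⁆ = (((0 : Fin (d + 1) → ℂ), omega x.1 y.1) : (Fin (d + 1) → ℂ) × ℝ) := rfl

theorem omega_zero_left (u : Fin (d + 1) → ℂ) : omega 0 u = 0 := by simp [omega]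

theorem omega_zero_right (u : Fin (d + 1) → ℂ) : omega u 0 = 0 := by simp [omega]

theorem omega_self (u : Fin (d + 1) → ℂ) : omega u u = 0 := by
  have := omega_swap u u; linarith

instance : LieRing (Heis d) where
  add_lie x y z := Prod.ext (add_zero 0).symm (omega_add_left x.1 y.1 z.1)
  lie_add x y z := Prod.ext (add_zero 0).symm (omega_add_right x.1 y.1 z.1)
  lie_self x := Prod.ext rfl (omega_self x.1)
  leibniz_lie x y z := Prod.ext (add_zero 0).symm (by
    change omega x.1 0 = omega 0 z.1 + omega y.1 0
    simp [omega_zero_left, omega_zero_right])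

instance : LieAlgebra ℝ (Heis d) where
  lie_smul r x y := Prod.ext (smul_zero r).symm (omega_smul_right r x.1 y.1)

theorem omega_transpose (A : uLie d) (v u : Fin (d + 1) → ℂ) :
    omega ((A : Mat d)ᵀ *ᵥ v) u = -omega v ((A : Mat d)ᵀ *ᵥ u) := by
  have hA : -(sgn * (A : Mat d)ᴴ * sgn) = (A : Mat d) := A.2
  have h : (A : Mat d)ᵀᴴ * sgn = -(sgn * (A : Mat d)ᵀ) := by
    have h1 := congrArg Matrix.transpose hA
    have h2 : (sgn : Mat d)ᵀ = sgn := by simp [sgn]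
    rw [Matrix.transpose_neg, Matrix.transpose_mul, Matrix.transpose_mul, h2] at h1
    have h3 : sgn * (A : Mat d)ᵀ = -((A : Mat d)ᴴᵀ * sgn) := by
      rw [← h1, Matrix.mul_neg, ← Matrix.mul_assoc, sgn_mul_sgn, Matrix.one_mul]
    rw [h3, neg_neg]
    rfl
  rw [omega_eq, omega_eq, Matrix.star_mulVec, ← Matrix.dotProduct_mulVec, Matrix.mulVec_mulVec, h,
    Matrix.neg_mulVec, dotProduct_neg, Complex.neg_im, Matrix.mulVec_mulVec]

/-- The derivation `v + s Z ↦ -A^⊤ v` of the Heisenberg algebra, for `A ∈ 𝔲(1,n-1)`. -/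
def heisDer (A : uLie d) : LieDerivation ℝ (Heis d) (Heis d) where
  toFun x := (-((A : Mat d)ᵀ *ᵥ x.1), (0 : ℝ))
  map_add' x y := Prod.ext
    (by change -((A : Mat d)ᵀ *ᵥ (x.1 + y.1)) = -((A : Mat d)ᵀ *ᵥ x.1) + -((A : Mat d)ᵀ *ᵥ y.1)
        rw [Matrix.mulVec_add, neg_add]) (add_zero 0).symm
  map_smul' r x := Prod.ext
    (by change -((A : Mat d)ᵀ *ᵥ (r • x.1)) = r • -((A : Mat d)ᵀ *ᵥ x.1)
        rw [Matrix.mulVec_smul, smul_neg]) (smul_zero r).symm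
  leibniz' x y := Prod.ext
    (by change -((A : Mat d)ᵀ *ᵥ (0 : Fin (d + 1) → ℂ)) = 0 - 0
        simp)
    (by change (0 : ℝ) = omega x.1 (-((A : Mat d)ᵀ *ᵥ y.1)) - omega y.1 (-((A : Mat d)ᵀ *ᵥ x.1))
        have hn : ∀ v u : Fin (d + 1) → ℂ, omega v (-u) = -omega v u := fun v u => by
          have := omega_smul_right (-1) v u
          simpa using this
        have h1 := omega_transpose A x.1 y.1
        have h2 := omega_swap ((A : Mat d)ᵀ *ᵥ x.1) y.1
        rw [hn, hn]; linarith)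

variable (d) in
/-- The action of `𝔟` on `𝔥𝔢𝔦𝔰_{2n+1}` by derivations. -/
def heisAction : bLie d →ₗ⁅ℝ⁆ LieDerivation ℝ (Heis d) (Heis d) where
  toFun A := heisDer A
  map_add' A B := by
    ext x
    refine Prod.ext ?_ (add_zero 0).symm
    change -((((A : uLie d) : Mat d) + ((B : uLie d) : Mat d))ᵀ *ᵥ x.1)
      = -(((A : uLie d) : Mat d)ᵀ *ᵥ x.1) + -(((B : uLie d) : Mat d)ᵀ *ᵥ x.1)
    rw [Matrix.transpose_add, Matrix.add_mulVec, neg_add]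
  map_smul' r A := by
    ext x
    refine Prod.ext ?_ (smul_zero r).symm
    change -((r • ((A : uLie d) : Mat d))ᵀ *ᵥ x.1) = r • -(((A : uLie d) : Mat d)ᵀ *ᵥ x.1)
    rw [Matrix.transpose_smul, Matrix.smul_mulVec, smul_neg]
  map_lie' {A B} := by
    ext x
    refine Prod.ext ?_ (sub_zero 0).symm
    change -((((A : uLie d) : Mat d) * ((B : uLie d) : Mat d)
        - ((B : uLie d) : Mat d) * ((A : uLie d) : Mat d))ᵀ *ᵥ x.1)
      = -(((A : uLie d) : Mat d)ᵀ *ᵥ -(((B : uLie d) : Mat d)ᵀ *ᵥ x.1))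
        - -(((B : uLie d) : Mat d)ᵀ *ᵥ -(((A : uLie d) : Mat d)ᵀ *ᵥ x.1))
    rw [Matrix.transpose_sub, Matrix.transpose_mul, Matrix.transpose_mul, Matrix.sub_mulVec,
      Matrix.mulVec_neg, Matrix.mulVec_neg, Matrix.mulVec_mulVec, Matrix.mulVec_mulVec]
    abel

variable (d) in
/-- The Lie algebra `𝔩 = 𝔟 ⋉ 𝔥𝔢𝔦𝔰_{2n+1}`, with `[A, v + s Z] = -A^⊤ v` for `A ∈ 𝔟`. -/
abbrev SolvLie : Type := LieAlgebra.SemiDirectSum (Heis d) (bLie d) (heisAction d)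

instance : FiniteDimensional ℝ (SolvLie d) :=
  (LieAlgebra.SemiDirectSum.toProdl (heisAction d)).symm.finiteDimensional

/-- `B_a^R` as an element of `𝔩`. -/
def solvBR (a : Fin d) : SolvLie d := LieAlgebra.SemiDirectSum.inr (heisAction d) ⟨bR a, bR_mem a⟩

/-! ## The infinitesimal action of `𝔩` on the level sets -/

/-- The underlying matrix of the `𝔟`-component. -/
def matPart : SolvLie d →ₗ[ℝ] Mat d where
  toFun x := ((x.right : uLie d) : Mat d)
  map_add' _ _ := rfl
  map_smul' _ _ := rfl

/-- The `ℂ^n`-component. -/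
def vecPart : SolvLie d →ₗ[ℝ] (Fin (d + 1) → ℂ) where
  toFun x := x.left.1
  map_add' _ _ := rfl
  map_smul' _ _ := rfl

/-- The coefficient of `Z`. -/
def zPart : SolvLie d →ₗ[ℝ] ℝ where
  toFun x := x.left.2
  map_add' _ _ := rfl
  map_smul' _ _ := rfl

/-- The infinitesimal action `α` (depending on `c`) of `𝔩` on `K`: the element `A + v + s Z`
generates the vector field whose value at `(X, φ, w)` is the velocity of
* `X`, moved by the fractional linear action of `exp(tA)` on the ball (the action on the lines
  spanned by `(1, X)`);
* `φ ↦ φ - 2c arg j + …`, where `j` is the automorphy factor of the fractional linear action, and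
  `w ↦ exp(-tA^⊤) w`;
* the Heisenberg translation `w ↦ w + v / (2√2)`, `φ ↦ φ + s + √2 Im(v̄⁰ w⁰ - ∑ v̄^a w^a)`. -/
def killingField (c : ℝ) (q : Coord d) : SolvLie d →ₗ[ℝ] Coord d where
  toFun x :=
    (fun a => (matPart x *ᵥ Fin.cons 1 q.1) a.succ - q.1 a * (matPart x *ᵥ Fin.cons 1 q.1) 0,
     -2 * c * ((matPart x *ᵥ Fin.cons 1 q.1) 0).im + √2 * omega (vecPart x) q.2.2 + zPart x,
     -((matPart x)ᵀ *ᵥ q.2.2) + (1 / (2 * √2)) • vecPart x)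
  map_add' x y := by
    refine Prod.ext ?_ (Prod.ext ?_ ?_)
    · funext a
      simp only [map_add, Matrix.add_mulVec, Pi.add_apply, Prod.fst_add]; ring
    · simp only [map_add, Matrix.add_mulVec, Pi.add_apply, Prod.fst_add, Prod.snd_add,
        Complex.add_im, omega_add_left]; ring
    · simp only [map_add, Matrix.transpose_add, Matrix.add_mulVec, Prod.snd_add, smul_add]; abel
  map_smul' r x := by
    have h : ∀ u, omega (r • vecPart x) u = r * omega (vecPart x) u := fun u => by
      rw [omega_swap, omega_smul_right, omega_swap u]; ring
    refine Prod.ext ?_ (Prod.ext ?_ ?_)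
    · funext a
      simp only [map_smul, Matrix.smul_mulVec, Pi.smul_apply, Prod.smul_fst, RingHom.id_apply,
        smul_sub, mul_smul_comm]
    · simp only [map_smul, Matrix.smul_mulVec, Pi.smul_apply, Prod.smul_fst, Prod.smul_snd,
        RingHom.id_apply, Complex.smul_im, h, smul_eq_mul]; ring
    · simp only [map_smul, Matrix.transpose_smul, Matrix.smul_mulVec, Prod.smul_snd,
        RingHom.id_apply, smul_add, smul_neg]
      rw [smul_comm]

/-! ## The left-invariant metric -/

theorem reInner_symm (z w : ℂ) : reInner z w = reInner w z := by
  simp only [reInner, Complex.mul_re, Complex.conj_re, Complex.conj_im]; ring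

theorem reInner_add (z z' w : ℂ) : reInner (z + z') w = reInner z w + reInner z' w := by
  simp only [reInner, map_add, add_mul, Complex.add_re]

theorem reInner_smul (r : ℝ) (z w : ℂ) : reInner (r • z) w = r * reInner z w := by
  simp only [reInner, Complex.mul_re, Complex.conj_re, Complex.conj_im, Complex.smul_re,
    Complex.smul_im, smul_eq_mul]; ring

theorem reInner_self (z : ℂ) : reInner z z = Complex.normSq z := by
  simp [reInner, Complex.normSq_apply]

theorem xForm_add (q u v : Coord d) : xForm q (u + v) = xForm q u + xForm q v := by
  simp [xForm, mul_add, Finset.sum_add_distrib]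

theorem xForm_smul (r : ℝ) (q u : Coord d) : xForm q (r • u) = r • xForm q u := by
  simp [xForm, Finset.mul_sum, mul_left_comm]

theorem wForm_add (q u v : Coord d) : wForm q (u + v) = wForm q u + wForm q v := by
  simp [wForm, mul_add, Finset.sum_add_distrib]; ring

theorem wForm_smul (r : ℝ) (q u : Coord d) : wForm q (r • u) = r • wForm q u := by
  simp [wForm, Finset.mul_sum, mul_left_comm]

theorem phiForm_add (c : ℝ) (q u v : Coord d) :
    phiForm c q (u + v) = phiForm c q u + phiForm c q v := by
  have h := omega_add_right q.2.2 u.2.2 v.2.2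
  simp only [omega] at h
  simp only [phiForm, xForm_add, Prod.snd_add, Prod.fst_add, h, Complex.add_im]
  ring

theorem phiForm_smul (c r : ℝ) (q u : Coord d) : phiForm c q (r • u) = r * phiForm c q u := by
  have h := omega_smul_right r q.2.2 u.2.2
  simp only [omega] at h
  simp only [phiForm, xForm_smul, Prod.smul_snd, Prod.smul_fst, h, Complex.smul_im, smul_eq_mul]
  ring

theorem levelMetric_symm (c ρ : ℝ) (q u v : Coord d) :
    levelMetric c ρ q u v = levelMetric c ρ q v u := by
  simp only [levelMetric, oneLoopMetric]
  simp only [reInner_symm (u.1 _), reInner_symm (xForm q u), reInner_symm (u.2.2 _),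
    reInner_symm (wForm q u)]
  ring

theorem levelMetric_add (c ρ : ℝ) (q u u' v : Coord d) :
    levelMetric c ρ q (u + u') v = levelMetric c ρ q u v + levelMetric c ρ q u' v := by
  simp only [levelMetric, oneLoopMetric, xForm_add, wForm_add, phiForm_add, Prod.fst_add,
    Prod.snd_add, Pi.add_apply, reInner_add, Finset.sum_add_distrib]
  ring

theorem levelMetric_smul (c ρ r : ℝ) (q u v : Coord d) :
    levelMetric c ρ q (r • u) v = r * levelMetric c ρ q u v := by
  simp only [levelMetric, oneLoopMetric, xForm_smul, wForm_smul, phiForm_smul, Prod.smul_fst,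
    Prod.smul_snd, Pi.smul_apply, reInner_smul, ← Finset.mul_sum]
  ring

theorem levelMetric_zero_self (c ρ : ℝ) (hρ : 0 < ρ) (u : Coord d) :
    levelMetric c ρ 0 u u
      = (ρ + c) / ρ * ∑ a, Complex.normSq (u.1 a)
        + 1 / (4 * ρ ^ 2) * ((ρ + c) / (ρ + 2 * c)) * u.2.1 ^ 2
        + 2 * (ρ + 2 * c) / ρ ^ 2 * Complex.normSq (u.2.2 0)
        + 2 / ρ * ∑ a : Fin d, Complex.normSq (u.2.2 a.succ) := by
  simp only [levelMetric, oneLoopMetric, hFun, xForm, phiForm, wForm, reInner_self]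
  simp
  field_simp
  ring

theorem levelMetric_zero_pos (c ρ : ℝ) (hc : 0 ≤ c) (hρ : 0 < ρ) (u : Coord d) (hu : u ≠ 0) :
    0 < levelMetric c ρ 0 u u := by
  have h1 : ∀ a, 0 ≤ Complex.normSq (u.1 a) := fun a => Complex.normSq_nonneg _
  have h2 : ∀ a, 0 ≤ Complex.normSq (u.2.2 a) := fun a => Complex.normSq_nonneg _
  have k1 : 0 < (ρ + c) / ρ := by positivity
  have k2 : 0 < 1 / (4 * ρ ^ 2) * ((ρ + c) / (ρ + 2 * c)) := by positivity
  have k3 : 0 < 2 * (ρ + 2 * c) / ρ ^ 2 := by positivity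
  have k4 : 0 < 2 / ρ := by positivity
  have s1 : 0 ≤ ∑ a, Complex.normSq (u.1 a) := Finset.sum_nonneg fun a _ => h1 a
  have s2 : 0 ≤ ∑ a : Fin d, Complex.normSq (u.2.2 a.succ) := Finset.sum_nonneg fun a _ => h2 _
  rw [levelMetric_zero_self c ρ hρ]
  by_contra hcon
  have t1 := mul_nonneg k1.le s1
  have t2 := mul_nonneg k2.le (sq_nonneg u.2.1)
  have t3 := mul_nonneg k3.le (h2 0)
  have t4 := mul_nonneg k4.le s2
  have z1 : (ρ + c) / ρ * ∑ a, Complex.normSq (u.1 a) = 0 := by linarith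
  have z2 : 1 / (4 * ρ ^ 2) * ((ρ + c) / (ρ + 2 * c)) * u.2.1 ^ 2 = 0 := by linarith
  have z3 : 2 * (ρ + 2 * c) / ρ ^ 2 * Complex.normSq (u.2.2 0) = 0 := by linarith
  have z4 : 2 / ρ * ∑ a : Fin d, Complex.normSq (u.2.2 a.succ) = 0 := by linarith
  have y1 := (mul_eq_zero.1 z1).resolve_left k1.ne'
  have y2 := (mul_eq_zero.1 z2).resolve_left k2.ne'
  have y3 := (mul_eq_zero.1 z3).resolve_left k3.ne'
  have y4 := (mul_eq_zero.1 z4).resolve_left k4.ne'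
  rw [Finset.sum_eq_zero_iff_of_nonneg fun a _ => h1 a] at y1
  rw [Finset.sum_eq_zero_iff_of_nonneg fun a _ => h2 _] at y4
  apply hu
  refine Prod.ext ?_ (Prod.ext ?_ ?_)
  · funext a; exact Complex.normSq_eq_zero.1 (y1 a (Finset.mem_univ a))
  · exact pow_eq_zero_iff (two_ne_zero) |>.1 y2
  · funext a
    refine Fin.cases (Complex.normSq_eq_zero.1 y3)
      (fun a => Complex.normSq_eq_zero.1 (y4 a (Finset.mem_univ a))) a

theorem bR_col (a b : Fin d) : (bR a : Mat d) b.succ 0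
    = if a = b then (if a = firstIdx a then 1 else 1 / 2) else 0 := by
  by_cases ha : a = firstIdx a
  · rw [coe_bR_first a ha, if_pos ha]
    simp [Matrix.single_apply]
  · rw [coe_bR_ne a ha, if_neg ha]
    simp [Matrix.vecMulVec_apply, nuV, Pi.single_apply, (Fin.succ_ne_zero _).symm, eq_comm]

theorem bI_col (a b : Fin d) : (bI a : Mat d) b.succ 0
    = (if a = b then (if a = firstIdx a then 1 else 1 / 2) else 0) * Complex.I := by
  by_cases ha : a = firstIdx a
  · rw [coe_bI_first a ha, if_pos ha]
    simp [Matrix.vecMulVec_apply, nuV, etaV, Pi.single_apply, ← ha, eq_comm]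
  · rw [coe_bI_ne a ha, if_neg ha]
    by_cases h : a = b
    · subst h
      simp [Matrix.vecMulVec_apply, nuV]; ring
    · simp [Matrix.vecMulVec_apply, nuV, h, Ne.symm h]

theorem eq_zero_of_col (A : uLie d) (hA : A ∈ bSpan d)
    (h : ∀ b : Fin d, (A : Mat d) b.succ 0 = 0) : A = 0 := by
  rw [bSpan, Submodule.span_union, Submodule.mem_sup] at hA
  obtain ⟨x, hx, y, hy, rfl⟩ := hA
  obtain ⟨r, rfl⟩ := (Submodule.mem_span_range_iff_exists_fun ℝ).1 hx
  obtain ⟨s, rfl⟩ := (Submodule.mem_span_range_iff_exists_fun ℝ).1 hy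
  have key : ∀ b, r b = 0 ∧ s b = 0 := by
    intro b
    have hb := h b
    have e : ((∑ i, r i • bR i + ∑ i, s i • bI i : uLie d) : Mat d) b.succ 0
        = ∑ i, r i • (bR i : Mat d) b.succ 0 + ∑ i, s i • (bI i : Mat d) b.succ 0 := by
      simp [Matrix.add_apply, Matrix.sum_apply, Matrix.smul_apply]
    rw [e] at hb
    simp only [bR_col, bI_col, ite_mul, zero_mul, smul_ite, smul_zero, Finset.sum_ite_eq',
      Finset.mem_univ, if_true] at hb
    split_ifs at hb
    · have h1 := congrArg Complex.re hb
      have h2 := congrArg Complex.im hb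
      simp at h1 h2
      exact ⟨h1, h2⟩
    · have h1 := congrArg Complex.re hb
      have h2 := congrArg Complex.im hb
      simp at h1 h2
      exact ⟨h1, h2⟩
  simp [key]

theorem killingField_zero_injective (c : ℝ) (x : SolvLie d)
    (hx : killingField c (0 : Coord d) x = 0) : x = 0 := by
  have h1 := congrArg (fun u : Coord d => u.1) hx
  have h2 := congrArg (fun u : Coord d => u.2.1) hx
  have h3 := congrArg (fun u : Coord d => u.2.2) hx
  simp only [killingField, LinearMap.coe_mk, AddHom.coe_mk] at h1 h2 h3
  have hcol : ∀ b, (matPart x *ᵥ (Fin.cons 1 (0 : Coord d).1 : Fin (d + 1) → ℂ)) b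
      = matPart x b 0 := fun b => by
    simp [Matrix.mulVec, dotProduct, Fin.sum_univ_succ]
  have hA : (x.right : uLie d) = 0 := by
    refine eq_zero_of_col _ x.right.2 fun b => ?_
    have := congrFun h1 b
    simp only [hcol] at this
    have h0 : matPart x b.succ 0 = 0 := by simpa using this
    exact h0
  have hM : matPart x = 0 := by
    change ((x.right : uLie d) : Mat d) = 0
    rw [hA]; rfl
  have hv : vecPart x = 0 := by
    have h4 : (1 / (2 * √2) : ℝ) ≠ 0 := by positivity
    rw [hM] at h3
    simp only [Matrix.transpose_zero, Matrix.zero_mulVec, neg_zero, zero_add] at h3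
    exact (smul_eq_zero.1 h3).resolve_left h4
  have hz : zPart x = 0 := by
    rw [hM, hv] at h2
    simpa [omega_zero_left] using h2
  exact LieAlgebra.SemiDirectSum.ext (Prod.ext hv hz) (Subtype.ext hA)

/-- The left-invariant metric on the simply connected Lie group `L` with Lie algebra `𝔩` that
corresponds to `g_ρ^c` under the orbit map `L → N̄_ρ` of the base point `p_ρ = (ρ, 0)`: the inner
product on `𝔩` is the pull-back of `g_ρ^c` at `p_ρ` by `x ↦ α(x)|_{p_ρ}`. -/
def solvMetric (d : ℕ) (c ρ : ℝ) (hc : 0 ≤ c) (hρ : 0 < ρ) : LeftInvariantMetric (SolvLie d) where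
  form := LinearMap.mk₂ ℝ
    (fun x y => levelMetric c ρ 0 (killingField c 0 x) (killingField c 0 y))
    (fun x x' y => by rw [map_add, levelMetric_add])
    (fun r x y => by rw [map_smul, levelMetric_smul, smul_eq_mul])
    (fun x y y' => by
      rw [map_add, levelMetric_symm, levelMetric_add, levelMetric_symm,
        levelMetric_symm c ρ 0 (killingField c 0 y')])
    (fun r x y => by
      rw [map_smul, levelMetric_symm, levelMetric_smul, levelMetric_symm, smul_eq_mul])
  symm x y := levelMetric_symm c ρ 0 _ _
  pos x hx := levelMetric_zero_pos c ρ hc hρ _ fun h => hx (killingField_zero_injective c x h)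

end LieAlg

end OneLoop

end

/-!
The proof has three independent parts.

**The action.** Let `ζ = (1, X)` and let `⟨·,·⟩` be the Hermitian form on `ℂⁿ` with Hermitian square
`-|z⁰|² + ∑ |z^a|²`. Every ingredient of the metric is a pairing: `1 - ‖X‖² = -⟨ζ, ζ⟩`,
`∑ X̄^a dX^a = ⟨ζ, dζ⟩`, `dw⁰ + ∑ X^a dw^a = ζ · dw`. The matrix `A` of an element of `𝔩` is skew
for `⟨·,·⟩`, and along the vector field `ζ` moves by `Aζ - jζ`, where `j = (Aζ)⁰` is the
infinitesimal automorphy factor. So each ingredient changes by terms in `j` and `dj` only, and these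
cancel in the metric: `isKillingOn_killingField`. For completeness, the integral curves are
obtained by solving `ζ' = Aζ` and `w' = -Aᵀw + v/(2√2)` globally and dividing by `ζ⁰`, which cannot
vanish because `⟨ζ, ζ⟩ < 0` is preserved (`isCompleteOn_killingField`). If a field vanishes at a
point, `ζ` is an eigenvector of `A`; the matrices of `𝔟` are determined by their first column
(`HasIwasawaShape`), and none but zero has an eigenvector of negative square, hence
`killingField_injective`; surjectivity is a dimension count.

**The Ricci tensor.** With `A_y x = ∇_x y` one has
`Ric(y, z) = -tr ad(∇_y z) - tr(A_y A_z)` (`LeftInvariantMetric.ricciTensor_eq`). For `n ≥ 2`, in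
the real coordinates `toModel` the metric is diagonal with four coefficients: `k` on the matrix
part, `l` on the centre, and `a`, `b` on the negative and the positive directions of `ℂⁿ`; here
`b < a` if `c > 0`, and `a = b`, `k = 1`, `l = 4b²` if `c = 0`. This gives the full Ricci form for
`c = 0` (`ricciTensor_of_model_zero`) and, in general, its values on the two vectors `e₀`, `e₁` of
the standard basis of `ℂⁿ` (`ricciTensor_of_model_time`, `ricciTensor_of_model_space`). The case
`n = 1` is treated in the same way in three coordinates.

**Solitons.** `ℂⁿ ⊕ ℝZ` is graded with degrees `1` and `2`, and `𝔟` has degree `0`, so there is a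
derivation acting as the degree times a constant `κ` (`gradingDerivation`). For `n = 1`, and for
`n ≥ 2` and `c = 0`, the Ricci endomorphism minus this derivation is a multiple of the identity.
For `c > 0`, the element `R = B_1^R` satisfies `[R, e₀] = -e₁` and `[R, e₁] = -e₀`. This forces a
derivation to have the same diagonal coefficient on `e₀` and `e₁`, whereas the Ricci curvatures in
these two directions differ, as `b < a`. The same two brackets show that `ad R` is not normal,
since `e₀` and `e₁` have different lengths.
-/

noncomputable section

open scoped ContDiff

namespace OneLoop

/-! ### The Ricci tensor of a left-invariant metric -/

namespace LeftInvariantMetric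

variable {𝔤 : Type*} [LieRing 𝔤] [LieAlgebra ℝ 𝔤]

/-- A skew endomorphism is conjugate, by the metric, to minus its transpose. -/
theorem trace_eq_zero_of_skew [FiniteDimensional ℝ 𝔤] (g : LeftInvariantMetric 𝔤)
    (f : Module.End ℝ 𝔤) (hf : ∀ x y, g.form (f x) y = -g.form x (f y)) :
    LinearMap.trace ℝ 𝔤 f = 0 := by
  have h : (g.form.toDual g.nondegenerate).conj f = -Module.Dual.transpose (R := ℝ) f := by
    refine LinearMap.ext fun φ => LinearMap.ext fun y => ?_
    obtain ⟨x, rfl⟩ := (g.form.toDual g.nondegenerate).surjective φ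
    simp only [LinearEquiv.conj_apply_apply, LinearEquiv.symm_apply_apply]
    exact hf x y
  have h1 := LinearMap.trace_conj' f (g.form.toDual g.nondegenerate)
  rw [h] at h1
  have h2 := map_neg (LinearMap.trace ℝ (Module.Dual ℝ 𝔤)) (Module.Dual.transpose (R := ℝ) f)
  rw [LinearMap.trace_transpose'] at h2
  have h3 := h2.symm.trans h1
  linarith

variable [FiniteDimensional ℝ 𝔤]

theorem nabla_sub_nabla (g : LeftInvariantMetric 𝔤) (x y : 𝔤) :
    g.nabla x y - g.nabla y x = ⁅x, y⁆ := by
  refine g.form_ext fun z => ?_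
  rw [map_sub, LinearMap.sub_apply, form_nabla, form_nabla, ← lie_skew x y, ← lie_skew x z,
    ← lie_skew y z]
  simp only [map_neg, LinearMap.neg_apply]
  ring

theorem form_nabla_skew (g : LeftInvariantMetric 𝔤) (x y z : 𝔤) :
    g.form (g.nabla x y) z = -g.form y (g.nabla x z) := by
  rw [g.symm y, form_nabla, form_nabla, ← lie_skew y z, ← lie_skew x y, ← lie_skew x z]
  simp only [map_neg, LinearMap.neg_apply]
  ring

/-- The endomorphism `x ↦ ∇_x y`. -/
def nablaFlip (g : LeftInvariantMetric 𝔤) (y : 𝔤) : Module.End ℝ 𝔤 where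
  toFun x := g.nabla x y
  map_add' x x' := g.nabla_add_left x x' y
  map_smul' r x := g.nabla_smul_left r x y

theorem nablaFlip_apply (g : LeftInvariantMetric 𝔤) (x y : 𝔤) :
    g.nablaFlip y x = g.nabla x y := rfl

theorem trace_nablaFlip (g : LeftInvariantMetric 𝔤) (y : 𝔤) :
    LinearMap.trace ℝ 𝔤 (g.nablaFlip y) = -LinearMap.trace ℝ 𝔤 (LieAlgebra.ad ℝ 𝔤 y) := by
  have h : LinearMap.trace ℝ 𝔤 (g.nablaFlip y + LieAlgebra.ad ℝ 𝔤 y) = 0 := by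
    refine g.trace_eq_zero_of_skew _ fun a b => ?_
    have e : ∀ c, (g.nablaFlip y + LieAlgebra.ad ℝ 𝔤 y) c = g.nabla y c := fun c => by
      rw [LinearMap.add_apply, nablaFlip_apply, LieAlgebra.ad_apply, ← g.nabla_sub_nabla]
      abel
    rw [e, e, form_nabla_skew]
  rw [map_add] at h
  linarith

/-- With `A_y x = ∇_x y` one has `Ric(y,z) = -tr ad(∇_y z) - tr (A_y A_z)`: the commutator
`[A_z, ad y]` in the trace defining the Ricci tensor drops out, and `A_w + ad w = ∇_w` is skew. -/
theorem ricciTensor_eq (g : LeftInvariantMetric 𝔤) (y z : 𝔤) :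
    g.ricciTensor y z = -LinearMap.trace ℝ 𝔤 (LieAlgebra.ad ℝ 𝔤 (g.nabla y z))
      - LinearMap.trace ℝ 𝔤 (g.nablaFlip y * g.nablaFlip z) := by
  have h : g.curvature y z = g.nablaFlip (g.nabla y z) - g.nablaFlip y * g.nablaFlip z
      - LieAlgebra.ad ℝ 𝔤 y * g.nablaFlip z + g.nablaFlip z * LieAlgebra.ad ℝ 𝔤 y := by
    refine LinearMap.ext fun x => ?_
    change g.nabla x (g.nabla y z) - g.nabla y (g.nabla x z) - g.nabla ⁅x, y⁆ z
      = g.nabla x (g.nabla y z) - g.nabla (g.nabla x z) y - ⁅y, g.nabla x z⁆ + g.nabla ⁅y, x⁆ z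
    rw [← g.nabla_sub_nabla y (g.nabla x z), ← lie_skew x y, ← neg_one_smul ℝ, nabla_smul_left]
    module
  change LinearMap.trace ℝ 𝔤 (g.curvature y z) = _
  rw [h, map_add, map_sub, map_sub, LinearMap.trace_mul_comm ℝ (LieAlgebra.ad ℝ 𝔤 y),
    trace_nablaFlip]
  ring

theorem ricciTensor_symm (g : LeftInvariantMetric 𝔤) (y z : 𝔤) :
    g.ricciTensor y z = g.ricciTensor z y := by
  have h : LinearMap.trace ℝ 𝔤 (LieAlgebra.ad ℝ 𝔤 (g.nabla y z))
      = LinearMap.trace ℝ 𝔤 (LieAlgebra.ad ℝ 𝔤 (g.nabla z y)) := by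
    have e : LieAlgebra.ad ℝ 𝔤 ⁅y, z⁆ = LieAlgebra.ad ℝ 𝔤 y * LieAlgebra.ad ℝ 𝔤 z
        - LieAlgebra.ad ℝ 𝔤 z * LieAlgebra.ad ℝ 𝔤 y := LinearMap.ext fun x => lie_lie y z x
    rw [← sub_eq_zero, ← map_sub, ← map_sub, nabla_sub_nabla, e, map_sub,
      LinearMap.trace_mul_comm, sub_self]
  rw [ricciTensor_eq, ricciTensor_eq, h, LinearMap.trace_mul_comm]

theorem form_ricci (g : LeftInvariantMetric 𝔤) (y z : 𝔤) :
    g.form (g.ricci y) z = g.ricciTensor y z :=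
  LinearMap.BilinForm.apply_toDual_symm_apply (hB := g.nondegenerate) (g.ricciTensor y) z

/-- By polarization, the Ricci endomorphism is a given symmetric endomorphism as soon as the
quadratic forms agree. -/
theorem ricci_eq_of_quadratic (g : LeftInvariantMetric 𝔤) (f : Module.End ℝ 𝔤)
    (hf : ∀ x y, g.form (f x) y = g.form x (f y))
    (h : ∀ x, g.ricciTensor x x = g.form (f x) x) (x : 𝔤) : g.ricci x = f x := by
  refine g.form_ext fun z => ?_
  rw [form_ricci]
  have e1 := h (x + z)
  have e2 : ∀ w, g.ricciTensor (x + z) w = g.ricciTensor x w + g.ricciTensor z w := fun w => by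
    rw [ricciTensor_symm, map_add, ricciTensor_symm, g.ricciTensor_symm w z]
  rw [e2, map_add, map_add, h x, h z, g.ricciTensor_symm z x] at e1
  simp only [map_add, LinearMap.add_apply] at e1
  have e3 : g.form (f z) x = g.form (f x) z := by rw [hf, g.symm]
  linarith

end LeftInvariantMetric

/-! ### Traces in coordinates -/

theorem trace_prod {M N : Type*} [AddCommGroup M] [Module ℝ M] [AddCommGroup N] [Module ℝ N]
    [FiniteDimensional ℝ M] [FiniteDimensional ℝ N] (f : Module.End ℝ (M × N)) :
    LinearMap.trace ℝ (M × N) f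
      = LinearMap.trace ℝ M (LinearMap.fst ℝ M N ∘ₗ f ∘ₗ LinearMap.inl ℝ M N)
        + LinearMap.trace ℝ N (LinearMap.snd ℝ M N ∘ₗ f ∘ₗ LinearMap.inr ℝ M N) := by
  rw [LinearMap.trace_comp_comm' (f ∘ₗ LinearMap.inl ℝ M N), LinearMap.trace_comp_comm'
    (f ∘ₗ LinearMap.inr ℝ M N), ← map_add]
  congr 1
  refine LinearMap.ext fun x => ?_
  simp [← map_add]

theorem trace_real (f : Module.End ℝ ℝ) : LinearMap.trace ℝ ℝ f = f 1 := by
  have h : f = f 1 • LinearMap.id := LinearMap.ext_ring (by simp)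
  conv_lhs => rw [h]
  simp

theorem trace_fun {m : ℕ} (f : Module.End ℝ (Fin m → ℝ)) :
    LinearMap.trace ℝ (Fin m → ℝ) f = ∑ b, f (Pi.single b 1) b := by
  rw [LinearMap.trace_eq_matrix_trace ℝ (Pi.basisFun ℝ (Fin m)), Matrix.trace]
  simp

/-! ### The Lie algebra in real coordinates -/

/-- Real coordinates `(r, t, s, p₁, p₂, q₁, q₂, z₁, z₂, u₁, u₂)` on `𝔩` for `n = m + 2`. -/
abbrev Model (m : ℕ) : Type :=
  ℝ × ℝ × ℝ × ℝ × ℝ × ℝ × ℝ × (Fin m → ℝ) × (Fin m → ℝ) × (Fin m → ℝ) × (Fin m → ℝ)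

theorem trace_model {m : ℕ} (f : Module.End ℝ (Model m)) :
    LinearMap.trace ℝ (Model m) f
      = (f (1, 0, 0, 0, 0, 0, 0, 0, 0, 0, 0)).1
      + (f (0, 1, 0, 0, 0, 0, 0, 0, 0, 0, 0)).2.1
      + (f (0, 0, 1, 0, 0, 0, 0, 0, 0, 0, 0)).2.2.1
      + (f (0, 0, 0, 1, 0, 0, 0, 0, 0, 0, 0)).2.2.2.1
      + (f (0, 0, 0, 0, 1, 0, 0, 0, 0, 0, 0)).2.2.2.2.1
      + (f (0, 0, 0, 0, 0, 1, 0, 0, 0, 0, 0)).2.2.2.2.2.1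
      + (f (0, 0, 0, 0, 0, 0, 1, 0, 0, 0, 0)).2.2.2.2.2.2.1
      + ∑ b, (f (0, 0, 0, 0, 0, 0, 0, Pi.single b 1, 0, 0, 0)).2.2.2.2.2.2.2.1 b
      + ∑ b, (f (0, 0, 0, 0, 0, 0, 0, 0, Pi.single b 1, 0, 0)).2.2.2.2.2.2.2.2.1 b
      + ∑ b, (f (0, 0, 0, 0, 0, 0, 0, 0, 0, Pi.single b 1, 0)).2.2.2.2.2.2.2.2.2.1 b
      + ∑ b, (f (0, 0, 0, 0, 0, 0, 0, 0, 0, 0, Pi.single b 1)).2.2.2.2.2.2.2.2.2.2 b := by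
  simp only [trace_prod, trace_real, trace_fun, LinearMap.comp_apply, LinearMap.fst_apply,
    LinearMap.snd_apply, LinearMap.inl_apply, LinearMap.inr_apply, add_assoc]
  rfl

open Matrix in
/-- The bracket of `𝔩` in the model coordinates. -/
def modelBracket {m : ℕ} (c : ℝ) : Model m → Model m → Model m :=
  fun (r, t, _, p₁, p₂, q₁, q₂, z₁, z₂, u₁, u₂) (R, T, _, P₁, P₂, Q₁, Q₂, Z₁, Z₂, U₁, U₂) =>
    (0,
     2 * (r * T - R * t) + 2 * (z₁ ⬝ᵥ Z₂ - z₂ ⬝ᵥ Z₁),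
     p₁ * P₂ - p₂ * P₁ - q₁ * Q₂ + q₂ * Q₁ - (u₁ ⬝ᵥ U₂ - u₂ ⬝ᵥ U₁)
       - 2 * c * (2 * (r * T - R * t) + 2 * (z₁ ⬝ᵥ Z₂ - z₂ ⬝ᵥ Z₁)),
     -r * Q₁ + t * (P₂ + Q₂) - (z₁ ⬝ᵥ U₁ - z₂ ⬝ᵥ U₂)
       + R * q₁ - T * (p₂ + q₂) + (Z₁ ⬝ᵥ u₁ - Z₂ ⬝ᵥ u₂),
     -r * Q₂ - t * (P₁ + Q₁) - (z₁ ⬝ᵥ U₂ + z₂ ⬝ᵥ U₁)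
       + R * q₂ + T * (p₁ + q₁) + (Z₁ ⬝ᵥ u₂ + Z₂ ⬝ᵥ u₁),
     -r * P₁ - t * (P₂ + Q₂) + (z₁ ⬝ᵥ U₁ - z₂ ⬝ᵥ U₂)
       + R * p₁ + T * (p₂ + q₂) - (Z₁ ⬝ᵥ u₁ - Z₂ ⬝ᵥ u₂),
     -r * P₂ + t * (P₁ + Q₁) + (z₁ ⬝ᵥ U₂ + z₂ ⬝ᵥ U₁)
       + R * p₂ - T * (p₁ + q₁) - (Z₁ ⬝ᵥ u₂ + Z₂ ⬝ᵥ u₁),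
     r • Z₁ - R • z₁,
     r • Z₂ - R • z₂,
     (p₁ + q₁) • Z₁ + (p₂ + q₂) • Z₂ - (P₁ + Q₁) • z₁ - (P₂ + Q₂) • z₂,
     (p₂ + q₂) • Z₁ - (p₁ + q₁) • Z₂ - (P₂ + Q₂) • z₁ + (P₁ + Q₁) • z₂)

open Matrix in
/-- A diagonal inner product in the model coordinates. -/
def modelForm {m : ℕ} (k l a b : ℝ) : Model m → Model m → ℝ :=
  fun (r, t, s, p₁, p₂, q₁, q₂, z₁, z₂, u₁, u₂) (R, T, S, P₁, P₂, Q₁, Q₂, Z₁, Z₂, U₁, U₂) =>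
    k * (r * R + t * T + z₁ ⬝ᵥ Z₁ + z₂ ⬝ᵥ Z₂) + l * (s * S) + a * (p₁ * P₁ + p₂ * P₂)
      + b * (q₁ * Q₁ + q₂ * Q₂ + u₁ ⬝ᵥ U₁ + u₂ ⬝ᵥ U₂)

open Matrix in
/-- The adjoint of `modelBracket c y` with respect to `modelForm k l a b`. -/
def modelAdjoint {m : ℕ} (c k l a b : ℝ) : Model m → Model m → Model m :=
  fun (r, t, _, p₁, p₂, q₁, q₂, z₁, z₂, u₁, u₂) (_, T, S, P₁, P₂, Q₁, Q₂, Z₁, Z₂, U₁, U₂) =>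
    let e := k * T - 2 * c * l * S
    (k⁻¹ * (-2 * e * t - k * (z₁ ⬝ᵥ Z₁ + z₂ ⬝ᵥ Z₂) + a * (P₁ * q₁ + P₂ * q₂)
        + b * (Q₁ * p₁ + Q₂ * p₂)),
     k⁻¹ * (2 * e * r - (a * P₁ - b * Q₁) * (p₂ + q₂) + (a * P₂ - b * Q₂) * (p₁ + q₁)),
     0,
     a⁻¹ * (-l * S * p₂ - t * a * P₂ - b * (r * Q₁ - t * Q₂) - b * (U₁ ⬝ᵥ z₁ - U₂ ⬝ᵥ z₂)),
     a⁻¹ * (l * S * p₁ + t * a * P₁ - b * (r * Q₂ + t * Q₁) - b * (U₁ ⬝ᵥ z₂ + U₂ ⬝ᵥ z₁)),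
     b⁻¹ * (l * S * q₂ - a * (r * P₁ + t * P₂) + b * t * Q₂ - b * (U₁ ⬝ᵥ z₁ - U₂ ⬝ᵥ z₂)),
     b⁻¹ * (-l * S * q₁ - a * (r * P₂ - t * P₁) - b * t * Q₁ - b * (U₁ ⬝ᵥ z₂ + U₂ ⬝ᵥ z₁)),
     k⁻¹ • (-(2 * e) • z₂ + (k * r) • Z₁ + (a * P₁ - b * Q₁) • u₁ + (a * P₂ - b * Q₂) • u₂
        + (b * (p₁ + q₁)) • U₁ + (b * (p₂ + q₂)) • U₂),
     k⁻¹ • ((2 * e) • z₁ + (k * r) • Z₂ - (a * P₁ - b * Q₁) • u₂ + (a * P₂ - b * Q₂) • u₁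
        - (b * (p₁ + q₁)) • U₂ + (b * (p₂ + q₂)) • U₁),
     b⁻¹ • ((l * S) • u₂ - (a * P₁ - b * Q₁) • z₁ - (a * P₂ - b * Q₂) • z₂),
     b⁻¹ • (-(l * S) • u₁ + (a * P₁ - b * Q₁) • z₂ - (a * P₂ - b * Q₂) • z₁))

open Matrix in
theorem modelForm_modelAdjoint {m : ℕ} (c k l a b : ℝ) (hk : k ≠ 0) (ha : a ≠ 0) (hb : b ≠ 0)
    (y x w : Model m) :
    modelForm k l a b (modelAdjoint c k l a b y x) w
      = modelForm k l a b x (modelBracket c y w) := by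
  obtain ⟨r, t, s, p₁, p₂, q₁, q₂, z₁, z₂, u₁, u₂⟩ := y
  obtain ⟨R, T, S, P₁, P₂, Q₁, Q₂, Z₁, Z₂, U₁, U₂⟩ := x
  obtain ⟨r', t', s', p₁', p₂', q₁', q₂', z₁', z₂', u₁', u₂'⟩ := w
  simp only [modelForm, modelAdjoint, modelBracket, dotProduct_add, add_dotProduct,
    dotProduct_sub, sub_dotProduct, smul_dotProduct, dotProduct_smul, smul_eq_mul]
  simp only [dotProduct_comm z₁', dotProduct_comm z₂', dotProduct_comm z₁ Z₁,
    dotProduct_comm z₂ Z₂]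
  field_simp
  ring

/-- The Levi-Civita connection in the model coordinates. -/
def modelNabla {m : ℕ} (c k l a b : ℝ) (x y : Model m) : Model m :=
  (1 / 2 : ℝ) • (modelBracket c x y - modelAdjoint c k l a b y x - modelAdjoint c k l a b x y)

/-! ### The connection and the Ricci tensor in coordinates -/

section
variable {m : ℕ} {c k l a b : ℝ}

theorem modelForm_add_left (x y w : Model m) :
    modelForm k l a b (x + y) w = modelForm k l a b x w + modelForm k l a b y w := by
  obtain ⟨r, t, s, p₁, p₂, q₁, q₂, z₁, z₂, u₁, u₂⟩ := x
  obtain ⟨R, T, S, P₁, P₂, Q₁, Q₂, Z₁, Z₂, U₁, U₂⟩ := y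
  obtain ⟨r', t', s', p₁', p₂', q₁', q₂', z₁', z₂', u₁', u₂'⟩ := w
  simp only [modelForm, add_dotProduct]
  ring

theorem modelForm_smul_left (e : ℝ) (x w : Model m) :
    modelForm k l a b (e • x) w = e * modelForm k l a b x w := by
  obtain ⟨r, t, s, p₁, p₂, q₁, q₂, z₁, z₂, u₁, u₂⟩ := x
  obtain ⟨r', t', s', p₁', p₂', q₁', q₂', z₁', z₂', u₁', u₂'⟩ := w
  simp only [modelForm, Prod.smul_mk, smul_dotProduct, smul_eq_mul]
  ring

theorem modelForm_sub_left (x y w : Model m) :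
    modelForm k l a b (x - y) w = modelForm k l a b x w - modelForm k l a b y w := by
  rw [sub_eq_add_neg, modelForm_add_left, ← neg_one_smul ℝ, modelForm_smul_left]
  ring

theorem modelForm_comm (x w : Model m) :
    modelForm k l a b x w = modelForm k l a b w x := by
  obtain ⟨r, t, s, p₁, p₂, q₁, q₂, z₁, z₂, u₁, u₂⟩ := x
  obtain ⟨r', t', s', p₁', p₂', q₁', q₂', z₁', z₂', u₁', u₂'⟩ := w
  simp only [modelForm, dotProduct_comm z₁, dotProduct_comm z₂, dotProduct_comm u₁,
    dotProduct_comm u₂]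
  ring

/-- Only the `r`-component of `y` contributes to `tr ad y`. -/
theorem trace_ad_of_model {𝔤 : Type*} [LieRing 𝔤] [LieAlgebra ℝ 𝔤] [FiniteDimensional ℝ 𝔤]
    (Φ : 𝔤 ≃ₗ[ℝ] Model m) (hΦ : ∀ x y, Φ ⁅x, y⁆ = modelBracket c (Φ x) (Φ y)) (y : 𝔤) :
    LinearMap.trace ℝ 𝔤 (LieAlgebra.ad ℝ 𝔤 y) = (2 * m + 2) * (Φ y).1 := by
  rw [← LinearMap.trace_conj' _ Φ, trace_model]
  simp only [LinearEquiv.conj_apply_apply, LieAlgebra.ad_apply, hΦ, LinearEquiv.apply_symm_apply]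
  generalize Φ y = Y
  obtain ⟨r, t, s, p₁, p₂, q₁, q₂, z₁, z₂, u₁, u₂⟩ := Y
  simp [modelBracket]
  ring

variable {𝔤 : Type*} [LieRing 𝔤] [LieAlgebra ℝ 𝔤] [FiniteDimensional ℝ 𝔤]

/-- By the Koszul formula, `2 ∇_x y = [x,y] - (ad y)^* x - (ad x)^* y`. -/
theorem nabla_of_model (g : LeftInvariantMetric 𝔤) (Φ : 𝔤 ≃ₗ[ℝ] Model m)
    (hΦ : ∀ x y, Φ ⁅x, y⁆ = modelBracket c (Φ x) (Φ y))
    (hg : ∀ x y, g.form x y = modelForm k l a b (Φ x) (Φ y))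
    (hk : k ≠ 0) (ha : a ≠ 0) (hb : b ≠ 0) (x y : 𝔤) :
    Φ (g.nabla x y) = modelNabla c k l a b (Φ x) (Φ y) := by
  rw [← LinearEquiv.eq_symm_apply]
  refine g.form_ext fun w => ?_
  rw [LeftInvariantMetric.form_nabla, ← lie_skew w x, hg, hg, map_neg]
  simp only [LinearMap.neg_apply, hg, hΦ, LinearEquiv.apply_symm_apply, modelNabla,
    modelForm_smul_left, modelForm_sub_left, modelForm_modelAdjoint c k l a b hk ha hb]
  rw [modelForm_comm (Φ x), modelForm_comm (Φ y)]
  ring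

/-- The Ricci quadratic form in the model coordinates: minus the trace of `ad (∇_y y)` minus the
trace of the square of `x ↦ ∇_x y`. -/
theorem ricciTensor_of_model (g : LeftInvariantMetric 𝔤) (Φ : 𝔤 ≃ₗ[ℝ] Model m)
    (hΦ : ∀ x y, Φ ⁅x, y⁆ = modelBracket c (Φ x) (Φ y))
    (hg : ∀ x y, g.form x y = modelForm k l a b (Φ x) (Φ y))
    (hk : k ≠ 0) (ha : a ≠ 0) (hb : b ≠ 0) (y : 𝔤) (N : Model m → Model m)
    (hN : ∀ x, N x = modelNabla c k l a b x (Φ y)) :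
    g.ricciTensor y y = -(2 * m + 2) * (N (Φ y)).1
      - (
        (N (N (1, 0, 0, 0, 0, 0, 0, 0, 0, 0, 0))).1
        + (N (N (0, 1, 0, 0, 0, 0, 0, 0, 0, 0, 0))).2.1
        + (N (N (0, 0, 1, 0, 0, 0, 0, 0, 0, 0, 0))).2.2.1
        + (N (N (0, 0, 0, 1, 0, 0, 0, 0, 0, 0, 0))).2.2.2.1
        + (N (N (0, 0, 0, 0, 1, 0, 0, 0, 0, 0, 0))).2.2.2.2.1
        + (N (N (0, 0, 0, 0, 0, 1, 0, 0, 0, 0, 0))).2.2.2.2.2.1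
        + (N (N (0, 0, 0, 0, 0, 0, 1, 0, 0, 0, 0))).2.2.2.2.2.2.1
        + ∑ e, (N (N (0, 0, 0, 0, 0, 0, 0, Pi.single e 1, 0, 0, 0))).2.2.2.2.2.2.2.1 e
        + ∑ e, (N (N (0, 0, 0, 0, 0, 0, 0, 0, Pi.single e 1, 0, 0))).2.2.2.2.2.2.2.2.1 e
        + ∑ e, (N (N (0, 0, 0, 0, 0, 0, 0, 0, 0, Pi.single e 1, 0))).2.2.2.2.2.2.2.2.2.1 e
        + ∑ e, (N (N (0, 0, 0, 0, 0, 0, 0, 0, 0, 0, Pi.single e 1))).2.2.2.2.2.2.2.2.2.2 e) := by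
  rw [LeftInvariantMetric.ricciTensor_eq, trace_ad_of_model Φ hΦ,
    nabla_of_model g Φ hΦ hg hk ha hb, ← LinearMap.trace_conj' (_ * _) Φ, trace_model]
  simp only [LinearEquiv.conj_apply_apply, Module.End.mul_apply,
    LeftInvariantMetric.nablaFlip_apply, nabla_of_model g Φ hΦ hg hk ha hb,
    LinearEquiv.apply_symm_apply, ← hN]
  ring

/-- The shape taken by the diagonal sums over the `m`-dimensional blocks in the trace formula. -/
theorem sum_const_add_sq (f₀ f₁ f₂ f₃ f₄ : ℝ) (z₁ z₂ u₁ u₂ : Fin m → ℝ) :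
    ∑ e, (f₀ + f₁ * (z₁ e * z₁ e) + f₂ * (z₂ e * z₂ e) + f₃ * (u₁ e * u₁ e)
        + f₄ * (u₂ e * u₂ e))
      = m * f₀ + f₁ * (z₁ ⬝ᵥ z₁) + f₂ * (z₂ ⬝ᵥ z₂) + f₃ * (u₁ ⬝ᵥ u₁) + f₄ * (u₂ ⬝ᵥ u₂) := by
  simp [Finset.sum_add_distrib, dotProduct, Finset.mul_sum]

set_option maxHeartbeats 1000000 in
/-- The Ricci form in the undeformed case: it is diagonal, with eigenvalue `-(2m + 8)` on the
matrix part, `-2` on `ℂ^n` and `2m + 4` on the centre. -/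
theorem ricciTensor_of_model_zero (g : LeftInvariantMetric 𝔤) (Φ : 𝔤 ≃ₗ[ℝ] Model m)
    (hΦ : ∀ x y, Φ ⁅x, y⁆ = modelBracket 0 (Φ x) (Φ y)) (hb : b ≠ 0)
    (hg : ∀ x y, g.form x y = modelForm 1 (4 * b ^ 2) b b (Φ x) (Φ y)) (y : 𝔤) :
    g.ricciTensor y y
      = modelForm (-(2 * m + 8)) ((2 * m + 4) * (4 * b ^ 2)) (-2 * b) (-2 * b) (Φ y) (Φ y) := by
  have key := fun N => ricciTensor_of_model g Φ hΦ hg one_ne_zero hb hb y N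
  generalize Φ y = Y at key ⊢
  obtain ⟨r, t, s, p₁, p₂, q₁, q₂, z₁, z₂, u₁, u₂⟩ := Y
  obtain ⟨N, hN⟩ : ∃ N : Model m → Model m, ∀ x, N x
      = modelNabla 0 1 (4 * b ^ 2) b b x (r, t, s, p₁, p₂, q₁, q₂, z₁, z₂, u₁, u₂) :=
    ⟨_, fun _ => rfl⟩
  rw [key N hN]
  have h_self : (N (r, t, s, p₁, p₂, q₁, q₂, z₁, z₂, u₁, u₂)).1
      = 2 * t ^ 2 + z₁ ⬝ᵥ z₁ + z₂ ⬝ᵥ z₂ - 2 * b * (p₁ * q₁ + p₂ * q₂) := by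
    simp [hN, modelNabla, modelBracket, modelAdjoint]
    ring
  have h0 : (N (N (1, 0, 0, 0, 0, 0, 0, 0, 0, 0, 0))).1
      = 0 := by
    simp [hN, modelNabla, modelBracket, modelAdjoint]
    field_simp
    ring
  have h1 : (N (N (0, 1, 0, 0, 0, 0, 0, 0, 0, 0, 0))).2.1
      = 4 * r ^ 2 + z₁ ⬝ᵥ z₁ + z₂ ⬝ᵥ z₂ + 2 * b * (p₁ * q₁ + p₂ * q₂) := by
    simp [hN, modelNabla, modelBracket, modelAdjoint]
    field_simp
    ring
  have h2 : (N (N (0, 0, 1, 0, 0, 0, 0, 0, 0, 0, 0))).2.2.1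
      = b * (p₁ ^ 2 + p₂ ^ 2 + q₁ ^ 2 + q₂ ^ 2 + u₁ ⬝ᵥ u₁ + u₂ ⬝ᵥ u₂) := by
    simp [hN, modelNabla, modelBracket, modelAdjoint]
    field_simp
    ring
  have h3 : (N (N (0, 0, 0, 1, 0, 0, 0, 0, 0, 0, 0))).2.2.2.1
      = b * p₂ * q₂ + b * p₂ ^ 2 - 4 * b ^ 2 * s ^ 2 + r ^ 2 + t ^ 2 + z₁ ⬝ᵥ z₁ + z₂ ⬝ᵥ z₂ := by
    simp [hN, modelNabla, modelBracket, modelAdjoint]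
    field_simp
    ring
  have h4 : (N (N (0, 0, 0, 0, 1, 0, 0, 0, 0, 0, 0))).2.2.2.2.1
      = b * p₁ * q₁ + b * p₁ ^ 2 - 4 * b ^ 2 * s ^ 2 + r ^ 2 + t ^ 2 + z₁ ⬝ᵥ z₁ + z₂ ⬝ᵥ z₂ := by
    simp [hN, modelNabla, modelBracket, modelAdjoint]
    field_simp
    ring
  have h5 : (N (N (0, 0, 0, 0, 0, 1, 0, 0, 0, 0, 0))).2.2.2.2.2.1
      = b * p₂ * q₂ + b * q₂ ^ 2 - 4 * b ^ 2 * s ^ 2 + r ^ 2 + t ^ 2 := by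
    simp [hN, modelNabla, modelBracket, modelAdjoint]
    field_simp
    ring
  have h6 : (N (N (0, 0, 0, 0, 0, 0, 1, 0, 0, 0, 0))).2.2.2.2.2.2.1
      = b * p₁ * q₁ + b * q₁ ^ 2 - 4 * b ^ 2 * s ^ 2 + r ^ 2 + t ^ 2 := by
    simp [hN, modelNabla, modelBracket, modelAdjoint]
    field_simp
    ring
  have h7 : ∀ e, (N (N (0, 0, 0, 0, 0, 0, 0, Pi.single e 1, 0, 0, 0))).2.2.2.2.2.2.2.1 e
      = (r ^ 2 - t ^ 2 + b * (p₁ * q₁ + p₂ * q₂)) + 0 * (z₁ e * z₁ e) + 1 * (z₂ e * z₂ e)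
        + 0 * (u₁ e * u₁ e) + 0 * (u₂ e * u₂ e) := fun e => by
    simp [hN, modelNabla, modelBracket, modelAdjoint]
    field_simp
    ring
  have h8 : ∀ e, (N (N (0, 0, 0, 0, 0, 0, 0, 0, Pi.single e 1, 0, 0))).2.2.2.2.2.2.2.2.1 e
      = (r ^ 2 - t ^ 2 + b * (p₁ * q₁ + p₂ * q₂)) + 1 * (z₁ e * z₁ e) + 0 * (z₂ e * z₂ e)
        + 0 * (u₁ e * u₁ e) + 0 * (u₂ e * u₂ e) := fun e => by
    simp [hN, modelNabla, modelBracket, modelAdjoint]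
    field_simp
    ring
  have h9 : ∀ e, (N (N (0, 0, 0, 0, 0, 0, 0, 0, 0, Pi.single e 1, 0))).2.2.2.2.2.2.2.2.2.1 e
      = (b * (p₁ * q₁ + p₂ * q₂) - 4 * b ^ 2 * s ^ 2) + 1 * (z₁ e * z₁ e) + 1 * (z₂ e * z₂ e)
        + 0 * (u₁ e * u₁ e) + b * (u₂ e * u₂ e) := fun e => by
    simp [hN, modelNabla, modelBracket, modelAdjoint]
    field_simp
    ring
  have h10 : ∀ e, (N (N (0, 0, 0, 0, 0, 0, 0, 0, 0, 0, Pi.single e 1))).2.2.2.2.2.2.2.2.2.2 e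
      = (b * (p₁ * q₁ + p₂ * q₂) - 4 * b ^ 2 * s ^ 2) + 1 * (z₁ e * z₁ e) + 1 * (z₂ e * z₂ e)
        + b * (u₁ e * u₁ e) + 0 * (u₂ e * u₂ e) := fun e => by
    simp [hN, modelNabla, modelBracket, modelAdjoint]
    field_simp
    ring
  rw [h_self]
  simp only [h0, h1, h2, h3, h4, h5, h6, h7, h8, h9, h10, sum_const_add_sq, modelForm]
  ring

set_option maxHeartbeats 1000000 in
/-- The Ricci form on the negative basis vector `e₀` of `ℂ^n`. -/
theorem ricciTensor_of_model_time (g : LeftInvariantMetric 𝔤) (Φ : 𝔤 ≃ₗ[ℝ] Model m)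
    (hΦ : ∀ x y, Φ ⁅x, y⁆ = modelBracket c (Φ x) (Φ y))
    (hg : ∀ x y, g.form x y = modelForm k l a b (Φ x) (Φ y))
    (hk : k ≠ 0) (ha : a ≠ 0) (hb : b ≠ 0) (y : 𝔤)
    (hy : Φ y = (0, 0, 0, 1, 0, 0, 0, 0, 0, 0, 0)) :
    g.ricciTensor y y = a * ((m + 1) * (a / (k * b) - b / (k * a)) - l / (2 * a ^ 2)) := by
  rw [ricciTensor_of_model g Φ hΦ hg hk ha hb y _ fun _ => rfl, hy]
  simp [modelNabla, modelBracket, modelAdjoint]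
  field_simp
  ring

set_option maxHeartbeats 1000000 in
/-- The Ricci form on the positive basis vector `e₁` of `ℂ^n`. -/
theorem ricciTensor_of_model_space (g : LeftInvariantMetric 𝔤) (Φ : 𝔤 ≃ₗ[ℝ] Model m)
    (hΦ : ∀ x y, Φ ⁅x, y⁆ = modelBracket c (Φ x) (Φ y))
    (hg : ∀ x y, g.form x y = modelForm k l a b (Φ x) (Φ y))
    (hk : k ≠ 0) (ha : a ≠ 0) (hb : b ≠ 0) (y : 𝔤)
    (hy : Φ y = (0, 0, 0, 0, 0, 1, 0, 0, 0, 0, 0)) :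
    g.ricciTensor y y = b * (b / (k * a) - a / (k * b) - l / (2 * b ^ 2)) := by
  rw [ricciTensor_of_model g Φ hΦ hg hk ha hb y _ fun _ => rfl, hy]
  simp [modelNabla, modelBracket, modelAdjoint]
  field_simp
  ring

end

section

open Matrix ComplexConjugate

variable {d : ℕ}

/-! ### The Hermitian form of signature `(1, n-1)` -/

/-- The Hermitian form `-ā⁰ b⁰ + ∑ ā^i b^i` on `ℂⁿ`, conjugate linear in the first argument. -/
def herm (a b : Fin (d + 1) → ℂ) : ℂ := star a ⬝ᵥ (sgn *ᵥ b)

theorem herm_eq (a b : Fin (d + 1) → ℂ) :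
    herm a b = -(conj (a 0) * b 0) + ∑ i : Fin d, conj (a i.succ) * b i.succ := by
  simp [herm, dotProduct, sgn, Matrix.mulVec_diagonal, Fin.sum_univ_succ]

theorem herm_sub_left (a a' b : Fin (d + 1) → ℂ) : herm (a - a') b = herm a b - herm a' b := by
  simp only [herm, star_sub, sub_dotProduct]

theorem herm_sub_right (a b b' : Fin (d + 1) → ℂ) : herm a (b - b') = herm a b - herm a b' := by
  simp only [herm, Matrix.mulVec_sub, dotProduct_sub]

theorem herm_neg_left (a b : Fin (d + 1) → ℂ) : herm (-a) b = -herm a b := by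
  simp only [herm, star_neg, neg_dotProduct]

theorem herm_neg_right (a b : Fin (d + 1) → ℂ) : herm a (-b) = -herm a b := by
  simp only [herm, Matrix.mulVec_neg, dotProduct_neg]

theorem herm_zero_right (a : Fin (d + 1) → ℂ) : herm a 0 = 0 := by
  simp only [herm, Matrix.mulVec_zero, dotProduct_zero]

theorem herm_smul_left (z : ℂ) (a b : Fin (d + 1) → ℂ) : herm (z • a) b = conj z * herm a b := by
  simp only [herm, star_smul, smul_dotProduct, smul_eq_mul]; rfl

theorem herm_smul_right (z : ℂ) (a b : Fin (d + 1) → ℂ) : herm a (z • b) = z * herm a b := by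
  simp only [herm, Matrix.mulVec_smul, dotProduct_smul, smul_eq_mul]

theorem conj_herm (a b : Fin (d + 1) → ℂ) : conj (herm a b) = herm b a := by
  simp only [herm_eq, map_add, map_neg, map_mul, map_sum, Complex.conj_conj, mul_comm]

theorem herm_mulVec (A : uLie d) (a b : Fin (d + 1) → ℂ) :
    herm ((A : Mat d) *ᵥ a) b = -herm a ((A : Mat d) *ᵥ b) := by
  have hA : -(sgn * (A : Mat d)ᴴ * sgn) = (A : Mat d) := A.2
  have h : (A : Mat d)ᴴ * sgn = -(sgn * (A : Mat d)) := by
    conv_rhs => rw [← hA, Matrix.mul_neg, ← Matrix.mul_assoc, ← Matrix.mul_assoc, sgn_mul_sgn,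
      Matrix.one_mul, neg_neg]
  rw [herm, herm, Matrix.star_mulVec, ← Matrix.dotProduct_mulVec, Matrix.mulVec_mulVec, h,
    Matrix.neg_mulVec, dotProduct_neg, Matrix.mulVec_mulVec]

theorem herm_transpose_mulVec (A : uLie d) (a b : Fin (d + 1) → ℂ) :
    herm ((A : Mat d)ᵀ *ᵥ a) b = -herm a ((A : Mat d)ᵀ *ᵥ b) := by
  have hA : -(sgn * (A : Mat d)ᴴ * sgn) = (A : Mat d) := A.2
  have h : (A : Mat d)ᵀᴴ * sgn = -(sgn * (A : Mat d)ᵀ) := by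
    have h1 := congrArg Matrix.transpose hA
    have h2 : (sgn : Mat d)ᵀ = sgn := by simp [sgn]
    rw [Matrix.transpose_neg, Matrix.transpose_mul, Matrix.transpose_mul, h2] at h1
    have h3 : sgn * (A : Mat d)ᵀ = -((A : Mat d)ᴴᵀ * sgn) := by
      rw [← h1, Matrix.mul_neg, ← Matrix.mul_assoc, sgn_mul_sgn, Matrix.one_mul]
    rw [h3, neg_neg]
    rfl
  rw [herm, herm, Matrix.star_mulVec, ← Matrix.dotProduct_mulVec, Matrix.mulVec_mulVec, h,
    Matrix.neg_mulVec, dotProduct_neg, Matrix.mulVec_mulVec]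

theorem coe_right_eq_matPart (x : SolvLie d) : ((x.right : uLie d) : Mat d) = matPart x := rfl

/-! ### The fundamental vector fields -/

/-- The lift `ζ = (1, X)` of a point of the ball. -/
def lift (q : Coord d) : Fin (d + 1) → ℂ := Fin.cons 1 q.1

/-- The derivative `(0, dX)` of the lift `ζ = (1, X)`. -/
def dlift (u : Coord d) : Fin (d + 1) → ℂ := Fin.cons 0 u.1

theorem lift_zero (q : Coord d) : lift q 0 = 1 := rfl
theorem lift_succ (q : Coord d) (i : Fin d) : lift q i.succ = q.1 i := rfl
theorem dlift_zero (q : Coord d) : dlift q 0 = 0 := rfl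
theorem dlift_succ (q : Coord d) (i : Fin d) : dlift q i.succ = q.1 i := rfl

theorem lift_add_smul (q u : Coord d) (t : ℝ) :
    lift (q + t • u) = lift q + t • dlift u := by
  funext i
  refine Fin.cases ?_ (fun i => ?_) i <;> simp [lift, dlift]

/-- The function `1 - ‖X‖²` is minus the Hermitian square of the lift. -/
theorem hFun_eq_herm (q : Coord d) : herm (lift q) (lift q) = -(hFun q : ℂ) := by
  rw [herm_eq]
  simp only [lift_zero, lift_succ, hFun, Complex.ofReal_sub, Complex.ofReal_sum,
    Complex.normSq_eq_conj_mul_self]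
  simp [sub_eq_add_neg, add_comm]

theorem xForm_eq_herm (q u : Coord d) : xForm q u = herm (lift q) (dlift u) := by
  rw [herm_eq]
  simp [dlift_zero, lift_succ, dlift_succ, xForm]

theorem wForm_eq (q u : Coord d) : wForm q u = lift q ⬝ᵥ u.2.2 := by
  simp [wForm, dotProduct, Fin.sum_univ_succ, lift_zero, lift_succ]

theorem phiForm_eq (c : ℝ) (q u : Coord d) : phiForm c q u
    = u.2.1 - 4 * omega q.2.2 u.2.2 + 2 * c / hFun q * (xForm q u).im := rfl

/-- The metric in terms of the Hermitian form. -/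
theorem levelMetric_eq (c ρ : ℝ) (q u v : Coord d) :
    levelMetric c ρ q u v = (ρ + c) / ρ * (1 / hFun q *
        ((herm (dlift u) (dlift v)).re + 1 / hFun q * reInner (xForm q u) (xForm q v)))
      + 1 / (4 * ρ ^ 2) * ((ρ + c) / (ρ + 2 * c)) * (phiForm c q u * phiForm c q v)
      + 2 / ρ * (herm u.2.2 v.2.2).re
      + (ρ + c) / ρ ^ 2 * 4 * (1 / hFun q * reInner (wForm q u) (wForm q v)) := by
  simp only [levelMetric, oneLoopMetric, herm_eq, dlift_zero, dlift_succ, reInner]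
  simp
  ring

theorem killingField_fst (c : ℝ) (q : Coord d) (x : SolvLie d) (i : Fin d) :
    (killingField c q x).1 i
      = (matPart x *ᵥ lift q) i.succ - q.1 i * (matPart x *ᵥ lift q) 0 := rfl

theorem killingField_snd_fst (c : ℝ) (q : Coord d) (x : SolvLie d) :
    (killingField c q x).2.1 = -2 * c * ((matPart x *ᵥ lift q) 0).im
      + √2 * omega (vecPart x) q.2.2 + zPart x := rfl

theorem killingField_snd_snd (c : ℝ) (q : Coord d) (x : SolvLie d) :
    (killingField c q x).2.2
      = -((matPart x)ᵀ *ᵥ q.2.2) + (1 / (2 * √2)) • vecPart x := rfl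

/-- The lift moves by the linear action of `A`, projected back to the slice `ζ⁰ = 1`. -/
theorem dlift_killingField (c : ℝ) (q : Coord d) (x : SolvLie d) :
    dlift (killingField c q x)
      = matPart x *ᵥ lift q - (matPart x *ᵥ lift q) 0 • lift q := by
  funext i
  refine Fin.cases ?_ (fun i => ?_) i
  · simp [dlift_zero, lift_zero]
  · simp [dlift_succ, lift_succ, killingField_fst, mul_comm]

theorem contDiff_killingField (c : ℝ) (x : SolvLie d) :
    ContDiff ℝ ∞ (fun q : Coord d => killingField c q x) := by
  have h : ∀ i, ContDiff ℝ ∞ (fun q : Coord d => (matPart x *ᵥ lift q) i) := fun i => by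
    simp only [Matrix.mulVec, dotProduct, Fin.sum_univ_succ, lift_zero, lift_succ]
    fun_prop
  have h1 : ContDiff ℝ ∞ fun q : Coord d => (killingField c q x).1 := by
    refine contDiff_pi.2 fun i => ?_
    simp only [killingField_fst]
    exact (h _).sub (ContDiff.mul (by fun_prop) (h 0))
  have h2 : ContDiff ℝ ∞ fun q : Coord d => (killingField c q x).2.1 := by
    have h0 := Complex.imCLM.contDiff.comp (h 0)
    have h3 : ContDiff ℝ ∞ fun q : Coord d => omega (vecPart x) q.2.2 := by
      refine Complex.imCLM.contDiff.comp (g := Complex.im) ?_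
      fun_prop
    simp only [killingField_snd_fst]
    exact ((contDiff_const.mul h0).add (contDiff_const.mul h3)).add contDiff_const
  have h3 : ContDiff ℝ ∞ fun q : Coord d => (killingField c q x).2.2 := by
    simp only [killingField_snd_snd]
    refine ContDiff.add ?_ contDiff_const
    refine contDiff_pi.2 fun i => ?_
    simp only [Matrix.mulVec, dotProduct, Pi.neg_apply]
    fun_prop
  exact h1.prodMk (h2.prodMk h3)

/-- The derivative of the vector field `α(x)` at `q` in direction `u`. -/
def killingDeriv (c : ℝ) (x : SolvLie d) (q u : Coord d) : Coord d :=
  (fun i => (matPart x *ᵥ dlift u) i.succ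
      - (u.1 i * (matPart x *ᵥ lift q) 0 + q.1 i * (matPart x *ᵥ dlift u) 0),
    -2 * c * ((matPart x *ᵥ dlift u) 0).im + √2 * omega (vecPart x) u.2.2,
    -((matPart x)ᵀ *ᵥ u.2.2))

theorem dlift_killingDeriv (c : ℝ) (x : SolvLie d) (q u : Coord d) :
    dlift (killingDeriv c x q u) = matPart x *ᵥ dlift u - (matPart x *ᵥ lift q) 0 • dlift u
      - (matPart x *ᵥ dlift u) 0 • lift q := by
  funext i
  refine Fin.cases ?_ (fun i => ?_) i
  · simp [dlift_zero, lift_zero]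
  · simp [dlift_succ, lift_succ, killingDeriv]
    ring

theorem hasDerivAt_line {E : Type*} [NormedAddCommGroup E] [NormedSpace ℝ E] (a b : E) :
    HasDerivAt (fun t : ℝ => a + t • b) b 0 := by
  simpa using ((hasDerivAt_id (0 : ℝ)).smul_const b).const_add a

theorem hasDerivAt_mulVec_lift (A : Mat d) (q u : Coord d) (i : Fin (d + 1)) :
    HasDerivAt (fun t : ℝ => (A *ᵥ lift (q + t • u)) i) ((A *ᵥ dlift u) i) 0 := by
  simp only [lift_add_smul, Matrix.mulVec_add, Matrix.mulVec_smul, Pi.add_apply, Pi.smul_apply]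
  exact hasDerivAt_line _ _

theorem fderiv_killingField (c : ℝ) (x : SolvLie d) (q u : Coord d) :
    fderiv ℝ (fun q => killingField c q x) q u = killingDeriv c x q u := by
  have h1 : DifferentiableAt ℝ (fun q => killingField c q x) (q + (0 : ℝ) • u) :=
    (contDiff_killingField c x).differentiable (by simp) _
  have h2 := h1.hasFDerivAt.comp_hasDerivAt (0 : ℝ) (hasDerivAt_line q u)
  rw [zero_smul, add_zero] at h2
  refine h2.unique ?_
  refine HasDerivAt.prodMk (hasDerivAt_pi.2 fun i => ?_) (HasDerivAt.prodMk ?_ ?_)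
  · have h3 := (hasDerivAt_mulVec_lift (matPart x) q u i.succ).sub
      ((hasDerivAt_line (q.1 i) (u.1 i)).mul (hasDerivAt_mulVec_lift (matPart x) q u 0))
    exact h3.congr_deriv (by simp)
  · have h3 := Complex.imCLM.hasFDerivAt.comp_hasDerivAt (0 : ℝ)
      (hasDerivAt_mulVec_lift (matPart x) q u 0)
    have h4 := ((h3.const_mul (-2 * c)).add (((hasDerivAt_line (omega (vecPart x) q.2.2)
      (omega (vecPart x) u.2.2)).const_mul √2))).add_const (zPart x)
    have e : ∀ t : ℝ, omega (vecPart x) (q + t • u).2.2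
        = omega (vecPart x) q.2.2 + t • omega (vecPart x) u.2.2 := fun t => by
      rw [smul_eq_mul, ← omega_smul_right, ← omega_add_right]; rfl
    simp only [← e] at h4
    exact h4
  · have h3 := (hasDerivAt_line (-((matPart x)ᵀ *ᵥ q.2.2))
      (-((matPart x)ᵀ *ᵥ u.2.2))).add_const ((1 / (2 * √2)) • vecPart x)
    have e : ∀ t : ℝ, -((matPart x)ᵀ *ᵥ (q + t • u).2.2)
        = -((matPart x)ᵀ *ᵥ q.2.2) + t • -((matPart x)ᵀ *ᵥ u.2.2) := fun t => by
      rw [← Matrix.mulVec_neg, ← Matrix.mulVec_neg, ← Matrix.mulVec_neg, ← Matrix.mulVec_smul,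
        ← Matrix.mulVec_add]
      simp [add_comm]
    simp only [← e] at h3
    exact h3

theorem matPart_lie (x y : SolvLie d) :
    matPart ⁅x, y⁆ = matPart x * matPart y - matPart y * matPart x := rfl

theorem vecPart_lie (x y : SolvLie d) :
    vecPart ⁅x, y⁆ = (matPart y)ᵀ *ᵥ vecPart x - (matPart x)ᵀ *ᵥ vecPart y := by
  change (0 : Fin (d + 1) → ℂ) + -((matPart x)ᵀ *ᵥ vecPart y) - -((matPart y)ᵀ *ᵥ vecPart x) = _
  abel

theorem zPart_lie (x y : SolvLie d) : zPart ⁅x, y⁆ = omega (vecPart x) (vecPart y) := by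
  change omega (vecPart x) (vecPart y) + (0 : ℝ) - 0 = _
  ring

theorem omega_transpose_matPart (x : SolvLie d) (v u : Fin (d + 1) → ℂ) :
    omega ((matPart x)ᵀ *ᵥ v) u = -omega v ((matPart x)ᵀ *ᵥ u) := by
  have h := omega_transpose (x.right : uLie d) v u
  rwa [coe_right_eq_matPart] at h

theorem omega_neg_right (v u : Fin (d + 1) → ℂ) : omega v (-u) = -omega v u := by
  simpa using omega_smul_right (-1) v u

theorem omega_sub_left (v v' u : Fin (d + 1) → ℂ) :
    omega (v - v') u = omega v u - omega v' u := by
  rw [omega_swap u, omega_swap u v, omega_swap u v', sub_eq_add_neg v, omega_add_right,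
    omega_neg_right]
  ring

theorem lieBracket_killingField (c : ℝ) (x y : SolvLie d) (q : Coord d) :
    VectorField.lieBracket ℝ (fun q => killingField c q x) (fun q => killingField c q y) q
      = -killingField c q ⁅x, y⁆ := by
  rw [VectorField.lieBracket, fderiv_killingField, fderiv_killingField]
  refine Prod.ext ?_ (Prod.ext ?_ ?_)
  · funext i
    simp only [Prod.fst_sub, Prod.fst_neg, Pi.sub_apply, Pi.neg_apply, killingDeriv,
      dlift_killingField, killingField_fst, matPart_lie, Matrix.mulVec_sub, Matrix.mulVec_smul,
      Matrix.sub_mulVec, Matrix.mulVec_mulVec, Pi.smul_apply, smul_eq_mul]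
    ring
  · have h2 : √2 * (1 / (2 * √2)) = (1 / 2 : ℝ) := by field_simp
    simp only [Prod.fst_sub, Prod.fst_neg, Prod.snd_sub, Prod.snd_neg, killingDeriv,
      dlift_killingField, killingField_snd_fst, killingField_snd_snd, matPart_lie, vecPart_lie,
      zPart_lie, Matrix.mulVec_sub, Matrix.mulVec_smul, omega_sub_left, omega_add_right,
      omega_neg_right, omega_smul_right, omega_transpose_matPart,
      Matrix.sub_mulVec, Matrix.mulVec_mulVec, Pi.sub_apply, Pi.smul_apply, smul_eq_mul,
      Complex.sub_im, Complex.mul_im]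
    rw [omega_swap (vecPart x) (vecPart y)]
    linear_combination (-2 * omega (vecPart x) (vecPart y)) * h2
  · simp only [Prod.snd_sub, Prod.snd_neg, killingDeriv, killingField_snd_snd, matPart_lie,
      vecPart_lie, Matrix.mulVec_add, Matrix.mulVec_neg, Matrix.mulVec_smul,
      Matrix.mulVec_mulVec, Matrix.transpose_sub, Matrix.transpose_mul, Matrix.sub_mulVec]
    module

/-! ### Invariance of the metric -/

theorem hasDerivAt_herm {f g : ℝ → Fin (d + 1) → ℂ} {f' g' : Fin (d + 1) → ℂ} {t : ℝ}
    (hf : HasDerivAt f f' t) (hg : HasDerivAt g g' t) :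
    HasDerivAt (fun s => herm (f s) (g s)) (herm f' (g t) + herm (f t) g') t := by
  rw [hasDerivAt_pi] at hf hg
  have h : ∀ i, HasDerivAt (fun s => conj (f s i) * g s i)
      (conj (f' i) * g t i + conj (f t i) * g' i) t := fun i =>
    (Complex.conjCLE.toContinuousLinearMap.hasFDerivAt.comp_hasDerivAt t (hf i)).mul (hg i)
  simp only [herm_eq]
  refine ((h 0).fun_neg.add (HasDerivAt.fun_sum fun i _ => h i.succ)).congr_deriv ?_
  rw [Finset.sum_add_distrib]
  ring

theorem hasDerivAt_reInner {f g : ℝ → ℂ} {f' g' : ℂ} {t : ℝ} (hf : HasDerivAt f f' t)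
    (hg : HasDerivAt g g' t) :
    HasDerivAt (fun s => reInner (f s) (g s)) (reInner f' (g t) + reInner (f t) g') t := by
  have h := Complex.reCLM.hasFDerivAt.comp_hasDerivAt t
    ((Complex.conjCLE.toContinuousLinearMap.hasFDerivAt.comp_hasDerivAt t hf).mul hg)
  exact h.congr_deriv (Complex.add_re _ _)

section Invariance

variable (c : ℝ) (x : SolvLie d) (q u v : Coord d)

theorem herm_matPart (a b : Fin (d + 1) → ℂ) :
    herm (matPart x *ᵥ a) b = -herm a (matPart x *ᵥ b) := by
  have h := herm_mulVec (x.right : uLie d) a b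
  rwa [coe_right_eq_matPart] at h

/-- As `A` is skew for the Hermitian form, `Re ⟨ζ, Aζ⟩ = 0`. -/
theorem xForm_killingField :
    (xForm q (killingField c q x)).re = ((matPart x *ᵥ lift q) 0).re * hFun q := by
  have h1 := herm_matPart x (lift q) (lift q)
  rw [← conj_herm] at h1
  have h2 := congrArg Complex.re h1
  rw [Complex.conj_re, Complex.neg_re] at h2
  rw [xForm_eq_herm, dlift_killingField, herm_sub_right, herm_smul_right, hFun_eq_herm]
  simp
  linarith

/-- The derivative of `1 - ‖X‖²` along `α(x)`. -/
theorem hasDerivAt_hFun :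
    HasDerivAt (fun t : ℝ => hFun (q + t • killingField c q x))
      (-2 * ((matPart x *ᵥ lift q) 0).re * hFun q) 0 := by
  have h : ∀ a b : ℂ, HasDerivAt (fun t : ℝ => Complex.normSq (a + t • b))
      (2 * (conj a * b).re) 0 := fun a b => by
    have h1 := hasDerivAt_reInner (hasDerivAt_line a b) (hasDerivAt_line a b)
    simp only [reInner_self] at h1
    refine h1.congr_deriv ?_
    rw [reInner_symm]
    simp [reInner]
    ring
  have h2 : HasDerivAt (fun t : ℝ => hFun (q + t • killingField c q x))
      (-(2 * (xForm q (killingField c q x)).re)) 0 := by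
    rw [xForm, Complex.re_sum, Finset.mul_sum]
    exact (HasDerivAt.fun_sum fun i _ => h (q.1 i) _).const_sub 1
  refine h2.congr_deriv ?_
  rw [xForm_killingField]
  ring

/-- The derivative of the coefficients of `∑ X̄^a dX^a` along `α(x)`, up to the term that the Lie
derivative adds. The remaining summand with `hFun` cancels in the metric. -/
theorem hasDerivAt_xForm :
    HasDerivAt (fun t : ℝ => xForm (q + t • killingField c q x) u)
      (-2 * ((matPart x *ᵥ lift q) 0).re * xForm q u + (matPart x *ᵥ dlift u) 0 * hFun q
        - xForm q (killingDeriv c x q u)) 0 := by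
  simp only [xForm_eq_herm, lift_add_smul]
  refine (hasDerivAt_herm (hasDerivAt_line _ _) (hasDerivAt_const _ _)).congr_deriv ?_
  rw [herm_zero_right, add_zero, dlift_killingField, dlift_killingDeriv,
    herm_sub_left, herm_smul_left, herm_sub_right, herm_sub_right, herm_smul_right,
    herm_smul_right, herm_matPart, hFun_eq_herm]
  have h := Complex.add_conj ((matPart x *ᵥ lift q) 0)
  push_cast at h
  linear_combination (-herm (lift q) (dlift u)) * h

/-- The form `dw⁰ + ∑ X^a dw^a` is rescaled by minus the automorphy factor. -/
theorem hasDerivAt_wForm :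
    HasDerivAt (fun t : ℝ => wForm (q + t • killingField c q x) u)
      (-(matPart x *ᵥ lift q) 0 * wForm q u - wForm q (killingDeriv c x q u)) 0 := by
  simp only [wForm_eq, lift_add_smul, add_dotProduct, smul_dotProduct]
  refine (hasDerivAt_line _ _).congr_deriv ?_
  rw [dlift_killingField, sub_dotProduct, smul_dotProduct]
  simp only [killingDeriv, dotProduct_neg, Matrix.mulVec_transpose,
    dotProduct_comm (lift q) (u.2.2 ᵥ* _), ← Matrix.dotProduct_mulVec]
  rw [dotProduct_comm u.2.2, smul_eq_mul]
  ring

/-- The form `dφ - 4 Im(…) + …` is invariant: the term `-2c Im j` of the `φ`-component of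
`α(x)` compensates the change of the form `2c/(1-‖X‖²) Im(∑ X̄^a dX^a)`. -/
theorem hasDerivAt_phiForm (hq : hFun q ≠ 0) :
    HasDerivAt (fun t : ℝ => phiForm c (q + t • killingField c q x) u)
      (-phiForm c q (killingDeriv c x q u)) 0 := by
  have h1 := Complex.imCLM.hasFDerivAt.comp_hasDerivAt (0 : ℝ) (hasDerivAt_xForm c x q u)
  have h2 := hasDerivAt_hFun c x q
  have h0 : hFun (q + (0 : ℝ) • killingField c q x) ≠ 0 := by simpa using hq
  have e : ∀ t : ℝ, omega (q + t • killingField c q x).2.2 u.2.2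
      = omega q.2.2 u.2.2 + t • omega (killingField c q x).2.2 u.2.2 := fun t => by
    rw [omega_swap u.2.2, omega_swap u.2.2 q.2.2, omega_swap u.2.2 (killingField c q x).2.2]
    change -omega u.2.2 (q.2.2 + t • (killingField c q x).2.2) = _
    rw [omega_add_right, omega_smul_right, smul_eq_mul]
    ring
  have h3 := (((hasDerivAt_line (omega q.2.2 u.2.2) (omega (killingField c q x).2.2
    u.2.2)).const_mul 4).const_sub u.2.1).add (((h2.fun_inv h0).const_mul (2 * c)).mul h1)
  simp only [phiForm_eq, e, div_eq_mul_inv]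
  refine h3.congr_deriv ?_
  have hs : 1 / (2 * √2) * 4 = √2 := by
    have := Real.mul_self_sqrt (show (0 : ℝ) ≤ 2 by norm_num)
    field_simp
    linarith
  have h4 : omega (killingField c q x).2.2 u.2.2
      = omega q.2.2 ((matPart x)ᵀ *ᵥ u.2.2) + 1 / (2 * √2) * omega (vecPart x) u.2.2 := by
    rw [killingField_snd_snd, omega_swap, omega_add_right, omega_neg_right, omega_smul_right,
      omega_swap _ u.2.2, omega_transpose_matPart, omega_swap (vecPart x)]
    ring
  have h5 : omega q.2.2 (killingDeriv c x q u).2.2 = -omega q.2.2 ((matPart x)ᵀ *ᵥ u.2.2) :=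
    omega_neg_right _ _
  have h6 : (killingDeriv c x q u).2.1
      = -2 * c * ((matPart x *ᵥ dlift u) 0).im + √2 * omega (vecPart x) u.2.2 := rfl
  rw [h4, h5, h6]
  generalize 1 / (2 * √2) = σ at hs
  simp
  field_simp
  linear_combination (-omega (vecPart x) u.2.2 * hFun q) * hs

end Invariance

theorem isKillingOn_killingField (c ρ : ℝ) (x : SolvLie d) :
    IsKillingOn (levelDomain d) (levelMetric c ρ) (fun q => killingField c q x) := by
  intro q hq u v
  have hh : hFun q ≠ 0 := (sub_pos.2 hq).ne'
  have hh0 : hFun (q + (0 : ℝ) • killingField c q x) ≠ 0 := by simpa using hh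
  rw [fderiv_killingField, fderiv_killingField]
  have dh := (hasDerivAt_hFun c x q).fun_inv hh0
  have dx := hasDerivAt_reInner (hasDerivAt_xForm c x q u) (hasDerivAt_xForm c x q v)
  have dp := (hasDerivAt_phiForm c x q u hh).mul (hasDerivAt_phiForm c x q v hh)
  have dw := hasDerivAt_reInner (hasDerivAt_wForm c x q u) (hasDerivAt_wForm c x q v)
  have key := (((((dh.mul ((dh.mul dx).const_add (herm (dlift u) (dlift v)).re)).const_mul
    ((ρ + c) / ρ))).add (dp.const_mul (1 / (4 * ρ ^ 2) * ((ρ + c) / (ρ + 2 * c))))).add_const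
      (2 / ρ * (herm u.2.2 v.2.2).re)).add ((dh.mul dw).const_mul ((ρ + c) / ρ ^ 2 * 4))
  simp only [levelMetric_eq, one_div (hFun _)]
  refine key.congr_deriv ?_
  have hu : (killingDeriv c x q u).2.2 = -((matPart x)ᵀ *ᵥ u.2.2) := rfl
  have hv : (killingDeriv c x q v).2.2 = -((matPart x)ᵀ *ᵥ v.2.2) := rfl
  have hflat : (herm (killingDeriv c x q u).2.2 v.2.2).re
      = -(herm u.2.2 (killingDeriv c x q v).2.2).re := by
    have h := herm_transpose_mulVec (x.right : uLie d) u.2.2 v.2.2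
    rw [coe_right_eq_matPart] at h
    rw [hu, hv, herm_neg_left, herm_neg_right, h, Complex.neg_re, Complex.neg_re]
  have hS : (herm (dlift (killingDeriv c x q u)) (dlift v)).re
      + (herm (dlift u) (dlift (killingDeriv c x q v))).re
      = -2 * ((matPart x *ᵥ lift q) 0).re * (herm (dlift u) (dlift v)).re
        - reInner ((matPart x *ᵥ dlift u) 0) (xForm q v)
        - reInner ((matPart x *ᵥ dlift v) 0) (xForm q u) := by
    rw [dlift_killingDeriv, dlift_killingDeriv]
    simp only [herm_sub_left, herm_sub_right, herm_smul_left, herm_smul_right, herm_matPart,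
      ← xForm_eq_herm]
    rw [← conj_herm (lift q) (dlift u), ← xForm_eq_herm]
    simp [reInner]
    ring
  have hS' : (herm (dlift (killingDeriv c x q u)) (dlift v)).re
      = -2 * ((matPart x *ᵥ lift q) 0).re * (herm (dlift u) (dlift v)).re
        - reInner ((matPart x *ᵥ dlift u) 0) (xForm q v)
        - reInner ((matPart x *ᵥ dlift v) 0) (xForm q u)
        - (herm (dlift u) (dlift (killingDeriv c x q v))).re := by linarith
  rw [hflat, hS']
  -- what remains is an identity of rational functions in the following quantities
  simp only [Pi.mul_apply, zero_smul, add_zero]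
  generalize herm (dlift u) (dlift (killingDeriv c x q v)) = e1
  generalize herm (dlift u) (dlift v) = e2
  generalize herm u.2.2 (killingDeriv c x q v).2.2 = e3
  generalize xForm q (killingDeriv c x q u) = e4
  generalize xForm q (killingDeriv c x q v) = e5
  generalize wForm q (killingDeriv c x q u) = e6
  generalize wForm q (killingDeriv c x q v) = e7
  generalize phiForm c q (killingDeriv c x q u) = e8
  generalize phiForm c q (killingDeriv c x q v) = e9
  generalize (matPart x *ᵥ lift q) 0 = j
  generalize (matPart x *ᵥ dlift u) 0 = ju
  generalize (matPart x *ᵥ dlift v) 0 = jv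
  generalize xForm q u = xu
  generalize xForm q v = xv
  generalize wForm q u = wu
  generalize wForm q v = wv
  generalize phiForm c q u = pu
  generalize phiForm c q v = pv
  generalize hFun q = h at hh ⊢
  generalize (ρ + c) / ρ = k1
  generalize 1 / (4 * ρ ^ 2) * ((ρ + c) / (ρ + 2 * c)) = k2
  generalize (ρ + c) / ρ ^ 2 * 4 = k3
  simp [reInner]
  field_simp
  ring

/-! ### Completeness -/

theorem exists_integralCurve_linear {E : Type*} [NormedAddCommGroup E] [NormedSpace ℝ E]
    [CompleteSpace E] (L : E →L[ℝ] E) (a : E) :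
    ∃ γ : ℝ → E, γ 0 = a ∧ ∀ t, HasDerivAt γ (L (γ t)) t := by
  refine ⟨fun t => NormedSpace.exp (t • L) a, by simp, fun t => ?_⟩
  exact (hasDerivAt_exp_smul_const' L t).clm_apply (hasDerivAt_const t a) |>.congr_deriv (by simp)

/-- Affine differential equations with constant coefficients become linear on `E × ℝ`. -/
theorem exists_integralCurve_affine {E : Type*} [NormedAddCommGroup E] [NormedSpace ℝ E]
    [CompleteSpace E] (L : E →L[ℝ] E) (b a : E) :
    ∃ γ : ℝ → E, γ 0 = a ∧ ∀ t, HasDerivAt γ (L (γ t) + b) t := by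
  obtain ⟨γ, h0, hγ⟩ := exists_integralCurve_linear
    ((L.coprod ((ContinuousLinearMap.id ℝ ℝ).smulRight b)).prod (0 : E × ℝ →L[ℝ] ℝ)) (a, 1)
  have h2 : ∀ t, (γ t).2 = 1 := fun t => by
    have hd : ∀ t, HasDerivAt (fun t => (γ t).2) 0 t := fun t =>
      (ContinuousLinearMap.snd ℝ E ℝ).hasFDerivAt.comp_hasDerivAt t (hγ t)
    have := is_const_of_deriv_eq_zero (fun t => (hd t).differentiableAt)
      (fun t => (hd t).deriv) t 0
    simpa [h0] using this
  refine ⟨fun t => (γ t).1, congrArg Prod.fst h0, fun t => ?_⟩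
  refine ((ContinuousLinearMap.fst ℝ E ℝ).hasFDerivAt.comp_hasDerivAt t (hγ t)).congr_deriv ?_
  simp [h2]

theorem mem_levelDomain_iff (q : Coord d) : q ∈ levelDomain d ↔ 0 < hFun q :=
  (sub_pos (b := ∑ a, Complex.normSq (q.1 a))).symm

theorem isCompleteOn_killingField (c : ℝ) (x : SolvLie d) :
    IsCompleteOn (levelDomain d) (fun q => killingField c q x) := by
  intro q hq
  obtain ⟨ζ, hζ0, hζ⟩ := exists_integralCurve_linear
    (LinearMap.toContinuousLinearMap ((Matrix.mulVecLin (matPart x)).restrictScalars ℝ)) (lift q)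
  obtain ⟨w, hw0, hw⟩ := exists_integralCurve_affine
    (-LinearMap.toContinuousLinearMap ((Matrix.mulVecLin (matPart x)ᵀ).restrictScalars ℝ))
    ((1 / (2 * √2) : ℝ) • vecPart x) q.2.2
  replace hζ : ∀ t, HasDerivAt ζ (matPart x *ᵥ ζ t) t := hζ
  replace hw : ∀ t, HasDerivAt w (-((matPart x)ᵀ *ᵥ w t) + (1 / (2 * √2)) • vecPart x) t := hw
  -- the Hermitian form is preserved, so `ζ⁰` never vanishes
  have hpos : ∀ t, (herm (ζ t) (ζ t)).re = -hFun q := fun t => by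
    have hd : ∀ t, HasDerivAt (fun t => herm (ζ t) (ζ t)) 0 t := fun t =>
      (hasDerivAt_herm (hζ t) (hζ t)).congr_deriv (by rw [herm_matPart, neg_add_cancel])
    have h1 := is_const_of_deriv_eq_zero (fun t => (hd t).differentiableAt)
      (fun t => (hd t).deriv) t 0
    rw [h1, hζ0, hFun_eq_herm, Complex.neg_re, Complex.ofReal_re]
  have hne : ∀ t, ζ t 0 ≠ 0 := fun t h => by
    have h1 := hpos t
    rw [herm_eq, h, map_zero, zero_mul, neg_zero, zero_add, Complex.re_sum] at h1
    have h2 : 0 ≤ ∑ i : Fin d, (conj (ζ t i.succ) * ζ t i.succ).re :=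
      Finset.sum_nonneg fun i _ => by
        rw [← Complex.normSq_eq_conj_mul_self, Complex.ofReal_re]
        exact Complex.normSq_nonneg _
    have h3 := (mem_levelDomain_iff q).1 hq
    linarith
  set X : ℝ → Fin d → ℂ := fun t i => ζ t i.succ / ζ t 0 with hX
  have hlift : ∀ t (p : ℝ × (Fin (d + 1) → ℂ)), lift ((X t, p) : Coord d) = (ζ t 0)⁻¹ • ζ t := by
    intro t p
    funext i
    refine Fin.cases ?_ (fun i => ?_) i
    · simp [lift_zero, hne t]
    · simp [lift_succ, hX, div_eq_inv_mul]
  set F : ℝ → ℝ := fun t => -2 * c * ((matPart x *ᵥ ((ζ t 0)⁻¹ • ζ t)) 0).im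
    + √2 * omega (vecPart x) (w t) + zPart x with hF
  have hζc : Continuous ζ := continuous_iff_continuousAt.2 fun t => (hζ t).continuousAt
  have hwc : Continuous w := continuous_iff_continuousAt.2 fun t => (hw t).continuousAt
  have hFc : Continuous F := by
    have h1 : Continuous fun t => (matPart x *ᵥ ((ζ t 0)⁻¹ • ζ t)) 0 := by
      have h2 : Continuous fun t => (ζ t 0)⁻¹ • ζ t :=
        (((continuous_apply 0).comp hζc).inv₀ hne).smul hζc
      simp only [Matrix.mulVec, dotProduct]
      fun_prop
    have h3 : Continuous fun t => omega (vecPart x) (w t) := by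
      unfold omega
      fun_prop
    fun_prop
  refine ⟨fun t => (X t, q.2.1 + ∫ s in (0 : ℝ)..t, F s, w t), ?_, fun t => ⟨?_, ?_⟩⟩
  · refine Prod.ext ?_ (Prod.ext ?_ hw0)
    · funext i
      simp [hX, hζ0, lift_zero, lift_succ]
    · simp
  · rw [mem_levelDomain_iff]
    have h1 := congrArg Complex.re (hFun_eq_herm (X t, q.2.1 + ∫ s in (0 : ℝ)..t, F s, w t))
    rw [hlift, herm_smul_left, herm_smul_right, ← mul_assoc, ← Complex.normSq_eq_conj_mul_self,
      Complex.re_ofReal_mul, hpos] at h1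
    simp only [Complex.neg_re, Complex.ofReal_re] at h1
    have h2 : 0 < Complex.normSq (ζ t 0)⁻¹ := Complex.normSq_pos.2 (inv_ne_zero (hne t))
    have h3 := mul_pos h2 ((mem_levelDomain_iff q).1 hq)
    linarith
  · refine HasDerivAt.prodMk (hasDerivAt_pi.2 fun i => ?_) (HasDerivAt.prodMk ?_ (hw t))
    · have h1 := hasDerivAt_pi.1 (hζ t)
      refine ((h1 i.succ).div (h1 0) (hne t)).congr_deriv ?_
      change _ = (killingField c (X t, q.2.1 + ∫ s in (0 : ℝ)..t, F s, w t) x).1 i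
      rw [killingField_fst, hlift]
      have := hne t
      simp only [hX, Matrix.mulVec_smul, Pi.smul_apply, smul_eq_mul]
      field_simp
    · refine ((hFc.integral_hasStrictDerivAt 0 t).hasDerivAt.const_add q.2.1).congr_deriv ?_
      change _ = (killingField c (X t, q.2.1 + ∫ s in (0 : ℝ)..t, F s, w t) x).2.1
      rw [killingField_snd_fst, hlift]

/-! ### Simple transitivity -/

/-- The first columns of the elements of `𝔟` fill the space `ℂ^d`. -/
theorem exists_mem_bSpan_col (X : Fin d → ℂ) :
    ∃ A : uLie d, A ∈ bSpan d ∧ ∀ b : Fin d, (A : Mat d) b.succ 0 = X b := by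
  set κ : Fin d → ℝ := fun a => if a = firstIdx a then 1 else 1 / 2 with hκ
  have hκ0 : ∀ a, κ a ≠ 0 := fun a => by simp only [hκ]; split_ifs <;> norm_num
  refine ⟨∑ a, ((X a).re / κ a) • bR a + ∑ a, ((X a).im / κ a) • bI a,
    add_mem (sum_mem fun a _ => Submodule.smul_mem _ _ (bR_mem a))
      (sum_mem fun a _ => Submodule.smul_mem _ _ (bI_mem a)), fun b => ?_⟩
  have e : ((∑ a, ((X a).re / κ a) • bR a + ∑ a, ((X a).im / κ a) • bI a : uLie d) : Mat d)
      b.succ 0 = ∑ a, ((X a).re / κ a) • (bR a : Mat d) b.succ 0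
        + ∑ a, ((X a).im / κ a) • (bI a : Mat d) b.succ 0 := by
    simp [Matrix.add_apply, Matrix.sum_apply, Matrix.smul_apply]
  have hκc : ∀ a, (if a = firstIdx a then 1 else 1 / 2 : ℂ) = κ a := fun a => by
    simp only [hκ]; split_ifs <;> simp
  rw [e]
  simp only [bR_col, bI_col, hκc, ite_mul, zero_mul, smul_ite, smul_zero, Finset.sum_ite_eq',
    Finset.mem_univ, if_true]
  have h := hκ0 b
  refine Complex.ext ?_ ?_ <;> simp <;> field_simp

theorem exists_solvLie (X : Fin d → ℂ) (v : Fin (d + 1) → ℂ) :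
    ∃ x : SolvLie d, (∀ b : Fin d, matPart x b.succ 0 = X b) ∧ vecPart x = v ∧ zPart x = 0 := by
  obtain ⟨A, hA, h⟩ := exists_mem_bSpan_col X
  exact ⟨⟨(v, (0 : ℝ)), ⟨A, hA⟩⟩, h, rfl, rfl⟩

/-- The central element `Z` of `𝔩`. -/
def centralElt (d : ℕ) : SolvLie d := ⟨((0 : Fin (d + 1) → ℂ), (1 : ℝ)), 0⟩

theorem matPart_centralElt : matPart (centralElt d) = 0 := rfl
theorem vecPart_centralElt : vecPart (centralElt d) = 0 := rfl
theorem zPart_centralElt : zPart (centralElt d) = 1 := rfl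

/-- Elements of `𝔩` are determined by the first column of the matrix part, the vector part and the
central part. -/
theorem solvLie_ext {x y : SolvLie d} (h1 : ∀ b : Fin d, matPart x b.succ 0 = matPart y b.succ 0)
    (h2 : vecPart x = vecPart y) (h3 : zPart x = zPart y) : x = y := by
  rw [← sub_eq_zero]
  refine killingField_zero_injective 0 _ ?_
  have hA : matPart (x - y) = 0 := by
    have h : ((x - y).right : uLie d) = 0 :=
      eq_zero_of_col _ (x - y).right.2 fun b => sub_eq_zero.2 (h1 b)
    rw [← coe_right_eq_matPart, h]
    rfl
  have hv : vecPart (x - y) = 0 := by rw [map_sub, h2, sub_self]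
  have hz : zPart (x - y) = 0 := by rw [map_sub, h3, sub_self]
  refine Prod.ext ?_ (Prod.ext ?_ ?_)
  · funext i
    rw [killingField_fst, hA]
    simp
  · rw [killingField_snd_fst, hA, hv, hz, omega_zero_left]
    simp
  · rw [killingField_snd_snd, hA, hv]
    simp

theorem killingField_zero_surjective (c : ℝ) :
    Function.Surjective (killingField c (0 : Coord d)) := by
  intro u
  obtain ⟨x, h1, h2, h3⟩ := exists_solvLie u.1 ((2 * √2) • u.2.2)
  have hcol : ∀ b, (matPart x *ᵥ lift (0 : Coord d)) b = matPart x b 0 := fun b => by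
    simp [Matrix.mulVec, dotProduct, Fin.sum_univ_succ, lift_zero, lift_succ]
  refine ⟨x + (u.2.1 + 2 * c * (matPart x 0 0).im) • centralElt d, ?_⟩
  refine Prod.ext ?_ (Prod.ext ?_ ?_)
  · funext i
    rw [killingField_fst, map_add, map_smul, matPart_centralElt, smul_zero, add_zero, hcol, h1]
    simp
  · rw [killingField_snd_fst]
    simp only [map_add, map_smul, matPart_centralElt, vecPart_centralElt, zPart_centralElt,
      smul_zero, add_zero, hcol, h3, zero_add]
    simp [omega_zero_right]
  · rw [killingField_snd_snd]
    simp only [map_add, map_smul, matPart_centralElt, vecPart_centralElt,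
      smul_zero, add_zero, h2]
    have h : 1 / (2 * √2) * (2 * √2) = 1 := by field_simp
    rw [smul_smul, h]
    simp

theorem finrank_solvLie : Module.finrank ℝ (SolvLie d) = Module.finrank ℝ (Coord d) :=
  (LinearEquiv.ofBijective (killingField 0 (0 : Coord d))
    ⟨(injective_iff_map_eq_zero _).2 fun x hx => killingField_zero_injective 0 x hx,
      killingField_zero_surjective 0⟩).finrank_eq

/-- The shape of the matrices in `𝔟`: they are determined by their first column. -/
structure HasIwasawaShape {m : ℕ} (M : Mat (m + 1)) : Prop where
  apply_zero_zero : M 0 0 = (M 1 0).im * Complex.I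
  apply_zero_one : M 0 1 = conj (M 1 0)
  apply_one_one : M 1 1 = -((M 1 0).im * Complex.I)
  apply_zero_succ : ∀ b : Fin m, M 0 b.succ.succ = conj (M b.succ.succ 0)
  apply_one_succ : ∀ b : Fin m, M 1 b.succ.succ = conj (M b.succ.succ 0)
  apply_succ_one : ∀ b : Fin m, M b.succ.succ 1 = -M b.succ.succ 0
  apply_succ_succ : ∀ b e : Fin m, M b.succ.succ e.succ.succ = 0

theorem hasIwasawaShape_bR {m : ℕ} (a : Fin (m + 1)) :
    HasIwasawaShape (bR a : Mat (m + 1)) := by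
  have h1 : (1 : Fin (m + 1 + 1)) = (0 : Fin (m + 1)).succ := rfl
  have h2 : conj (2 : ℂ) = 2 := map_ofNat _ 2
  induction a using Fin.cases with
  | zero =>
    rw [coe_bR_first 0 rfl]
    constructor <;> intros <;> (try rw [h1]) <;> simp [Fin.ext_iff]
  | succ a =>
    have hf : firstIdx a.succ = 0 := rfl
    rw [coe_bR_ne _ (fun h => Fin.succ_ne_zero a h)]
    constructor <;> intros <;> (try rw [h1]) <;>
      simp [Matrix.vecMulVec_apply, etaV, nuV, hf, Pi.single_apply, Fin.ext_iff, apply_ite]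
    all_goals
      intro h
      simp [h, h2]

theorem hasIwasawaShape_bI {m : ℕ} (a : Fin (m + 1)) :
    HasIwasawaShape (bI a : Mat (m + 1)) := by
  have h1 : (1 : Fin (m + 1 + 1)) = (0 : Fin (m + 1)).succ := rfl
  have h2 : conj (2 : ℂ) = 2 := map_ofNat _ 2
  have hf : firstIdx a = 0 := rfl
  induction a using Fin.cases with
  | zero =>
    rw [coe_bI_first 0 rfl]
    constructor <;> intros <;> (try rw [h1]) <;>
      simp [Matrix.vecMulVec_apply, etaV, nuV, hf, Fin.ext_iff]
  | succ a =>
    rw [coe_bI_ne _ (fun h => Fin.succ_ne_zero a h)]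
    constructor <;> intros <;> (try rw [h1]) <;>
      simp [Matrix.vecMulVec_apply, etaV, nuV, hf, Pi.single_apply, Fin.ext_iff, apply_ite]
    all_goals
      intro h
      simp [h, h2, neg_div]

theorem HasIwasawaShape.add {m : ℕ} {M N : Mat (m + 1)} (hM : HasIwasawaShape M)
    (hN : HasIwasawaShape N) : HasIwasawaShape (M + N) := by
  obtain ⟨a1, a2, a3, a4, a5, a6, a7⟩ := hM
  obtain ⟨b1, b2, b3, b4, b5, b6, b7⟩ := hN
  constructor <;> intros <;> simp only [Matrix.add_apply, Complex.add_im, Complex.ofReal_add,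
    map_add, *] <;> ring

theorem HasIwasawaShape.smul {m : ℕ} {M : Mat (m + 1)} (hM : HasIwasawaShape M) (r : ℝ) :
    HasIwasawaShape (r • M) := by
  obtain ⟨a1, a2, a3, a4, a5, a6, a7⟩ := hM
  constructor <;> intros <;> simp only [Matrix.smul_apply, Complex.real_smul,
    Complex.im_ofReal_mul, Complex.ofReal_mul, map_mul, Complex.conj_ofReal, *] <;> ring

theorem hasIwasawaShape_of_mem_bSpan {m : ℕ} {A : uLie (m + 1)} (hA : A ∈ bSpan (m + 1)) :
    HasIwasawaShape (A : Mat (m + 1)) := by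
  unfold bSpan at hA
  induction hA using Submodule.span_induction with
  | mem A h =>
    rcases h with ⟨a, rfl⟩ | ⟨a, rfl⟩
    · exact hasIwasawaShape_bR a
    · exact hasIwasawaShape_bI a
  | zero =>
    change HasIwasawaShape (0 : Mat (m + 1))
    constructor <;> simp
  | add A B _ _ hA hB => exact hA.add hB
  | smul r A _ hA => exact hA.smul r

theorem hasIwasawaShape_matPart {m : ℕ} (x : SolvLie (m + 1)) : HasIwasawaShape (matPart x) := by
  rw [← coe_right_eq_matPart]
  exact hasIwasawaShape_of_mem_bSpan x.right.2

/-- If `α(x)` vanishes at `q`, then `ζ` is an eigenvector of the matrix part, and its eigenvalue has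
real part zero since `ζ` is not null. By the shape of the matrix the eigenvalue is minus the real
part of the `(1, 0)` entry, so it is zero, and the remaining equations make the first column
vanish. -/
theorem killingField_injective (c : ℝ) {q : Coord d} (hq : q ∈ levelDomain d) :
    Function.Injective (killingField c q) := by
  refine (injective_iff_map_eq_zero _).2 fun x hx => ?_
  have hA : ∀ b : Fin d, matPart x b.succ 0 = 0 := by
    cases d with
    | zero => exact fun b => b.elim0
    | succ m =>
      have h0 := xForm_killingField c x q
      have hx' : (xForm q (killingField c q x)).re = 0 := by rw [hx]; simp [xForm]
      rw [hx', eq_comm] at h0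
      have hj := (mul_eq_zero.1 h0).resolve_right (sub_pos.2 hq).ne'
      have hX : ∀ i, (matPart x *ᵥ lift q) i.succ = q.1 i * (matPart x *ᵥ lift q) 0 := fun i => by
        rw [← sub_eq_zero, ← killingField_fst c, hx]
        rfl
      obtain ⟨a1, a2, a3, a4, a5, a6, a7⟩ := hasIwasawaShape_matPart x
      have e0 : (matPart x *ᵥ lift q) 0 = matPart x 0 0 + (matPart x 0 1 * q.1 0
          + ∑ b : Fin m, matPart x 0 b.succ.succ * q.1 b.succ) := by
        simp [Matrix.mulVec, dotProduct, Fin.sum_univ_succ, lift]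
      have e1 : (matPart x *ᵥ lift q) (0 : Fin (m + 1)).succ
          = matPart x 1 0 + (matPart x 1 1 * q.1 0
            + ∑ b : Fin m, matPart x 1 b.succ.succ * q.1 b.succ) := by
        simp [Matrix.mulVec, dotProduct, Fin.sum_univ_succ, lift]
      have e2 : ∀ b : Fin m, (matPart x *ᵥ lift q) b.succ.succ
          = matPart x b.succ.succ 0 + (matPart x b.succ.succ 1 * q.1 0
          + ∑ e : Fin m, matPart x b.succ.succ e.succ.succ * q.1 e.succ) := fun b => by
        simp [Matrix.mulVec, dotProduct, Fin.sum_univ_succ, lift]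
      have hne : (1 : ℂ) - q.1 0 ≠ 0 := fun h => by
        have h1 : q.1 0 = 1 := (sub_eq_zero.1 h).symm
        have h2 := Finset.single_le_sum (f := fun a => Complex.normSq (q.1 a))
          (fun a _ => Complex.normSq_nonneg _) (Finset.mem_univ 0)
        simp only [h1, map_one] at h2
        exact absurd hq (not_lt.2 h2)
      simp only [a4] at e0
      simp only [a5] at e1
      simp only [a6, a7, zero_mul, Finset.sum_const_zero] at e2
      have hxc : matPart x 1 0 = (matPart x 1 0).re + (matPart x 1 0).im * Complex.I :=
        (Complex.re_add_im _).symm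
      have hcc : conj (matPart x 1 0) = (matPart x 1 0).re - (matPart x 1 0).im * Complex.I :=
        Complex.ext (by simp) (by simp)
      -- the eigenvalue on the line of `(1, X)` is minus the real part of the `(1, 0)` entry
      have hjr : (matPart x *ᵥ lift q) 0 = -((matPart x 1 0).re : ℂ) := by
        have h1 := hX 0
        have h2 : (1 - q.1 0) * ((matPart x *ᵥ lift q) 0 + ((matPart x 1 0).re : ℂ)) = 0 := by
          rw [a1, a2, hcc] at e0
          rw [a3] at e1
          linear_combination e0 - e1 + h1 - hxc
        linear_combination (mul_eq_zero.1 h2).resolve_left hne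
      have hr : (matPart x 1 0).re = 0 := by
        rw [hjr] at hj
        simpa using hj
      rw [hr, Complex.ofReal_zero, neg_zero] at hjr
      have hz : ∀ b : Fin m, matPart x b.succ.succ 0 = 0 := fun b => by
        have h1 := hX b.succ
        rw [e2, hjr] at h1
        refine (mul_eq_zero.1 ?_).resolve_left hne
        linear_combination h1
      refine Fin.cases ?_ hz
      simp only [hz, map_zero, zero_mul, Finset.sum_const_zero, hjr, a1, a2, hcc, hr] at e0
      change matPart x 1 0 = 0
      rw [hxc, hr]
      refine (mul_eq_zero.1 ?_).resolve_left hne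
      simp only [Complex.ofReal_zero] at e0 ⊢
      linear_combination -e0
  have hM : matPart x = 0 := by
    rw [← coe_right_eq_matPart, eq_zero_of_col _ x.right.2 hA]
    rfl
  have hv : vecPart x = 0 := by
    have h := congrArg (fun u : Coord d => u.2.2) hx
    simp only [killingField_snd_snd, hM] at h
    have h4 : (1 / (2 * √2) : ℝ) ≠ 0 := by positivity
    exact (smul_eq_zero.1 (by simpa using h)).resolve_left h4
  refine solvLie_ext (fun b => by rw [hA, map_zero]; rfl) (by rw [hv, map_zero]) ?_
  have h := congrArg (fun u : Coord d => u.2.1) hx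
  simp only [killingField_snd_fst, hM, hv, omega_zero_left] at h
  rw [map_zero]
  simpa using h

theorem isSimplyTransitiveIsometricAction_killingField (d : ℕ) (c ρ : ℝ) :
    IsSimplyTransitiveIsometricAction (levelDomain d) (levelMetric c ρ) (killingField c) where
  smooth x := (contDiff_killingField c x).contDiffOn
  anti_hom x y q _ := lieBracket_killingField c x y q
  killing x := isKillingOn_killingField c ρ x
  complete x := isCompleteOn_killingField c x
  bijective q hq := by
    have h := killingField_injective c hq
    exact ⟨h, (LinearMap.injective_iff_surjective_of_finrank_eq_finrank finrank_solvLie).1 h⟩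

/-! ### Bounds for the derived and the lower central series -/

theorem lie_le_of_forall {𝔤 : Type*} [LieRing 𝔤] [LieAlgebra ℝ 𝔤] (I J : LieIdeal ℝ 𝔤)
    (S : Submodule ℝ 𝔤) (h : ∀ x ∈ I, ∀ y ∈ J, ⁅x, y⁆ ∈ S) :
    LieSubmodule.toSubmodule ⁅I, J⁆ ≤ S := by
  rw [LieSubmodule.lieIdeal_oper_eq_linear_span', Submodule.span_le]
  rintro _ ⟨x, hx, y, hy, rfl⟩
  exact h x hx y hy

/-- The subspaces `S k` need not be ideals. -/
theorem derivedSeries_le_of_chain {𝔤 : Type*} [LieRing 𝔤] [LieAlgebra ℝ 𝔤]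
    (S : ℕ → Submodule ℝ 𝔤) (h0 : S 0 = ⊤)
    (hS : ∀ k, ∀ x ∈ S k, ∀ y ∈ S k, ⁅x, y⁆ ∈ S (k + 1)) (k : ℕ) :
    LieSubmodule.toSubmodule (LieAlgebra.derivedSeries ℝ 𝔤 k) ≤ S k := by
  induction k with
  | zero => rw [h0]; exact le_top
  | succ k ih =>
    rw [LieAlgebra.derivedSeries_def, LieAlgebra.derivedSeriesOfIdeal_succ]
    exact lie_le_of_forall _ _ _ fun x hx y hy => hS k x (ih hx) y (ih hy)

/-! ### Adapted coordinates on the Lie algebra -/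

/-- Coordinates on `𝔩`, adapted to the metric: `r + it` and `z` are the entries of the first
column of the matrix part, `p`, `q`, `u` those of the vector part; the shift of the
`Z`-coordinate by `2ct` makes the metric diagonal. -/
def toModelLinear {m : ℕ} (c : ℝ) : SolvLie (m + 1) →ₗ[ℝ] Model m where
  toFun x :=
    ((matPart x 1 0).re, (matPart x 1 0).im, zPart x - 2 * c * (matPart x 1 0).im,
      (vecPart x 0).re, (vecPart x 0).im, (vecPart x 1).re, (vecPart x 1).im,
      fun b => (matPart x b.succ.succ 0).re, fun b => (matPart x b.succ.succ 0).im,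
      fun b => (vecPart x b.succ.succ).re, fun b => (vecPart x b.succ.succ).im)
  map_add' x y := by
    simp only [map_add, Matrix.add_apply, Pi.add_apply, Complex.add_re, Complex.add_im,
      Prod.mk_add_mk, Prod.mk.injEq, true_and]
    exact ⟨by ring, rfl, rfl, rfl, rfl⟩
  map_smul' r x := by
    simp only [map_smul, Matrix.smul_apply, Pi.smul_apply, Complex.smul_re, Complex.smul_im,
      smul_eq_mul, RingHom.id_apply, Prod.smul_mk, Prod.mk.injEq, true_and]
    exact ⟨by ring, rfl, rfl, rfl, rfl⟩

theorem toModelLinear_bijective {m : ℕ} (c : ℝ) :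
    Function.Bijective (toModelLinear (m := m) c) := by
  constructor
  · intro x y h
    simp only [toModelLinear, LinearMap.coe_mk, AddHom.coe_mk, Prod.mk.injEq] at h
    obtain ⟨h1, h2, h3, h4, h5, h6, h7, h8, h9, h10, h11⟩ := h
    refine solvLie_ext (Fin.cases (Complex.ext h1 h2) fun b =>
      Complex.ext (congrFun h8 b) (congrFun h9 b)) ?_ (by rw [h2] at h3; linarith)
    funext i
    exact Fin.cases (Complex.ext h4 h5) (Fin.cases (Complex.ext h6 h7) fun b =>
      Complex.ext (congrFun h10 b) (congrFun h11 b)) i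
  · rintro ⟨r, t, s, p₁, p₂, q₁, q₂, z₁, z₂, u₁, u₂⟩
    obtain ⟨x, h1, h2, h3⟩ := exists_solvLie
      (Fin.cons ⟨r, t⟩ fun b => ⟨z₁ b, z₂ b⟩ : Fin (m + 1) → ℂ)
      (Fin.cons ⟨p₁, p₂⟩ (Fin.cons ⟨q₁, q₂⟩ fun b => ⟨u₁ b, u₂ b⟩) : Fin (m + 1 + 1) → ℂ)
    have h0 : matPart x 1 0 = ⟨r, t⟩ := h1 0
    have hb : ∀ b : Fin m, matPart x b.succ.succ 0 = ⟨z₁ b, z₂ b⟩ := fun b => h1 b.succ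
    have hv : vecPart x 1 = ⟨q₁, q₂⟩ := by rw [h2]; rfl
    refine ⟨x + (s + 2 * c * t) • centralElt (m + 1), ?_⟩
    have e1 : matPart (x + (s + 2 * c * t) • centralElt (m + 1)) = matPart x := by
      rw [map_add, map_smul, matPart_centralElt, smul_zero, add_zero]
    have e2 : vecPart (x + (s + 2 * c * t) • centralElt (m + 1)) = vecPart x := by
      rw [map_add, map_smul, vecPart_centralElt, smul_zero, add_zero]
    have e3 : zPart (x + (s + 2 * c * t) • centralElt (m + 1)) = s + 2 * c * t := by
      rw [map_add, map_smul, zPart_centralElt, h3, smul_eq_mul, mul_one, zero_add]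
    simp only [toModelLinear, LinearMap.coe_mk, AddHom.coe_mk, e1, e2, e3, h0, hb, hv, h2,
      Fin.cons_zero, Fin.cons_succ, add_sub_cancel_right]

/-- The linear isomorphism of `𝔩` with the model space. -/
def toModel {m : ℕ} (c : ℝ) : SolvLie (m + 1) ≃ₗ[ℝ] Model m :=
  LinearEquiv.ofBijective (toModelLinear c) (toModelLinear_bijective c)

theorem toModel_apply {m : ℕ} (c : ℝ) (x : SolvLie (m + 1)) : toModel c x
    = ((matPart x 1 0).re, (matPart x 1 0).im, zPart x - 2 * c * (matPart x 1 0).im,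
      (vecPart x 0).re, (vecPart x 0).im, (vecPart x 1).re, (vecPart x 1).im,
      fun b => (matPart x b.succ.succ 0).re, fun b => (matPart x b.succ.succ 0).im,
      fun b => (vecPart x b.succ.succ).re, fun b => (vecPart x b.succ.succ).im) := rfl

set_option maxHeartbeats 1000000 in
theorem toModel_lie {m : ℕ} (c : ℝ) (x y : SolvLie (m + 1)) :
    toModel c ⁅x, y⁆ = modelBracket c (toModel c x) (toModel c y) := by
  rw [toModel_apply, toModel_apply, toModel_apply, matPart_lie, vecPart_lie, zPart_lie]
  obtain ⟨a1, a2, a3, a4, a5, a6, a7⟩ := hasIwasawaShape_matPart x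
  obtain ⟨b1, b2, b3, b4, b5, b6, b7⟩ := hasIwasawaShape_matPart y
  generalize matPart x = A at *
  generalize matPart y = B at *
  generalize vecPart x = v
  generalize vecPart y = w
  simp only [modelBracket, Prod.mk.injEq]
  have hsum : ∑ b : Fin m, conj (A b.succ.succ 0) * B b.succ.succ 0
      - ∑ b : Fin m, conj (B b.succ.succ 0) * A b.succ.succ 0
      = 2 * Complex.I * ((∑ b : Fin m, (A b.succ.succ 0).re * (B b.succ.succ 0).im
        - ∑ b : Fin m, (A b.succ.succ 0).im * (B b.succ.succ 0).re : ℝ) : ℂ) := by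
    rw [← Finset.sum_sub_distrib, ← Finset.sum_sub_distrib, Complex.ofReal_sum, Finset.mul_sum]
    refine Finset.sum_congr rfl fun b _ => Complex.ext ?_ ?_
    · simp
      ring
    · simp
      ring
  have hcol : (A * B - B * A) 1 0
      = 2 * Complex.I * (((A 1 0).re * (B 1 0).im - (B 1 0).re * (A 1 0).im
      + (∑ b : Fin m, (A b.succ.succ 0).re * (B b.succ.succ 0).im
        - ∑ b : Fin m, (A b.succ.succ 0).im * (B b.succ.succ 0).re) : ℝ) : ℂ) := by
    rw [Complex.ofReal_add, mul_add, ← hsum]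
    simp only [Matrix.sub_apply, Matrix.mul_apply, Fin.sum_univ_succ, Fin.succ_zero_eq_one, *]
    have h : A 1 0 * (↑(B 1 0).im * Complex.I) + -(↑(A 1 0).im * Complex.I) * B 1 0
        - (B 1 0 * (↑(A 1 0).im * Complex.I) + -(↑(B 1 0).im * Complex.I) * A 1 0)
        = 2 * Complex.I * (((A 1 0).re * (B 1 0).im - (B 1 0).re * (A 1 0).im : ℝ) : ℂ) := by
      refine Complex.ext ?_ ?_
      · simp
      · simp
        ring
    linear_combination h + hsum
  refine ⟨?_, ?_, ?_, ?_, ?_, ?_, ?_, ?_, ?_, ?_, ?_⟩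
  · rw [hcol]
    simp
  · rw [hcol]
    simp [dotProduct]
    ring
  · rw [hcol]
    simp only [omega]
    simp [Fin.sum_univ_succ, dotProduct, Finset.sum_add_distrib]
    ring
  · simp only [Pi.sub_apply, Matrix.mulVec, dotProduct, Matrix.transpose_apply,
      Fin.sum_univ_succ, Fin.succ_zero_eq_one, *]
    simp
    ring
  · simp only [Pi.sub_apply, Matrix.mulVec, dotProduct, Matrix.transpose_apply,
      Fin.sum_univ_succ, Fin.succ_zero_eq_one, *]
    simp [Finset.sum_add_distrib]
    ring
  · simp only [Pi.sub_apply, Matrix.mulVec, dotProduct, Matrix.transpose_apply,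
      Fin.sum_univ_succ, Fin.succ_zero_eq_one, *]
    simp
    ring
  · simp only [Pi.sub_apply, Matrix.mulVec, dotProduct, Matrix.transpose_apply,
      Fin.sum_univ_succ, Fin.succ_zero_eq_one, *]
    simp [Finset.sum_add_distrib]
    ring
  · funext b
    simp only [Matrix.sub_apply, Matrix.mul_apply, Fin.sum_univ_succ, Fin.succ_zero_eq_one, *]
    simp
    ring
  · funext b
    simp only [Matrix.sub_apply, Matrix.mul_apply, Fin.sum_univ_succ, Fin.succ_zero_eq_one, *]
    simp
    ring
  · funext b
    simp only [Pi.sub_apply, Matrix.mulVec, dotProduct, Matrix.transpose_apply,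
      Fin.sum_univ_succ, Fin.succ_zero_eq_one, *]
    simp
    ring
  · funext b
    simp only [Pi.sub_apply, Matrix.mulVec, dotProduct, Matrix.transpose_apply,
      Fin.sum_univ_succ, Fin.succ_zero_eq_one, *]
    simp
    ring

theorem solvMetric_form (c ρ : ℝ) (hc : 0 ≤ c) (hρ : 0 < ρ) (x y : SolvLie d) :
    (solvMetric d c ρ hc hρ).form x y
      = levelMetric c ρ 0 (killingField c 0 x) (killingField c 0 y) := rfl

theorem mulVec_lift_zero (M : Mat d) (i : Fin (d + 1)) :
    (M *ᵥ lift (0 : Coord d)) i = M i 0 := by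
  simp [Matrix.mulVec, dotProduct, Fin.sum_univ_succ, lift_zero, lift_succ]

/-- The metric at the base point `q = 0`, where `ζ = (1, 0)`. -/
theorem solvMetric_form_eq (c ρ : ℝ) (hc : 0 ≤ c) (hρ : 0 < ρ) (x y : SolvLie d) :
    (solvMetric d c ρ hc hρ).form x y
      = (ρ + c) / ρ * ∑ a : Fin d, reInner (matPart x a.succ 0) (matPart y a.succ 0)
        + 1 / (4 * ρ ^ 2) * ((ρ + c) / (ρ + 2 * c))
          * ((zPart x - 2 * c * (matPart x 0 0).im) * (zPart y - 2 * c * (matPart y 0 0).im))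
        + (ρ + 2 * c) / (4 * ρ ^ 2) * reInner (vecPart x 0) (vecPart y 0)
        + 1 / (4 * ρ) * ∑ a : Fin d, reInner (vecPart x a.succ) (vecPart y a.succ) := by
  have h8 : ∀ z w : ℂ, reInner ((1 / (2 * √2) : ℝ) • z) ((1 / (2 * √2) : ℝ) • w)
      = 1 / 8 * reInner z w := fun z w => by
    rw [reInner_smul, reInner_symm, reInner_smul, reInner_symm, ← mul_assoc]
    congr 1
    have := Real.mul_self_sqrt (show (0 : ℝ) ≤ 2 by norm_num)
    field_simp
    nlinarith
  have hw : ∀ x : SolvLie d, (killingField c 0 x).2.2 = (1 / (2 * √2) : ℝ) • vecPart x :=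
    fun x => by
      rw [killingField_snd_snd]
      simp
  have hX : ∀ (x : SolvLie d) (i : Fin d), (killingField c 0 x).1 i = matPart x i.succ 0 :=
    fun x i => by
      rw [killingField_fst, mulVec_lift_zero]
      simp
  have hp : ∀ x : SolvLie d, phiForm c 0 (killingField c 0 x)
      = zPart x - 2 * c * (matPart x 0 0).im := fun x => by
    rw [phiForm_eq, killingField_snd_fst, mulVec_lift_zero]
    simp [omega_zero_right, omega_zero_left, xForm]
    ring
  have hx : ∀ u : Coord d, xForm 0 u = 0 := fun u => by simp [xForm]
  have hwf : ∀ u : Coord d, wForm 0 u = u.2.2 0 := fun u => by simp [wForm]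
  have hh : hFun (0 : Coord d) = 1 := by simp [hFun]
  rw [solvMetric_form, levelMetric, oneLoopMetric]
  simp only [hp, hx, hwf, hh, hw, hX, Pi.smul_apply, h8, ← Finset.mul_sum]
  simp [reInner]
  field_simp
  ring

/-- The shift of the central coordinate in `toModel` absorbs the term `-2c Im (Aζ)⁰` of `α(x)`. -/
theorem solvMetric_form_model {m : ℕ} (c ρ : ℝ) (hc : 0 ≤ c) (hρ : 0 < ρ)
    (x y : SolvLie (m + 1)) : (solvMetric (m + 1) c ρ hc hρ).form x y
      = modelForm ((ρ + c) / ρ) (1 / (4 * ρ ^ 2) * ((ρ + c) / (ρ + 2 * c)))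
        ((ρ + 2 * c) / (4 * ρ ^ 2)) (1 / (4 * ρ)) (toModel c x) (toModel c y) := by
  have h : ∀ x : SolvLie (m + 1), (matPart x 0 0).im = (matPart x 1 0).im := fun x => by
    rw [(hasIwasawaShape_matPart x).apply_zero_zero]
    simp
  rw [solvMetric_form_eq, toModel_apply, toModel_apply, h, h]
  simp [modelForm, reInner, Fin.sum_univ_succ, dotProduct, Finset.sum_add_distrib]
  ring

/-! ### Solvability and nilpotency -/

theorem isSolvable_solvLie_succ (m : ℕ) : LieAlgebra.IsSolvable (SolvLie (m + 1)) := by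
  -- vanishing of `r`, then of `z`, then of `t`, then of everything but the central coordinate
  let S : ℕ → Submodule ℝ (Model m)
    | 0 => ⊤
    | 1 => Submodule.prod ⊥ ⊤
    | 2 => .prod ⊥ (.prod ⊤ (.prod ⊤ (.prod ⊤ (.prod ⊤ (.prod ⊤ (.prod ⊤
        (.prod ⊥ (.prod ⊥ ⊤))))))))
    | 3 => .prod ⊥ (.prod ⊥ (.prod ⊤ (.prod ⊤ (.prod ⊤ (.prod ⊤ (.prod ⊤
        (.prod ⊥ (.prod ⊥ ⊤))))))))
    | 4 => .prod ⊥ (.prod ⊥ (.prod ⊤ ⊥))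
    | _ => ⊥
  have key := derivedSeries_le_of_chain (𝔤 := SolvLie (m + 1))
    (fun k => (S k).comap (toModel 0).toLinearMap) (by simp [S]) (fun k x hx y hy => by
      simp only [Submodule.mem_comap, LinearEquiv.coe_coe] at hx hy ⊢
      rw [toModel_lie]
      generalize toModel 0 x = x' at hx ⊢
      generalize toModel 0 y = y' at hy ⊢
      obtain ⟨r, t, s, p₁, p₂, q₁, q₂, z₁, z₂, u₁, u₂⟩ := x'
      obtain ⟨R, T, _, P₁, P₂, Q₁, Q₂, Z₁, Z₂, U₁, U₂⟩ := y'
      match k with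
      | 0 => simp [S, modelBracket]
      | 1 =>
        simp [S] at hx hy
        simp [S, modelBracket, hx, hy]
      | 2 =>
        simp [S] at hx hy
        simp [S, modelBracket, hx, hy]
      | 3 =>
        simp [S] at hx hy
        simp [S, modelBracket, hx, hy]
      | 4 =>
        simp [S] at hx hy
        simp [S, modelBracket, hx, hy]
      | k + 5 =>
        simp [S] at hx hy
        simp [S, modelBracket, hx, hy]) 5
  refine LieAlgebra.IsSolvable.mk (R := ℝ) (k := 5) ?_
  rw [← LieSubmodule.toSubmodule_eq_bot, eq_bot_iff]
  refine key.trans fun x hx => ?_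
  simpa [S] using hx

theorem matPart_eq_zero (x : SolvLie 0) : matPart x = 0 := by
  rw [← coe_right_eq_matPart, eq_zero_of_col _ x.right.2 fun b => b.elim0]
  rfl

/-- For `n = 1` the algebra `𝔟` is zero, and `𝔩` is the Heisenberg algebra. -/
theorem isNilpotent_solvLie_zero : LieRing.IsNilpotent (SolvLie 0) := by
  have h1 : LieSubmodule.toSubmodule (LieModule.lowerCentralSeries ℝ (SolvLie 0) (SolvLie 0) 1)
      ≤ LinearMap.ker (vecPart (d := 0)) := by
    rw [LieModule.lowerCentralSeries_succ]
    refine lie_le_of_forall _ _ _ fun x _ y _ => ?_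
    rw [LinearMap.mem_ker, vecPart_lie, matPart_eq_zero, matPart_eq_zero]
    simp
  rw [LieRing.IsNilpotent, LieModule.isNilpotent_iff ℝ]
  refine ⟨2, ?_⟩
  rw [LieModule.lowerCentralSeries_succ, ← LieSubmodule.toSubmodule_eq_bot, eq_bot_iff]
  refine lie_le_of_forall _ _ _ fun x _ y hy => (Submodule.mem_bot ℝ).2 ?_
  have hv : vecPart y = 0 := h1 hy
  refine solvLie_ext (fun b => b.elim0) ?_ ?_
  · rw [vecPart_lie, matPart_eq_zero, matPart_eq_zero, map_zero]
    simp
  · rw [zPart_lie, hv, omega_zero_right, map_zero]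

theorem isSolvable_solvLie (d : ℕ) : LieAlgebra.IsSolvable (SolvLie d) := by
  cases d with
  | zero =>
    have := isNilpotent_solvLie_zero
    infer_instance
  | succ m => exact isSolvable_solvLie_succ m

/-! ### The grading derivation and solitons -/

/-- The linear map that is `0` on `𝔟`, multiplication by `κ` on `ℂ^n` and multiplication by `2κ`
on the centre. -/
def gradingMap (d : ℕ) (κ : ℝ) : Module.End ℝ (SolvLie d) where
  toFun x := ⟨(κ • vecPart x, 2 * κ * zPart x), 0⟩
  map_add' x y := by
    refine solvLie_ext (fun b => (add_zero (0 : ℂ)).symm) ?_ ?_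
    · change κ • vecPart (x + y) = κ • vecPart x + κ • vecPart y
      rw [map_add, smul_add]
    · change 2 * κ * zPart (x + y) = 2 * κ * zPart x + 2 * κ * zPart y
      rw [map_add, mul_add]
  map_smul' r x := by
    refine solvLie_ext (fun b => (smul_zero r).symm) ?_ ?_
    · change κ • vecPart (r • x) = r • κ • vecPart x
      rw [map_smul, smul_comm]
    · change 2 * κ * zPart (r • x) = r * (2 * κ * zPart x)
      rw [map_smul, smul_eq_mul, mul_left_comm]

theorem matPart_gradingMap (κ : ℝ) (x : SolvLie d) : matPart (gradingMap d κ x) = 0 := rfl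

theorem vecPart_gradingMap (κ : ℝ) (x : SolvLie d) :
    vecPart (gradingMap d κ x) = κ • vecPart x := rfl

theorem zPart_gradingMap (κ : ℝ) (x : SolvLie d) :
    zPart (gradingMap d κ x) = 2 * κ * zPart x := rfl

/-- The map `gradingMap d κ` is a derivation: the central part of the bracket is quadratic in the
vector parts, and `𝔟` acts linearly on the vector part. -/
def gradingDerivation (d : ℕ) (κ : ℝ) : LieDerivation ℝ (SolvLie d) (SolvLie d) where
  toLinearMap := gradingMap d κ
  leibniz' x y := by
    refine solvLie_ext (fun b => ?_) ?_ ?_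
    · rw [map_sub, matPart_lie, matPart_lie, matPart_gradingMap, matPart_gradingMap,
        matPart_gradingMap]
      simp
    · rw [map_sub, vecPart_lie, vecPart_lie, vecPart_gradingMap, vecPart_gradingMap,
        vecPart_gradingMap, matPart_gradingMap, matPart_gradingMap, vecPart_lie,
        Matrix.transpose_zero, Matrix.zero_mulVec, Matrix.zero_mulVec,
        Matrix.mulVec_smul, Matrix.mulVec_smul]
      module
    · rw [map_sub, zPart_lie, zPart_lie, zPart_gradingMap, vecPart_gradingMap,
        vecPart_gradingMap, zPart_lie, omega_smul_right, omega_smul_right, omega_swap (vecPart y)]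
      ring

theorem isAlgebraicRicciSoliton_of_quadratic (g : LeftInvariantMetric (SolvLie d)) (l κ : ℝ)
    (hs : ∀ x y, g.form (gradingMap d κ x) y = g.form x (gradingMap d κ y))
    (h : ∀ x, g.ricciTensor x x = l * g.form x x + g.form (gradingMap d κ x) x) :
    g.IsAlgebraicRicciSoliton := by
  refine ⟨l, gradingDerivation d κ, fun x => ?_⟩
  refine g.ricci_eq_of_quadratic (l • LinearMap.id + gradingMap d κ)
    (fun x y => ?_) (fun x => ?_) x
  · change g.form (l • x + gradingMap d κ x) y = g.form x (l • y + gradingMap d κ y)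
    rw [map_add, map_add, map_smul, map_smul, LinearMap.add_apply, LinearMap.smul_apply, hs]
  · change _ = g.form (l • x + gradingMap d κ x) x
    rw [h, map_add, map_smul]
    rfl

theorem isSolvsoliton_solvMetric_zero (m : ℕ) (ρ : ℝ) (hρ : 0 < ρ) :
    (solvMetric (m + 1) 0 ρ le_rfl hρ).IsSolvsoliton := by
  have hb : 1 / (4 * ρ) ≠ 0 := by positivity
  have hform : ∀ x y, (solvMetric (m + 1) 0 ρ le_rfl hρ).form x y
      = modelForm 1 (4 * (1 / (4 * ρ)) ^ 2) (1 / (4 * ρ)) (1 / (4 * ρ))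
        (toModel 0 x) (toModel 0 y) := fun x y => by
    rw [solvMetric_form_model]
    congr 1 <;> field_simp <;> ring
  have hgr : ∀ x, toModel 0 (gradingMap (m + 1) (2 * m + 6) x)
      = (0, 0, (4 * m + 12) * (toModel 0 x).2.2.1, (2 * m + 6 : ℝ) • (toModel 0 x).2.2.2.1,
        (2 * m + 6 : ℝ) • (toModel 0 x).2.2.2.2.1, (2 * m + 6 : ℝ) • (toModel 0 x).2.2.2.2.2.1,
        (2 * m + 6 : ℝ) • (toModel 0 x).2.2.2.2.2.2.1, 0, 0,
        (2 * m + 6 : ℝ) • (toModel 0 x).2.2.2.2.2.2.2.2.2.1,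
        (2 * m + 6 : ℝ) • (toModel 0 x).2.2.2.2.2.2.2.2.2.2) := fun x => by
    rw [toModel_apply, toModel_apply, matPart_gradingMap, vecPart_gradingMap, zPart_gradingMap]
    simp only [Prod.mk.injEq, Matrix.zero_apply, Complex.zero_re, Complex.zero_im, Pi.smul_apply,
      Complex.smul_re, Complex.smul_im, true_and]
    exact ⟨by ring, rfl, rfl, rfl, rfl⟩
  refine ⟨isSolvable_solvLie _,
    isAlgebraicRicciSoliton_of_quadratic _ (-(2 * m + 8)) (2 * m + 6) (fun x y => ?_) fun x => ?_⟩
  · rw [hform, hform, hgr, hgr]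
    generalize toModel 0 x = X
    generalize toModel 0 y = Y
    simp only [modelForm, smul_dotProduct, dotProduct_smul, smul_eq_mul, zero_dotProduct,
      dotProduct_zero]
    ring
  · rw [ricciTensor_of_model_zero _ (toModel 0) (toModel_lie 0) hb hform, hform, hform, hgr]
    generalize toModel 0 x = X
    simp only [modelForm, smul_dotProduct, smul_eq_mul, zero_dotProduct]
    ring

/-! ### The Heisenberg algebra -/

/-- Coordinates on the Heisenberg algebra `𝔩 = 𝔥𝔢𝔦𝔰₃` for `n = 1`. -/
def heisModel : SolvLie 0 ≃ₗ[ℝ] ℝ × ℝ × ℝ where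
  toFun x := ((vecPart x 0).re, (vecPart x 0).im, zPart x)
  map_add' x y := by
    rw [map_add, map_add]
    rfl
  map_smul' r x := by
    rw [map_smul, map_smul]
    simp
  invFun p := ⟨((fun _ => ⟨p.1, p.2.1⟩), p.2.2), 0⟩
  left_inv x := solvLie_ext (fun b => b.elim0) (funext fun i => by
    rw [Fin.fin_one_eq_zero i]
    rfl) rfl
  right_inv p := rfl

theorem heisModel_apply (x : SolvLie 0) :
    heisModel x = ((vecPart x 0).re, (vecPart x 0).im, zPart x) := rfl

theorem heisModel_lie (x y : SolvLie 0) : heisModel ⁅x, y⁆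
    = (0, 0, (heisModel x).1 * (heisModel y).2.1 - (heisModel x).2.1 * (heisModel y).1) := by
  rw [heisModel_apply, heisModel_apply, heisModel_apply, vecPart_lie, zPart_lie, matPart_eq_zero,
    matPart_eq_zero]
  simp [omega]
  ring

theorem trace_heisModel (f : Module.End ℝ (SolvLie 0)) : LinearMap.trace ℝ (SolvLie 0) f
    = (heisModel (f (heisModel.symm (1, 0, 0)))).1
      + ((heisModel (f (heisModel.symm (0, 1, 0)))).2.1
        + (heisModel (f (heisModel.symm (0, 0, 1)))).2.2) := by
  rw [← LinearMap.trace_conj' f heisModel]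
  simp only [trace_prod, trace_real, LinearMap.comp_apply, LinearMap.fst_apply,
    LinearMap.snd_apply, LinearMap.inl_apply, LinearMap.inr_apply,
    LinearEquiv.conj_apply_apply]
  rfl

theorem nabla_of_heisModel (g : LeftInvariantMetric (SolvLie 0)) {l a : ℝ} (ha : a ≠ 0)
    (hg : ∀ x y, g.form x y = a * ((heisModel x).1 * (heisModel y).1
      + (heisModel x).2.1 * (heisModel y).2.1) + l * ((heisModel x).2.2 * (heisModel y).2.2))
    (x y : SolvLie 0) : heisModel (g.nabla x y)
      = (l / (2 * a) * ((heisModel x).2.2 * (heisModel y).2.1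
          + (heisModel y).2.2 * (heisModel x).2.1),
        -(l / (2 * a)) * ((heisModel x).2.2 * (heisModel y).1
          + (heisModel y).2.2 * (heisModel x).1),
        1 / 2 * ((heisModel x).1 * (heisModel y).2.1 - (heisModel x).2.1 * (heisModel y).1)) := by
  rw [← LinearEquiv.eq_symm_apply]
  refine g.form_ext fun w => ?_
  rw [LeftInvariantMetric.form_nabla]
  simp only [hg, heisModel_lie, LinearEquiv.apply_symm_apply]
  field_simp
  ring

theorem ricciTensor_of_heisModel (g : LeftInvariantMetric (SolvLie 0)) {l a : ℝ} (ha : a ≠ 0)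
    (hg : ∀ x y, g.form x y = a * ((heisModel x).1 * (heisModel y).1
      + (heisModel x).2.1 * (heisModel y).2.1) + l * ((heisModel x).2.2 * (heisModel y).2.2))
    (y : SolvLie 0) : g.ricciTensor y y
      = -(l / (2 * a)) * ((heisModel y).1 ^ 2 + (heisModel y).2.1 ^ 2)
        + l ^ 2 / (2 * a ^ 2) * (heisModel y).2.2 ^ 2 := by
  rw [LeftInvariantMetric.ricciTensor_eq, trace_heisModel, trace_heisModel]
  simp only [LieAlgebra.ad_apply, heisModel_lie, Module.End.mul_apply,
    LeftInvariantMetric.nablaFlip_apply, nabla_of_heisModel g ha hg, LinearEquiv.apply_symm_apply]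
  field_simp
  ring

theorem isNilsoliton_solvMetric (c ρ : ℝ) (hc : 0 ≤ c) (hρ : 0 < ρ) :
    (solvMetric 0 c ρ hc hρ).IsNilsoliton := by
  obtain ⟨a, ha⟩ : ∃ a, a = (ρ + 2 * c) / (4 * ρ ^ 2) := ⟨_, rfl⟩
  obtain ⟨l, hl⟩ : ∃ l, l = 1 / (4 * ρ ^ 2) * ((ρ + c) / (ρ + 2 * c)) := ⟨_, rfl⟩
  have ha0 : a ≠ 0 := by
    rw [ha]
    positivity
  have hform : ∀ x y, (solvMetric 0 c ρ hc hρ).form x y = a * ((heisModel x).1 * (heisModel y).1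
      + (heisModel x).2.1 * (heisModel y).2.1)
      + l * ((heisModel x).2.2 * (heisModel y).2.2) := fun x y => by
    rw [solvMetric_form_eq, heisModel_apply, heisModel_apply, matPart_eq_zero, matPart_eq_zero,
      ← ha, ← hl]
    simp [reInner]
    ring
  have hgr : ∀ κ x, heisModel (gradingMap 0 κ x)
      = (κ * (heisModel x).1, κ * (heisModel x).2.1, 2 * κ * (heisModel x).2.2) := fun κ x => by
    rw [heisModel_apply, heisModel_apply, vecPart_gradingMap, zPart_gradingMap]
    simp
  refine ⟨isNilpotent_solvLie_zero, isAlgebraicRicciSoliton_of_quadratic _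
    (-(3 * l) / (2 * a ^ 2)) (l / a ^ 2) (fun x y => ?_) fun x => ?_⟩
  · rw [hform, hform, hgr, hgr]
    ring
  · rw [ricciTensor_of_heisModel _ ha0 hform, hform, hform, hgr]
    field_simp
    ring

/-! ### Failure of the soliton equation and of normality -/

section

variable {m : ℕ} {c k l a b : ℝ} {𝔤 : Type*} [LieRing 𝔤] [LieAlgebra ℝ 𝔤] [FiniteDimensional ℝ 𝔤]

/-- Applying a derivation `D` to `[R, e₀] = -e₁` and `[R, e₁] = -e₀` shows that its diagonal
coefficients on `e₀` and `e₁` agree; the diagonal Ricci curvatures do not. -/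
theorem not_isAlgebraicRicciSoliton_of_model (g : LeftInvariantMetric 𝔤) (Φ : 𝔤 ≃ₗ[ℝ] Model m)
    (hΦ : ∀ x y, Φ ⁅x, y⁆ = modelBracket c (Φ x) (Φ y))
    (hg : ∀ x y, g.form x y = modelForm k l a b (Φ x) (Φ y))
    (hk : 0 < k) (hl : 0 < l) (hb : 0 < b) (hab : b < a) : ¬ g.IsAlgebraicRicciSoliton := by
  rintro ⟨lam, D, hD⟩
  have ha := hb.trans hab
  set R := Φ.symm (1, 0, 0, 0, 0, 0, 0, 0, 0, 0, 0) with hR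
  set e₀ := Φ.symm (0, 0, 0, 1, 0, 0, 0, 0, 0, 0, 0) with he₀
  set e₁ := Φ.symm (0, 0, 0, 0, 0, 1, 0, 0, 0, 0, 0) with he₁
  replace hR : Φ R = _ := (LinearEquiv.eq_symm_apply Φ).1 hR
  replace he₀ : Φ e₀ = _ := (LinearEquiv.eq_symm_apply Φ).1 he₀
  replace he₁ : Φ e₁ = _ := (LinearEquiv.eq_symm_apply Φ).1 he₁
  have h0 : ⁅R, e₀⁆ = -e₁ := Φ.injective (by
    rw [hΦ, map_neg, hR, he₀, he₁]
    simp [modelBracket])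
  have h1 : ⁅R, e₁⁆ = -e₀ := Φ.injective (by
    rw [hΦ, map_neg, hR, he₀, he₁]
    simp [modelBracket])
  have d0 := congrArg (fun x => (Φ x).2.2.2.2.2.1) (D.apply_lie_eq_sub R e₀)
  have d1 := congrArg (fun x => (Φ x).2.2.2.1) (D.apply_lie_eq_sub R e₁)
  simp only [h0, h1, map_neg, map_sub, hΦ, hR, he₀, he₁] at d0 d1
  have r0 := g.form_ricci e₀ e₀
  have r1 := g.form_ricci e₁ e₁
  rw [ricciTensor_of_model_time g Φ hΦ hg hk.ne' ha.ne' hb.ne' e₀ he₀, hD, hg, map_add, map_smul,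
    he₀] at r0
  rw [ricciTensor_of_model_space g Φ hΦ hg hk.ne' ha.ne' hb.ne' e₁ he₁, hD, hg, map_add, map_smul,
    he₁] at r1
  generalize Φ (D R) = x at *
  generalize Φ (D e₀) = y at *
  generalize Φ (D e₁) = z at *
  -- with `r` the first coordinate of `D R`, the diagonal coefficients `α₀`, `α₁` of `D` on `e₀`,
  -- `e₁` satisfy `α₁ = α₀ + r` and `α₀ = α₁ + r`
  simp [modelBracket] at d0 d1
  have s0 : lam + y.2.2.2.1 = (m + 1) * (a / (k * b) - b / (k * a)) - l / (2 * a ^ 2) :=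
    by simpa [modelForm, ha.ne'] using r0
  have s1 : lam + z.2.2.2.2.2.1 = b / (k * a) - a / (k * b) - l / (2 * b ^ 2) :=
    by simpa [modelForm, hb.ne'] using r1
  have t1 : b / (k * a) < a / (k * b) := by
    rw [div_lt_div_iff₀ (by positivity) (by positivity)]
    nlinarith [mul_pos hk (sub_pos.2 hab)]
  have t2 : l / (2 * a ^ 2) < l / (2 * b ^ 2) := by gcongr
  have t3 : 0 ≤ (m + 1 : ℝ) * (a / (k * b) - b / (k * a)) :=
    mul_nonneg (by positivity) (sub_pos.2 t1).le
  linarith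

/-- For `f = ad R` one has `f e₀ = -e₁` and `f e₁ = -e₀`. If `f` commuted with its adjoint, then
`⟨f f^* e₀, e₀⟩ = ⟨f^* f e₀, e₀⟩` would read `a² / b = b`. -/
theorem not_isNormal_ad_of_model (g : LeftInvariantMetric 𝔤) (Φ : 𝔤 ≃ₗ[ℝ] Model m)
    (hΦ : ∀ x y, Φ ⁅x, y⁆ = modelBracket c (Φ x) (Φ y))
    (hg : ∀ x y, g.form x y = modelForm k l a b (Φ x) (Φ y))
    (hb : 0 < b) (hab : b < a) (R : 𝔤) (hR : Φ R = (1, 0, 0, 0, 0, 0, 0, 0, 0, 0, 0)) :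
    ¬ g.IsNormal (LieAlgebra.ad ℝ 𝔤 R) := by
  intro h
  set e₀ := Φ.symm (0, 0, 0, 1, 0, 0, 0, 0, 0, 0, 0) with he₀
  set e₁ := Φ.symm (0, 0, 0, 0, 0, 1, 0, 0, 0, 0, 0) with he₁
  replace he₀ : Φ e₀ = _ := (LinearEquiv.eq_symm_apply Φ).1 he₀
  replace he₁ : Φ e₁ = _ := (LinearEquiv.eq_symm_apply Φ).1 he₁
  rw [LeftInvariantMetric.IsNormal] at h
  have hadj := LinearMap.BilinForm.isAdjointPairLeftAdjointOfNondegenerate g.form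
    g.nondegenerate (LieAlgebra.ad ℝ 𝔤 R)
  generalize g.form.leftAdjointOfNondegenerate g.nondegenerate (LieAlgebra.ad ℝ 𝔤 R) = f at *
  have hadj' : ∀ x y, g.form (f x) y = g.form x ⁅R, y⁆ := fun x y => hadj x y
  have e : ⁅R, f e₀⁆ = f ⁅R, e₀⁆ := LinearMap.congr_fun h e₀
  have e1 : g.form ⁅R, f e₀⁆ e₀ = g.form ⁅R, e₀⁆ ⁅R, e₀⁆ := by rw [e, hadj']
  have e2 := hadj' e₀ e₁
  simp only [hg, hΦ, hR, he₀, he₁] at e1 e2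
  generalize Φ (f e₀) = y at *
  simp [modelBracket, modelForm] at e1 e2
  -- the coordinate `q₁` of `f e₀` is `-a / b` by `e2`, and `-b / a` by `e1`
  nlinarith

end

theorem toModel_solvBR {m : ℕ} (c : ℝ) :
    toModel c (solvBR (0 : Fin (m + 1))) = (1, 0, 0, 0, 0, 0, 0, 0, 0, 0, 0) := by
  have h : ∀ b : Fin (m + 1), matPart (solvBR (0 : Fin (m + 1))) b.succ 0
      = if 0 = b then 1 else 0 := fun b => by
      have h0 : (0 : Fin (m + 1)) = firstIdx 0 := rfl
      rw [← coe_right_eq_matPart, show (1 : ℂ) = if (0 : Fin (m + 1)) = firstIdx 0 then 1 else 1 / 2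
        by rw [if_pos h0]]
      exact bR_col 0 b
  have h1 : matPart (solvBR (0 : Fin (m + 1))) 1 0 = 1 := h 0
  have h2 : ∀ b : Fin m, matPart (solvBR (0 : Fin (m + 1))) b.succ.succ 0 = 0 := fun b => by
    rw [h, if_neg (Fin.succ_ne_zero b).symm]
  have hv : vecPart (solvBR (0 : Fin (m + 1))) = 0 := rfl
  have hz : zPart (solvBR (0 : Fin (m + 1))) = 0 := rfl
  rw [toModel_apply, hv, hz]
  simp only [h1, h2]
  simp
  rfl

end

end OneLoop

end

theorem theorem1p1 (n : ℕ) (hn : 1 ≤ n) (c ρ : ℝ) (hc : 0 ≤ c) (hρ : 0 < ρ) :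
    OneLoop.IsSimplyTransitiveIsometricAction (OneLoop.levelDomain (n - 1))
        (OneLoop.levelMetric c ρ) (OneLoop.killingField c) ∧
    LieAlgebra.IsSolvable (OneLoop.SolvLie (n - 1)) ∧
    (n = 1 → (OneLoop.solvMetric (n - 1) c ρ hc hρ).IsNilsoliton) ∧
    (1 < n → c = 0 → (OneLoop.solvMetric (n - 1) c ρ hc hρ).IsSolvsoliton) ∧
    (1 < n → 0 < c → ¬ (OneLoop.solvMetric (n - 1) c ρ hc hρ).IsSolvsoliton) ∧
    (∀ h : 1 < n, 0 < c →
      ¬ (OneLoop.solvMetric (n - 1) c ρ hc hρ).IsNormal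
        (LieAlgebra.ad ℝ (OneLoop.SolvLie (n - 1))
          (OneLoop.solvBR ⟨0, Nat.sub_pos_of_lt h⟩))) := by
  refine ⟨OneLoop.isSimplyTransitiveIsometricAction_killingField _ c ρ,
    OneLoop.isSolvable_solvLie _, ?_, ?_, ?_, ?_⟩
  · rintro rfl
    exact OneLoop.isNilsoliton_solvMetric c ρ hc hρ
  · rintro h rfl
    obtain ⟨m, rfl⟩ := Nat.exists_eq_add_of_le' h
    exact OneLoop.isSolvsoliton_solvMetric_zero m ρ hρ
  all_goals
    intro h hc0
    obtain ⟨m, rfl⟩ := Nat.exists_eq_add_of_le' h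
    have hb : 0 < 1 / (4 * ρ) := by positivity
    have hab : 1 / (4 * ρ) < (ρ + 2 * c) / (4 * ρ ^ 2) := by
      rw [div_lt_div_iff₀ (by positivity) (by positivity)]
      nlinarith [mul_pos hc0 hρ]
  · exact fun hs => OneLoop.not_isAlgebraicRicciSoliton_of_model _ (OneLoop.toModel c)
      (OneLoop.toModel_lie c) (OneLoop.solvMetric_form_model c ρ hc hρ) (by positivity)
      (by positivity) hb hab hs.2
  · exact OneLoop.not_isNormal_ad_of_model _ (OneLoop.toModel c)
      (OneLoop.toModel_lie c) (OneLoop.solvMetric_form_model c ρ hc hρ) hb hab _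
      (OneLoop.toModel_solvBR c)
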